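/- **Setting.** Let $\mathsf{AP}$ be a finite set of atomic propositions. A Kripke structure $\mathcal K=\langle S,s_{init},\delta,L\rangle$ has a finite set $S$ of states, an initial state $s_{init}\in S$, a transition relation $\delta\subseteq S\times S$ in which every state has a successor, and a labeling $L:S\to 2^{\mathsf{AP}}$; its size is $|S|$. It is *acyclic* if the only loops of $(S,\delta)$ are self-loops on states that have no other outgoing transition. Its traces are the sequences $L(s_0)L(s_1)\cdots$ for the infinite paths $s_0s_1\cdots$ with $s_0=s_{init}$. A HyperLTL formula is a sequence of quantifiers $\exists\pi$, $\forall\pi$ over trace variables, followed by a quantifier-free formula built from $\mathsf{true}$, atoms $a_\pi$ ($a\in\mathsf{AP}$), $\neg$, $\vee$, next and until; the quantifiers range over the traces of the structure, and the semantics is the usual one. $\mathrm{A}^*$-HyperLTL consists of the formulas whose quantifiers (possibly none) are all universal; $\mathrm{EA}^*$-HyperLTL consists of the formulas with one existential quantifier followed by a possibly empty block of universal quantifiers. For a closed formula $\varphi$, the *repair problem* $\mathrm{PR}_\varphi$ on acyclic Kripke structures is the following decision problem. An instance is an acyclic Kripke structure $\mathcal K=\langle S,s_{init},\delta,L\rangle$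 (over the atomic propositions of $\varphi$, with $S=\{0,\dots,n-1\}$, encoded as a word that lists, for each state, its label, whether it is initial, and its row of the adjacency matrix, so that the word has length $n(n+1)$). The question is whether there is a $\delta'\subseteq\delta$ such that $\mathcal K'=\langle S,s_{init},\delta',L\rangle$ is a Kripke structure (so every state still has a successor) and $\mathcal K'\models\varphi$. **Theorem.** The repair problems for $\mathrm{A}^*$-HyperLTL and for $\mathrm{EA}^*$-HyperLTL on acyclic Kripke structures are NL-complete in the size of the Kripke structure. That is, for each of the two fragments: 1. for every finite $\mathsf{AP}$ and every closed formula $\varphi$ over $\mathsf{AP}$ in the fragment, $\mathrm{PR}_\varphi$ is in NL: some nondeterministic Turing machine with a read-only input tape, whose work space is $O(\log m)$ on all inputs of length $m$ and all computations, accepts the encoding of an acyclic Kripke structure if and only if the answer for that structure is yes; 2. there are a finite $\mathsf{AP}$ and a closed formula $\varphi$ over $\mathsf{AP}$ in the fragment such that $\mathrm{PR}_\varphi$ is NL-hard: for every language $A$ in NL over a finite alphabet there is a function $f$, computable by a deterministic logarithmic-space Turing machine with output tape, that maps each word $w$ to the encoding of an acyclic Kripke structure whose answer is yes if and only if $w\in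 A$. -/

import Mathlib

/-! ### Kripke structures -/

/-- A Kripke structure with state space `S`; letters are subsets of `AP`. -/
structure Kripke (AP S : Type) where
  initial : S
  trans : S → S → Prop
  label : S → Set AP
  total : ∀ s, ∃ s', trans s s'

namespace Kripke

variable {AP S : Type}

/-- `s 0, s 1, …, s n` is a loop of the Kripke frame. -/
def IsLoop (K : Kripke AP S) (n : ℕ) (s : ℕ → S) : Prop :=
  (∀ i < n, K.trans (s i) (s (i + 1))) ∧ K.trans (s n) (s 0)

/-- The only loops are self-loops on otherwise terminal states: a state on a loop has no outgoing
transition except the one to itself (hence all the states of a loop coincide). -/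
def Acyclic (K : Kripke AP S) : Prop :=
  ∀ (n : ℕ) (s : ℕ → S), K.IsLoop n s → ∀ i ≤ n, ∀ s', K.trans (s i) s' → s' = s i

def IsPath (K : Kripke AP S) (p : ℕ → S) : Prop :=
  p 0 = K.initial ∧ ∀ i, K.trans (p i) (p (i + 1))

/-- The traces of the paths that start in the initial state. -/
def Traces (K : Kripke AP S) : Set (ℕ → Set AP) :=
  {t | ∃ p, K.IsPath p ∧ ∀ i, t i = K.label (p i)}

end Kripke

/-! ### HyperLTL; the trace variables are the natural numbers -/

/-- Quantifier-free formulas. -/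
inductive HyperBody (AP : Type) : Type
  | tru : HyperBody AP
  | atom : AP → ℕ → HyperBody AP
  | neg : HyperBody AP → HyperBody AP
  | or : HyperBody AP → HyperBody AP → HyperBody AP
  | next : HyperBody AP → HyperBody AP
  | untl : HyperBody AP → HyperBody AP → HyperBody AP

inductive HyperLTL (AP : Type) : Type
  | ex : ℕ → HyperLTL AP → HyperLTL AP
  | all : ℕ → HyperLTL AP → HyperLTL AP
  | body : HyperBody AP → HyperLTL AP

/-- Trace assignments: partial maps from trace variables to traces. -/
def TraceAssignment (AP : Type) : Type := ℕ → Option (ℕ → Set AP)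

namespace TraceAssignment

variable {AP : Type}

def empty : TraceAssignment AP := fun _ => none

def set (A : TraceAssignment AP) (v : ℕ) (t : ℕ → Set AP) : TraceAssignment AP :=
  fun u => if u = v then some t else A u

/-- Every assigned trace is replaced by its suffix from position `j`. -/
def suffix (A : TraceAssignment AP) (j : ℕ) : TraceAssignment AP :=
  fun v => (A v).map fun t i => t (j + i)

end TraceAssignment

namespace HyperBody

variable {AP : Type}

def vars : HyperBody AP → Set ℕ
  | tru => ∅
  | atom _ v => {v}
  | neg f => f.vars
  | or f g => f.vars ∪ g.vars
  | next f => f.vars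
  | untl f g => f.vars ∪ g.vars

def Sat : HyperBody AP → TraceAssignment AP → Prop
  | tru, _ => True
  | atom a v, A => ∃ t, A v = some t ∧ a ∈ t 0
  | neg f, A => ¬ f.Sat A
  | or f g, A => f.Sat A ∨ g.Sat A
  | next f, A => f.Sat (A.suffix 1)
  | untl f g, A => ∃ i, g.Sat (A.suffix i) ∧ ∀ j < i, f.Sat (A.suffix j)

end HyperBody

namespace HyperLTL

variable {AP : Type}

def freeVars : HyperLTL AP → Set ℕ
  | ex v f => f.freeVars \ {v}
  | all v f => f.freeVars \ {v}
  | body f => f.vars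

def Closed (f : HyperLTL AP) : Prop := f.freeVars = ∅

def Sat (T : Set (ℕ → Set AP)) : HyperLTL AP → TraceAssignment AP → Prop
  | ex v f, A => ∃ t ∈ T, f.Sat T (A.set v t)
  | all v f, A => ∀ t ∈ T, f.Sat T (A.set v t)
  | body f, A => f.Sat A

/-- The fragment A*: a possibly empty block of universal quantifiers. -/
def IsAStar : HyperLTL AP → Prop
  | ex _ _ => False
  | all _ f => f.IsAStar
  | body _ => True

/-- The fragment EA*: one existential quantifier, then a possibly empty block of universal ones. -/
def IsEAStar : HyperLTL AP → Prop
  | ex _ f => f.IsAStar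
  | all _ _ => False
  | body _ => False

end HyperLTL

/-- The Kripke structure satisfies the formula. -/
def Kripke.Models {AP S : Type} (K : Kripke AP S) (f : HyperLTL AP) : Prop :=
  f.Sat K.Traces TraceAssignment.empty

/-- `K` has a repair for `f`: transitions may be removed so that no state becomes a deadlock
(the field `total` of `K'`) and the formula holds. -/
def Kripke.Repairable {AP S : Type} (K : Kripke AP S) (f : HyperLTL AP) : Prop :=
  ∃ K' : Kripke AP S, K'.initial = K.initial ∧ (∀ s s', K'.trans s s' → K.trans s s') ∧
    K'.label = K.label ∧ K'.Models f

/-! ### Turing machines with a read-only input tape and work tapes -/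

namespace LogSpace

inductive HeadMove : Type
  | left
  | stay
  | right

/-- What the input head can see: an input letter or one of the two end markers. -/
inductive InputCell (Γ : Type) : Type
  | leftEnd : InputCell Γ
  | letter : Γ → InputCell Γ
  | rightEnd : InputCell Γ

/-- The content of the input tape `⊢ w ⊣` at a position in `0, …, |w| + 1`. -/
def inputCell {Γ : Type} (w : List Γ) : ℕ → InputCell Γ
  | 0 => InputCell.leftEnd
  | p + 1 => match w[p]? with
    | some a => InputCell.letter a
    | none => InputCell.rightEnd

/-- The input head never leaves `⊢ w ⊣`. -/
def moveInput (len : ℕ) (p : ℕ) : HeadMove → ℕ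
  | HeadMove.left => p - 1
  | HeadMove.stay => p
  | HeadMove.right => min (p + 1) (len + 1)

def moveWork (h : ℤ) : HeadMove → ℤ
  | HeadMove.left => h - 1
  | HeadMove.stay => h
  | HeadMove.right => h + 1

/-- A configuration with control states `Q`, work alphabet `A` and `k` two-way infinite work
tapes. The input tape is not part of it, since it never changes. -/
structure Config (Q A : Type) (k : ℕ) where
  state : Q
  inputHead : ℕ
  tape : Fin k → ℤ → A
  head : Fin k → ℤ

/-- What a machine does in one step: the new control state, the move of the input head, and on each
work tape the symbol written and the move of its head. -/
structure Action (Q A : Type) (k : ℕ) where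
  state : Q
  inputMove : HeadMove
  write : Fin k → A
  workMove : Fin k → HeadMove

namespace Config

variable {Q A : Type} {k : ℕ}

/-- Control state `q`, all the work tapes blank, the input head on the left end marker. -/
def start (q : Q) (blank : A) : Config Q A k where
  state := q
  inputHead := 0
  tape := fun _ _ => blank
  head := fun _ => 0

/-- The symbols under the work heads. -/
def scanned (c : Config Q A k) : Fin k → A := fun i => c.tape i (c.head i)

def perform (len : ℕ) (c : Config Q A k) (a : Action Q A k) : Config Q A k where
  state := a.state
  inputHead := moveInput len c.inputHead a.inputMove
  tape := fun i => Function.update (c.tape i) (c.head i) (a.write i)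
  head := fun i => moveWork (c.head i) (a.workMove i)

/-- The work heads stand within distance `s` of the starting cell. -/
def Within (c : Config Q A k) (s : ℕ) : Prop := ∀ i, |c.head i| ≤ (s : ℤ)

end Config

/-- Nondeterministic Turing machines with input alphabet `Γ`. -/
structure NTM (Γ : Type) where
  State : Type
  Work : Type
  tapes : ℕ
  finState : Finite State
  finWork : Finite Work
  start : State
  blank : Work
  accept : Set State
  trans : State → InputCell Γ → (Fin tapes → Work) → Set (Action State Work tapes)

namespace NTM

variable {Γ : Type}

def Step (M : NTM Γ) (w : List Γ) (c d : Config M.State M.Work M.tapes) : Prop :=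
  ∃ a ∈ M.trans c.state (inputCell w c.inputHead) c.scanned, d = c.perform w.length a

/-- The configurations that some computation on the input `w` reaches. -/
def Reachable (M : NTM Γ) (w : List Γ) (c : Config M.State M.Work M.tapes) : Prop :=
  Relation.ReflTransGen (M.Step w) (Config.start M.start M.blank) c

/-- The language of the machine: some computation reaches an accepting state. -/
def language (M : NTM Γ) : Language Γ :=
  {w | ∃ c, M.Reachable w c ∧ c.state ∈ M.accept}

/-- On all inputs and all computations, the work space is `O(log n)`. -/
def IsLogSpace (M : NTM Γ) : Prop :=
  ∃ C : ℕ, ∀ w c, M.Reachable w c → c.Within (C * (Nat.log 2 w.length + 1))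

end NTM

/-- The complexity class NL, over the input alphabet `Γ`. -/
def NL (Γ : Type) : Set (Language Γ) :=
  {L | ∃ M : NTM Γ, M.IsLogSpace ∧ M.language = L}

/-- Deterministic Turing machines with input alphabet `Γ` and a write-only output tape over `Δ`: in
each step at most one letter is appended to the output; the machine halts where `trans` is
`none`. -/
structure Transducer (Γ Δ : Type) where
  State : Type
  Work : Type
  tapes : ℕ
  finState : Finite State
  finWork : Finite Work
  start : State
  blank : Work
  trans : State → InputCell Γ → (Fin tapes → Work) →
    Option (Action State Work tapes × Option Δ)

namespace Transducer

variable {Γ Δ : Type}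

/-- One step on a configuration together with the output written so far. -/
def step (M : Transducer Γ Δ) (w : List Γ) (c : Config M.State M.Work M.tapes × List Δ) :
    Option (Config M.State M.Work M.tapes × List Δ) :=
  (M.trans c.1.state (inputCell w c.1.inputHead) c.1.scanned).map
    fun a => (c.1.perform w.length a.1, c.2 ++ a.2.toList)

def Reachable (M : Transducer Γ Δ) (w : List Γ)
    (c : Config M.State M.Work M.tapes × List Δ) : Prop :=
  Relation.ReflTransGen (fun c d => M.step w c = some d) (Config.start M.start M.blank, []) c

/-- The machine halts on every input `w` with output `f w`. -/
def Computes (M : Transducer Γ Δ) (f : List Γ → List Δ) : Prop :=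
  ∀ w, ∃ c, M.Reachable w c ∧ M.step w c = none ∧ c.2 = f w

/-- The work space (the output tape does not count) is `O(log n)`. -/
def IsLogSpace (M : Transducer Γ Δ) : Prop :=
  ∃ C : ℕ, ∀ w c, M.Reachable w c → c.1.Within (C * (Nat.log 2 w.length + 1))

end Transducer

def LogSpaceComputable {Γ Δ : Type} (f : List Γ → List Δ) : Prop :=
  ∃ M : Transducer Γ Δ, M.IsLogSpace ∧ M.Computes f

/-! ### Decision problems -/

/-- A decision problem: a type of instances, their encodings as words over a finite alphabet, and
the instances with answer yes. -/
structure DecisionProblem where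
  Instance : Type
  Letter : Type
  finLetter : Finite Letter
  encode : Instance → List Letter
  encode_injective : Function.Injective encode
  Yes : Instance → Prop

namespace DecisionProblem

/-- A nondeterministic log-space machine answers correctly on all the instances. -/
def InNL (P : DecisionProblem) : Prop :=
  ∃ L ∈ NL P.Letter, ∀ I, P.encode I ∈ L ↔ P.Yes I

/-- Every language in NL, over any finite alphabet, has a log-space many-one reduction to the
problem; the reduction yields an instance for every word. -/
def NLHard (P : DecisionProblem) : Prop :=
  ∀ (Γ : Type) [Finite Γ], ∀ L ∈ NL Γ, ∃ f : List Γ → List P.Letter,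
    LogSpaceComputable f ∧ ∀ w, ∃ I, f w = P.encode I ∧ (w ∈ L ↔ P.Yes I)

end DecisionProblem

end LogSpace

/-! ### The repair problem -/

open Classical in
/-- A Kripke structure with states `0, …, n - 1` as a word: for each state `i` in turn, one letter
that holds the label of `i` and tells whether `i` is the initial state, and then the `n` bits of
row `i` of the adjacency matrix. -/
noncomputable def Kripke.encode {AP : Type} {n : ℕ} (K : Kripke AP (Fin n)) :
    List ((Bool × Set AP) ⊕ Bool) :=
  (List.finRange n).flatMap fun i =>
    Sum.inl (decide (i = K.initial), K.label i) ::
      (List.finRange n).map fun j => Sum.inr (decide (K.trans i j))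

/-- Acyclic Kripke structures with states `0, …, n - 1` for some `n`. -/
def AcyclicKripke (AP : Type) : Type :=
  Σ n : ℕ, {K : Kripke AP (Fin n) // K.Acyclic}

theorem Kripke.encode_injective {AP : Type} :
    Function.Injective fun K : AcyclicKripke AP => K.2.1.encode := by
  have blocks : ∀ {ι α : Type} (l : List ι) (f g : ι → List α),
      (∀ i, (f i).length = (g i).length) → l.flatMap f = l.flatMap g → ∀ i ∈ l, f i = g i := by
    intro ι α l f g hfg
    induction l with
    | nil => simp
    | cons a l ih =>
      intro h
      rw [List.flatMap_cons, List.flatMap_cons] at h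
      obtain ⟨h1, h2⟩ := List.append_inj h (hfg a)
      intro i hi
      rcases List.mem_cons.1 hi with rfl | hi
      · exact h1
      · exact ih h2 i hi
  have len : ∀ {n : ℕ} (K : Kripke AP (Fin n)), K.encode.length = n * (n + 1) := by
    intro n K
    simp [Kripke.encode, List.length_flatMap]
  rintro ⟨n, K, hK⟩ ⟨m, K', hK'⟩ h
  have h : K.encode = K'.encode := h
  have hnm : n = m := by
    have h2 := congrArg List.length h
    rw [len, len] at h2
    rcases lt_trichotomy n m with h3 | h3 | h3
    · nlinarith
    · exact h3
    · nlinarith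
  subst hnm
  have h3 := blocks _ _ _ (by simp) h
  simp only [List.mem_finRange, forall_const, List.cons.injEq, Sum.inl.injEq, Prod.mk.injEq,
    decide_eq_decide, List.map_inj_left, Sum.inr.injEq] at h3
  have hKK : K = K' := by
    cases K
    cases K'
    simp only [Kripke.mk.injEq]
    refine ⟨((h3 _).1.1.1 rfl), ?_, funext fun i => (h3 i).1.2⟩
    funext i j
    exact propext ((h3 i).2 j)
  subst hKK
  rfl

/-- The repair problem for the fixed formula `f` on acyclic Kripke structures. -/
noncomputable def acyclicRepair {AP : Type} [Finite AP] (f : HyperLTL AP) :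
    LogSpace.DecisionProblem where
  Instance := AcyclicKripke AP
  Letter := (Bool × Set AP) ⊕ Bool
  finLetter := inferInstance
  encode := fun K => K.2.1.encode
  encode_injective := Kripke.encode_injective
  Yes := fun K => K.2.1.Repairable f

/-! Membership in NL. Let ψ be the quantifier-free matrix of a closed formula in one of the two
fragments. A total structure has at least one trace. If the formula holds, some single trace t can
be substituted for all variables: any trace in the universal case, the existential witness
otherwise. So ψ holds with every variable bound to t. Conversely, if t is the only trace, ψ on t
suffices. In an acyclic structure a path that revisits a state stays there forever, so a path uses
only one successor of each state it visits, and deleting transitions can isolate it. Hence a repair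
exists if and only if some path has a trace satisfying ψ (`Kripke.Acyclic.repairable_iff`). Such
traces are eventually constant, and a finite automaton that reads them from the end evaluates ψ
(`TailAutomaton.exists_recognizes`). A nondeterministic machine guesses the path state by state
together with the automaton's values, and it stores only two state indices
(`guessMachine.reach_accept_iff`).

Hardness. For ψ = "eventually a", repair is reachability of an a-state. The configurations of a
log-space machine are encoded by a finite control and finitely many registers: the tape halves
become numbers, and a head move is an affine operation on them. A time stamp makes the configuration
graph acyclic. Self-loops occur only at the last moment, and idling makes every earlier node have a
successor. A node is a number whose digits are columns holding one digit of each register and of the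
time, so adjacency is decided by carry arithmetic in one pass over the digits. This lets a log-space
transducer print the matrix (`RegisterSystem.logSpaceComputable_encode`). Reachability in the graph
is acceptance by `RegisterSystem.toKripke_path_iff` and `NTM.accepts_toRegisterSystem_iff`.

Both machines are programmed in a model that sweeps over a list of cells of logarithmic length. The
translation to Turing machines is proved once, in `RulerMachine.exists_mem_NL` and
`RulerMachine.logSpaceComputable`. -/

namespace LogSpace

/-! ### Sweep machines

A sweep machine has a finite control, a two-way input head and a finite list of cells. In one step it
reads the input letter, moves the input head, possibly writes an output letter, and then sweeps once
over the list, rewriting every cell; at the end of the sweep it may append a cell. -/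

structure SweepMachine (Γ Δ : Type) where
  State : Type
  Cell : Type
  finState : Finite State
  finCell : Finite Cell
  start : State
  delta : State → InputCell Γ → Set (State × HeadMove × Option Δ)
  sweep : State → Cell → State × Cell
  extend : State → Option Cell

def sweepList {S C : Type} (f : S → C → S × C) : S → List C → S × List C
  | s, [] => (s, [])
  | s, c :: l => ((sweepList f (f s c).1 l).1, (f s c).2 :: (sweepList f (f s c).1 l).2)

theorem sweepList_length {S C : Type} (f : S → C → S × C) (s : S) (l : List C) :
    (sweepList f s l).2.length = l.length := by
  induction l generalizing s with
  | nil => rfl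
  | cons c l ih => simp [sweepList, ih]

/-- A configuration of a sweep machine, with the output written so far. -/
structure Snapshot (S C Δ : Type) where
  state : S
  head : ℕ
  cells : List C
  output : List Δ

/-- The phases in which a Turing machine simulates one step of a sweep machine. -/
inductive Phase (S : Type) : Type
  | ready : S → Phase S
  | sweeping : S → Phase S
  | back : S → Phase S

instance {S : Type} [Finite S] : Finite (Phase S) := by
  let f : Phase S → S ⊕ S ⊕ S
    | .ready s => .inl s
    | .sweeping s => .inr (.inl s)
    | .back s => .inr (.inr s)
  refine Finite.of_injective f ?_
  rintro (a | a | a) (b | b | b) h <;> simp_all [f]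

/-- Cell -1 always stays blank, so the returning head recognizes the beginning of the list; the
first blank behind the list is the place where it may grow. -/
def tapeOf {C : Type} (l : List C) : ℤ → Option C
  | Int.ofNat n => l[n]?
  | Int.negSucc _ => none

theorem tapeOf_natCast {C : Type} (l : List C) (n : ℕ) : tapeOf l (n : ℤ) = l[n]? := rfl

theorem tapeOf_neg_one {C : Type} (l : List C) : tapeOf l (-1) = none := rfl

theorem tapeOf_nil {C : Type} : tapeOf ([] : List C) = fun _ => none := by
  funext z
  cases z <;> simp [tapeOf]

theorem update_tapeOf_append_cons {C : Type} (pre suf : List C) (c c' : C) :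
    Function.update (tapeOf (pre ++ c :: suf)) (pre.length : ℤ) (some c') =
      tapeOf (pre ++ c' :: suf) := by
  funext z
  by_cases h : z = pre.length
  · subst h
    simp [tapeOf_natCast]
  · rw [Function.update_of_ne h]
    cases z with
    | negSucc => rfl
    | ofNat n =>
      have h : n ≠ pre.length := by
        rintro rfl
        exact h rfl
      simp only [tapeOf, List.getElem?_append]
      split
      · rfl
      · obtain ⟨k, hk⟩ : ∃ k, n - pre.length = k + 1 := ⟨n - pre.length - 1, by omega⟩
        simp [hk]

theorem update_tapeOf_length {C : Type} (l : List C) (e : Option C) :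
    Function.update (tapeOf l) (l.length : ℤ) e = tapeOf (l ++ e.toList) := by
  funext z
  by_cases h : z = l.length
  · subst h
    cases e <;> simp [tapeOf_natCast]
  · rw [Function.update_of_ne h]
    cases z with
    | negSucc => rfl
    | ofNat n =>
      have h : n ≠ l.length := by
        rintro rfl
        exact h rfl
      simp only [tapeOf, List.getElem?_append]
      split
      · rfl
      · obtain ⟨k, hk⟩ : ∃ k, n - l.length = k + 1 := ⟨n - l.length - 1, by omega⟩
        rw [List.getElem?_eq_none (by omega), hk]
        cases e <;> simp

namespace SweepMachine

variable {Γ Δ : Type} (M : SweepMachine Γ Δ)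

abbrev Snap := Snapshot M.State M.Cell Δ

def advance (w : List Γ) (c : M.Snap) (d : M.State × HeadMove × Option Δ) : M.Snap where
  state := (sweepList M.sweep d.1 c.cells).1
  head := moveInput w.length c.head d.2.1
  cells := (sweepList M.sweep d.1 c.cells).2 ++
    (M.extend (sweepList M.sweep d.1 c.cells).1).toList
  output := c.output ++ d.2.2.toList

def Step (w : List Γ) (c d : M.Snap) : Prop :=
  ∃ y ∈ M.delta c.state (inputCell w c.head), d = M.advance w c y

abbrev Reach (w : List Γ) : M.Snap → M.Snap → Prop := Relation.ReflTransGen (M.Step w)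

def initial : M.Snap := ⟨M.start, 0, [], []⟩

/-- What the simulating Turing machine does while it sweeps and goes back. -/
def walk : Phase M.State → Option M.Cell → Action (Phase M.State) (Option M.Cell) 1
  -- A default value: `tmTrans` and `toTransducer` treat this phase separately.
  | .ready s, a => ⟨.ready s, .stay, fun _ => a, fun _ => .stay⟩
  | .sweeping s, some c =>
      ⟨.sweeping (M.sweep s c).1, .stay, fun _ => some (M.sweep s c).2, fun _ => .right⟩
  | .sweeping s, none => ⟨.back s, .stay, fun _ => M.extend s, fun _ => .left⟩
  | .back s, some c => ⟨.back s, .stay, fun _ => some c, fun _ => .left⟩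
  | .back s, none => ⟨.ready s, .stay, fun _ => none, fun _ => .right⟩

/-- How the simulation of one step starts. -/
def launch (a : Fin 1 → Option M.Cell) (d : M.State × HeadMove × Option Δ) :
    Action (Phase M.State) (Option M.Cell) 1 × Option Δ :=
  (⟨.sweeping d.1, d.2.1, a, fun _ => .stay⟩, d.2.2)

def tmTrans : Phase M.State → InputCell Γ → (Fin 1 → Option M.Cell) →
    Set (Action (Phase M.State) (Option M.Cell) 1 × Option Δ)
  | .ready s, x, a => M.launch a '' M.delta s x
  | .sweeping s, _, a => {(M.walk (.sweeping s) (a 0), none)}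
  | .back s, _, a => {(M.walk (.back s) (a 0), none)}

abbrev TMConfig := Config (Phase M.State) (Option M.Cell) 1

def tmStep (w : List Γ) (c d : M.TMConfig × List Δ) : Prop :=
  ∃ y ∈ M.tmTrans c.1.state (inputCell w c.1.inputHead) c.1.scanned,
    d = (c.1.perform w.length y.1, c.2 ++ y.2.toList)

abbrev tmReach (w : List Γ) : M.TMConfig × List Δ → M.TMConfig × List Δ → Prop :=
  Relation.ReflTransGen (M.tmStep w)

def tmConfig (p : Phase M.State) (h : ℕ) (l : List M.Cell) (z : ℤ) : M.TMConfig :=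
  ⟨p, h, fun _ => tapeOf l, fun _ => z⟩

def tmStart : M.TMConfig × List Δ := (Config.start (.ready M.start) none, [])

theorem tmStart_eq : M.tmStart = (M.tmConfig (.ready M.start) 0 [] 0, []) := by
  simp [tmStart, tmConfig, Config.start, tapeOf_nil]

/-! ### Correctness of the simulation -/

variable {M}

theorem perform_launch (n : ℕ) (s : M.State) (h : ℕ) (l : List M.Cell)
    (d : M.State × HeadMove × Option Δ) :
    (M.tmConfig (.ready s) h l 0).perform n
      (M.launch (M.tmConfig (.ready s) h l 0).scanned d).1 =
      M.tmConfig (.sweeping d.1) (moveInput n h d.2.1) l 0 := by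
  simp [tmConfig, Config.perform, launch, Config.scanned, moveWork]

theorem perform_sweep (n : ℕ) (s : M.State) (h : ℕ) (pre suf : List M.Cell) (c : M.Cell) :
    (M.tmConfig (.sweeping s) h (pre ++ c :: suf) pre.length).perform n
      (M.walk (.sweeping s) (some c)) =
      M.tmConfig (.sweeping (M.sweep s c).1) h ((pre ++ [(M.sweep s c).2]) ++ suf)
        (pre ++ [(M.sweep s c).2]).length := by
  simp [tmConfig, Config.perform, walk, moveWork, moveInput, update_tapeOf_append_cons]

theorem perform_turn (n : ℕ) (s : M.State) (h : ℕ) (l : List M.Cell) :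
    (M.tmConfig (.sweeping s) h l l.length).perform n (M.walk (.sweeping s) none) =
      M.tmConfig (.back s) h (l ++ (M.extend s).toList) (l.length - 1) := by
  simp [tmConfig, Config.perform, walk, moveWork, moveInput, update_tapeOf_length]

theorem perform_back (n : ℕ) (s : M.State) (h : ℕ) (l : List M.Cell) (z : ℤ) (c : M.Cell)
    (hc : tapeOf l z = some c) :
    (M.tmConfig (.back s) h l z).perform n (M.walk (.back s) (some c)) =
      M.tmConfig (.back s) h l (z - 1) := by
  simp [tmConfig, Config.perform, walk, moveWork, moveInput, ← hc]

theorem perform_arrive (n : ℕ) (s : M.State) (h : ℕ) (l : List M.Cell) :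
    (M.tmConfig (.back s) h l (-1)).perform n (M.walk (.back s) none) =
      M.tmConfig (.ready s) h l 0 := by
  have : Function.update (tapeOf l) (-1) none = tapeOf l := by
    rw [← tapeOf_neg_one l, Function.update_eq_self]
  simp [tmConfig, Config.perform, walk, moveWork, moveInput, this]

/-- The configurations of the Turing machine in the course of the simulation. -/
inductive Simulates (M : SweepMachine Γ Δ) (w : List Γ) : M.TMConfig × List Δ → Prop
  | ready (s h l o) : M.Reach w M.initial ⟨s, h, l, o⟩ →
      Simulates M w (M.tmConfig (.ready s) h l 0, o)
  | sweeping (s h pre suf o) :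
      M.Reach w M.initial ⟨(sweepList M.sweep s suf).1, h,
        pre ++ (sweepList M.sweep s suf).2 ++ (M.extend (sweepList M.sweep s suf).1).toList, o⟩ →
      Simulates M w (M.tmConfig (.sweeping s) h (pre ++ suf) pre.length, o)
  | back (s h l o) (z : ℤ) : M.Reach w M.initial ⟨s, h, l, o⟩ → -1 ≤ z → z < l.length →
      Simulates M w (M.tmConfig (.back s) h l z, o)

/-- The sweeping case of the invariant speaks of the snapshot that the finished sweep will produce.
Launching a step already moves on to that snapshot, and rewriting a cell only shifts it from the
unprocessed part to the finished one. -/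
theorem Simulates.step {w : List Γ} {c d : M.TMConfig × List Δ} (hc : Simulates M w c)
    (hd : M.tmStep w c d) : Simulates M w d := by
  obtain ⟨y, hy, rfl⟩ := hd
  cases hc with
  | ready s h l o hr =>
    obtain ⟨d, hd, rfl⟩ := hy
    simp only [perform_launch]
    exact Simulates.sweeping d.1 _ [] l _ (hr.tail ⟨d, hd, rfl⟩)
  | sweeping s h pre suf o hr =>
    obtain rfl : y = _ := hy
    cases suf with
    | nil =>
      have : (M.tmConfig (.sweeping s) h (pre ++ []) pre.length).scanned 0 = none := by
        simp [Config.scanned, tmConfig, tapeOf_natCast]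
      simp only [this]
      rw [List.append_nil, perform_turn]
      refine Simulates.back _ _ _ _ _ (by simpa [sweepList] using hr) (by omega) ?_
      simp only [List.length_append]
      push_cast
      omega
    | cons c suf =>
      have : (M.tmConfig (.sweeping s) h (pre ++ c :: suf) pre.length).scanned 0 = some c := by
        simp [Config.scanned, tmConfig, tapeOf_natCast]
      simp only [this]
      rw [perform_sweep]
      refine Simulates.sweeping _ _ _ _ _ ?_
      simpa [sweepList] using hr
  | back s h l o z hr h1 h2 =>
    obtain rfl : y = _ := hy
    by_cases hz : z = -1
    · subst hz
      have : (M.tmConfig (.back s) h l (-1)).scanned 0 = none := rfl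
      simp only [this]
      rw [perform_arrive]
      simpa using Simulates.ready _ _ _ _ hr
    · obtain ⟨n, rfl⟩ := Int.eq_ofNat_of_zero_le (show 0 ≤ z by omega)
      have hn : n < l.length := by omega
      have : (M.tmConfig (.back s) h l n).scanned 0 = some l[n] := by
        simp [Config.scanned, tmConfig, tapeOf_natCast, hn]
      simp only [this]
      rw [perform_back _ _ _ _ _ _ (by simp [tapeOf_natCast, hn])]
      simpa using Simulates.back _ _ _ _ _ hr (by omega) (by omega)

theorem simulates_of_tmReach {w : List Γ} {c : M.TMConfig × List Δ}
    (hc : M.tmReach w M.tmStart c) : Simulates M w c := by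
  induction hc with
  | refl =>
    rw [tmStart_eq]
    exact Simulates.ready _ _ _ _ .refl
  | tail _ h ih => exact ih.step h

theorem tmReach_sweep (w : List Γ) (s : M.State) (h : ℕ) (pre suf : List M.Cell) (o : List Δ) :
    M.tmReach w (M.tmConfig (.sweeping s) h (pre ++ suf) pre.length, o)
      (M.tmConfig (.sweeping (sweepList M.sweep s suf).1) h (pre ++ (sweepList M.sweep s suf).2)
        (pre ++ (sweepList M.sweep s suf).2).length, o) := by
  induction suf generalizing s pre with
  | nil => simpa [sweepList] using Relation.ReflTransGen.refl
  | cons c suf ih =>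
    refine .head ⟨_, rfl, rfl⟩ ?_
    have : (M.tmConfig (.sweeping s) h (pre ++ c :: suf) pre.length).scanned 0 = some c := by
      simp [Config.scanned, tmConfig, tapeOf_natCast]
    simp only [this]
    rw [perform_sweep]
    simpa [sweepList] using ih (M.sweep s c).1 (pre ++ [(M.sweep s c).2])

theorem tmReach_back (w : List Γ) (s : M.State) (h : ℕ) (l : List M.Cell) (o : List Δ) (n : ℕ)
    (hn : n ≤ l.length) :
    M.tmReach w (M.tmConfig (.back s) h l (n - 1), o) (M.tmConfig (.ready s) h l 0, o) := by
  induction n with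
  | zero =>
    refine .single ⟨_, rfl, ?_⟩
    have : (M.tmConfig (.back s) h l ((0 : ℕ) - 1)).scanned 0 = none := rfl
    simp only [this]
    have h0 : (((0 : ℕ) : ℤ) - 1) = -1 := rfl
    rw [h0, perform_arrive]
    simp
  | succ n ih =>
    refine .head ⟨_, rfl, rfl⟩ ?_
    have h1 : (((n + 1 : ℕ) : ℤ) - 1) = n := by push_cast; ring
    have : (M.tmConfig (.back s) h l n).scanned 0 = some l[n] := by
      simp [Config.scanned, tmConfig, tapeOf_natCast]
    simp only [h1, this]
    rw [perform_back _ _ _ _ _ _ (by simp [tapeOf_natCast])]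
    simpa using ih (by omega)

theorem tmReach_of_step {w : List Γ} {c d : M.Snap} (h : M.Step w c d) :
    M.tmReach w (M.tmConfig (.ready c.state) c.head c.cells 0, c.output)
      (M.tmConfig (.ready d.state) d.head d.cells 0, d.output) := by
  obtain ⟨y, hy, rfl⟩ := h
  refine .head ⟨_, ⟨y, hy, rfl⟩, rfl⟩ ?_
  simp only [perform_launch]
  refine (tmReach_sweep w _ _ [] _ _).trans ?_
  refine .head ⟨_, rfl, rfl⟩ ?_
  simp only [List.nil_append]
  have : ∀ (s : M.State) h (l : List M.Cell),
      (M.tmConfig (.sweeping s) h l l.length).scanned 0 = none := by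
    intro s h l
    simp [Config.scanned, tmConfig, tapeOf_natCast]
  simp only [this]
  rw [perform_turn]
  simpa [advance, launch] using tmReach_back w _ _ _ _ _ (by simp)

theorem tmReach_of_reach {w : List Γ} {c : M.Snap} (h : M.Reach w M.initial c) :
    M.tmReach w M.tmStart (M.tmConfig (.ready c.state) c.head c.cells 0, c.output) := by
  rw [tmStart_eq]
  induction h with
  | refl => exact .refl
  | tail _ h ih => exact ih.trans (tmReach_of_step h)

/-- All the reachable cell lists have logarithmic length. -/
def IsLogBounded (M : SweepMachine Γ Δ) : Prop :=
  ∃ C : ℕ, ∀ w c, M.Reach w M.initial c → c.cells.length ≤ C * (Nat.log 2 w.length + 1)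

theorem within_of_tmReach {M : SweepMachine Γ Δ} (hM : M.IsLogBounded) :
    ∃ C : ℕ, ∀ w c, M.tmReach w M.tmStart c → c.1.Within (C * (Nat.log 2 w.length + 1)) := by
  obtain ⟨C, hC⟩ := hM
  -- The head never passes the end of the list, but it does visit cell -1; the additional unit
  -- covers this when `C` is 0.
  refine ⟨C + 1, fun w c hc i => ?_⟩
  have key : ∀ (n : ℕ), n ≤ C * (Nat.log 2 w.length + 1) →
      (n : ℤ) + 1 ≤ ((C + 1) * (Nat.log 2 w.length + 1) : ℕ) := by
    intro n hn
    have : n + 1 ≤ (C + 1) * (Nat.log 2 w.length + 1) := by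
      rw [add_mul]
      omega
    exact_mod_cast this
  cases simulates_of_tmReach hc with
  | ready s h l o hr => simpa [tmConfig] using by positivity
  | sweeping s h pre suf o hr =>
    have h1 := hC w _ hr
    simp only [List.length_append] at h1
    have := key pre.length (by omega)
    simp only [tmConfig]
    rw [abs_le]
    constructor <;> omega
  | back s h l o z hr h1 h2 =>
    have := key l.length (hC w _ hr)
    simp only [tmConfig]
    rw [abs_le]
    constructor <;> omega

/-! ### From sweep machines to Turing machines -/

def toNTM (M : SweepMachine Γ Δ) (acc : Set M.State) : NTM Γ where
  State := Phase M.State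
  Work := Option M.Cell
  tapes := 1
  finState := have := M.finState; inferInstance
  finWork := have := M.finCell; inferInstance
  start := .ready M.start
  blank := none
  accept := Phase.ready '' acc
  trans := fun p x a => Prod.fst '' M.tmTrans p x a

theorem toNTM_reachable_iff (acc : Set M.State) (w : List Γ) (c : M.TMConfig) :
    (M.toNTM acc).Reachable w c ↔ ∃ o, M.tmReach w M.tmStart (c, o) := by
  constructor
  · intro h
    induction h with
    | refl => exact ⟨[], .refl⟩
    | tail _ h ih =>
      obtain ⟨o, ho⟩ := ih
      obtain ⟨_, ⟨y, hy, rfl⟩, rfl⟩ := h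
      exact ⟨o ++ y.2.toList, ho.tail ⟨y, hy, rfl⟩⟩
  · rintro ⟨o, h⟩
    have : ∀ d, M.tmReach w M.tmStart d → (M.toNTM acc).Reachable w d.1 := by
      intro d h
      induction h with
      | refl => exact .refl
      | tail _ h ih =>
        obtain ⟨y, hy, rfl⟩ := h
        exact ih.tail ⟨y.1, ⟨y, hy, rfl⟩, rfl⟩
    exact this _ h

/-- Only `ready` phases accept, so no configuration in the middle of a sweep can accept prematurely.
-/
theorem exists_mem_NL {M : SweepMachine Γ Δ} (hM : M.IsLogBounded) (acc : Set M.State) :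
    ∃ L ∈ NL Γ, ∀ w, w ∈ L ↔ ∃ c, M.Reach w M.initial c ∧ c.state ∈ acc := by
  refine ⟨(M.toNTM acc).language, ⟨_, ?_, rfl⟩, fun w => ?_⟩
  · obtain ⟨C, hC⟩ := within_of_tmReach hM
    refine ⟨C, fun w c hc => ?_⟩
    obtain ⟨o, ho⟩ := (toNTM_reachable_iff acc w c).1 hc
    exact hC w _ ho
  · constructor
    · rintro ⟨c, hc, s, hs, hsc⟩
      obtain ⟨o, ho⟩ := (toNTM_reachable_iff acc w c).1 hc
      cases simulates_of_tmReach ho with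
      | ready s' h l o' hr =>
        obtain rfl : s = s' := by simpa [tmConfig] using hsc
        exact ⟨_, hr, hs⟩
      | sweeping =>
        simp [tmConfig] at hsc
      | back =>
        simp [tmConfig] at hsc
    · rintro ⟨c, hc, hs⟩
      exact ⟨_, (toNTM_reachable_iff acc w _).2 ⟨_, tmReach_of_reach hc⟩, c.state, hs, rfl⟩

/-- A Turing machine with output for a sweep machine with at most one move in each situation. -/
def toTransducer (M : SweepMachine Γ Δ)
    (d : M.State → InputCell Γ → Option (M.State × HeadMove × Option Δ)) : Transducer Γ Δ where
  State := Phase M.State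
  Work := Option M.Cell
  tapes := 1
  finState := have := M.finState; inferInstance
  finWork := have := M.finCell; inferInstance
  start := .ready M.start
  blank := none
  trans := fun p x a => match p with
    | .ready s => (d s x).map (M.launch a)
    | p => some (M.walk p (a 0), none)

theorem toTransducer_step_iff {d : M.State → InputCell Γ → Option (M.State × HeadMove × Option Δ)}
    (hd : ∀ s x, M.delta s x = {y | d s x = some y}) (w : List Γ) (c c' : M.TMConfig × List Δ) :
    (M.toTransducer d).step w c = some c' ↔ M.tmStep w c c' := by
  obtain ⟨⟨p, h, t, z⟩, o⟩ := c
  cases p with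
  | ready s =>
    simp only [Transducer.step, toTransducer, tmStep, tmTrans, hd, Option.map_map]
    rw [Option.map_eq_some_iff]
    constructor
    · rintro ⟨y, hy, rfl⟩
      exact ⟨_, ⟨y, hy, rfl⟩, rfl⟩
    · rintro ⟨_, ⟨y, hy, rfl⟩, rfl⟩
      exact ⟨y, hy, rfl⟩
  | sweeping s => simp [Transducer.step, toTransducer, tmStep, tmTrans, eq_comm]
  | back s => simp [Transducer.step, toTransducer, tmStep, tmTrans, eq_comm]

theorem logSpaceComputable {M : SweepMachine Γ Δ} (hM : M.IsLogBounded)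
    {d : M.State → InputCell Γ → Option (M.State × HeadMove × Option Δ)}
    (hd : ∀ s x, M.delta s x = {y | d s x = some y}) (f : List Γ → List Δ)
    (hf : ∀ w, ∃ c, M.Reach w M.initial c ∧ d c.state (inputCell w c.head) = none ∧
      c.output = f w) : LogSpaceComputable f := by
  have hreach : ∀ w c, (M.toTransducer d).Reachable w c ↔ M.tmReach w M.tmStart c := by
    intro w c
    have : (fun a b => (M.toTransducer d).step w a = some b) = M.tmStep w := by
      funext a b
      exact propext (toTransducer_step_iff hd w a b)
    simp only [Transducer.Reachable, tmReach]
    rw [this]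
    rfl
  refine ⟨M.toTransducer d, ?_, fun w => ?_⟩
  · obtain ⟨C, hC⟩ := within_of_tmReach hM
    exact ⟨C, fun w c hc => hC w c ((hreach w c).1 hc)⟩
  · obtain ⟨c, hc, hhalt, hout⟩ := hf w
    refine ⟨_, (hreach w _).2 (tmReach_of_reach hc), ?_, hout⟩
    simp [Transducer.step, toTransducer, tmConfig, hhalt]

end SweepMachine

/-! ### Sweep machines with a ruler

The list of cells has fixed length, the binary length of the length of the input (plus one). -/

structure RulerMachine (Γ Δ : Type) where
  State : Type
  Cell : Type
  finState : Finite State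
  finCell : Finite Cell
  start : State
  blank : Cell
  delta : State → InputCell Γ → Set (State × HeadMove × Option Δ)
  sweep : State → Cell → State × Cell
  sweep_start : ∀ c, sweep start c = (start, c)

namespace RulerMachine

variable {Γ Δ : Type} (M : RulerMachine Γ Δ)

abbrev Snap := Snapshot M.State M.Cell Δ

def advance (w : List Γ) (c : M.Snap) (d : M.State × HeadMove × Option Δ) : M.Snap where
  state := (sweepList M.sweep d.1 c.cells).1
  head := moveInput w.length c.head d.2.1
  cells := (sweepList M.sweep d.1 c.cells).2
  output := c.output ++ d.2.2.toList

def Step (w : List Γ) (c d : M.Snap) : Prop :=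
  ∃ y ∈ M.delta c.state (inputCell w c.head), d = M.advance w c y

abbrev Reach (w : List Γ) : M.Snap → M.Snap → Prop := Relation.ReflTransGen (M.Step w)

/-- The number of cells. -/
def width (w : List Γ) : ℕ := Nat.size (w.length + 1)

/-- At the beginning the input head is on the right end marker. -/
def initial (w : List Γ) : M.Snap :=
  ⟨M.start, w.length + 1, List.replicate (width w) M.blank, []⟩

/-- A sweep machine that first counts the input letters in binary. -/
def toSweep : SweepMachine Γ Δ where
  State := Bool ⊕ M.State
  Cell := Bool × M.Cell
  finState := have := M.finState; inferInstance
  finCell := have := M.finCell; inferInstance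
  start := .inl false
  delta := fun s x => match s, x with
    | .inl _, .rightEnd => {(.inr M.start, .stay, none)}
    | .inl _, _ => {(.inl true, .right, none)}
    | .inr s, x => (fun y => (.inr y.1, y.2)) '' M.delta s x
  sweep := fun s a => match s with
    | .inl c => (.inl (c && a.1), (xor c a.1, a.2))
    | .inr s => (.inr (M.sweep s a.2).1, (a.1, (M.sweep s a.2).2))
  extend := fun s => match s with
    | .inl true => some (true, M.blank)
    | _ => none

variable {M}

theorem sweepList_count_false (l : List (Bool × M.Cell)) :
    sweepList M.toSweep.sweep (.inl false) l = (.inl false, l) := by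
  induction l with
  | nil => rfl
  | cons a l ih => simp [sweepList, toSweep] at ih ⊢; simp [ih]

theorem sweepList_count_isLeft (c : Bool) (l : List (Bool × M.Cell)) :
    ∃ c', (sweepList M.toSweep.sweep (.inl c) l).1 = .inl c' := by
  induction l generalizing c with
  | nil => exact ⟨c, rfl⟩
  | cons a l ih => exact ih _

def counter (M : RulerMachine Γ Δ) (m : ℕ) : List (Bool × M.Cell) :=
  m.bits.map fun b => (b, M.blank)

/-- Binary increment, lowest digit first: on an even number the carry stops at once, on an odd one
it passes to the half. A carry that survives the whole list becomes the new leading digit through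
`extend`. -/
theorem counter_succ (m : ℕ) :
    (sweepList M.toSweep.sweep (.inl true) (M.counter m)).2 ++
      (M.toSweep.extend (sweepList M.toSweep.sweep (.inl true) (M.counter m)).1).toList =
      M.counter (m + 1) := by
  induction m using Nat.strong_induction_on with
  | _ m ih =>
    rcases Nat.even_or_odd' m with ⟨k, rfl | rfl⟩
    · by_cases hk : k = 0
      · subst hk
        rfl
      · have h1 : M.counter (2 * k) = (false, M.blank) :: M.counter k := by
          simp [counter, Nat.bit0_bits k hk]
        have h2 : M.counter (2 * k + 1) = (true, M.blank) :: M.counter k := by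
          simp [counter]
        rw [h1, h2]
        have := sweepList_count_false (M.counter k)
        simp only [sweepList, toSweep] at this ⊢
        simp only [Bool.true_and, Bool.xor_false, this]
        exact List.append_nil _
    · have h1 : M.counter (2 * k + 1) = (true, M.blank) :: M.counter k := by
        simp [counter]
      have h2 : M.counter (2 * k + 1 + 1) = (false, M.blank) :: M.counter (k + 1) := by
        rw [show 2 * k + 1 + 1 = 2 * (k + 1) by ring]
        simp [counter, Nat.bit0_bits (k + 1) (by omega)]
      rw [h1, h2, ← ih k (by omega)]
      rfl

theorem counter_length (m : ℕ) : (M.counter m).length = Nat.size m := by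
  simp [counter, Nat.size_eq_bits_len]

/-- A snapshot of the machine together with the bits of the ruler. -/
def lift (bs : List Bool) (c : M.Snap) : M.toSweep.Snap :=
  ⟨.inr c.state, c.head, bs.zip c.cells, c.output⟩

theorem sweepList_zip (bs : List Bool) (s : M.State) (l : List M.Cell)
    (h : bs.length = l.length) :
    sweepList M.toSweep.sweep (.inr s) (bs.zip l) =
      (.inr (sweepList M.sweep s l).1, bs.zip (sweepList M.sweep s l).2) := by
  induction l generalizing bs s with
  | nil =>
    obtain rfl : bs = [] := by simpa using h
    rfl
  | cons a l ih =>
    cases bs with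
    | nil => simp at h
    | cons b bs =>
      have := ih bs (M.sweep s a).1 (by simpa using h)
      simp only [List.zip_cons_cons, sweepList]
      simp only [toSweep] at this ⊢
      rw [this]

theorem advance_lift (w : List Γ) (bs : List Bool) (c : M.Snap) (h : bs.length = c.cells.length)
    (y : M.State × HeadMove × Option Δ) :
    M.toSweep.advance w (lift bs c) (.inr y.1, y.2) = lift bs (M.advance w c y) := by
  have := sweepList_zip bs y.1 c.cells h
  simp only [SweepMachine.advance, lift, advance]
  rw [this]
  congr 1
  exact List.append_nil _

theorem length_advance (w : List Γ) (c : M.Snap) (y : M.State × HeadMove × Option Δ) :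
    (M.advance w c y).cells.length = c.cells.length := by
  simp [advance, sweepList_length]

theorem length_of_reach {w : List Γ} {c : M.Snap} (h : M.Reach w (M.initial w) c) :
    c.cells.length = width w := by
  induction h with
  | refl => simp [initial]
  | tail _ h ih =>
    obtain ⟨y, -, rfl⟩ := h
    rw [length_advance, ih]

theorem inputCell_eq_rightEnd_iff (w : List Γ) (p : ℕ) :
    inputCell w p = .rightEnd ↔ w.length + 1 ≤ p := by
  cases p with
  | zero => simp [inputCell]
  | succ p =>
    rw [inputCell]
    cases h : w[p]? with
    | none =>
      have := List.getElem?_eq_none_iff.1 h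
      simp [this]
    | some a =>
      have := (List.getElem?_eq_some_iff.1 h).1
      simp [this]

theorem step_count (w : List Γ) (c : Bool) (p : ℕ) (hp : p ≤ w.length) (d : M.toSweep.Snap) :
    M.toSweep.Step w ⟨.inl c, p, M.counter p, []⟩ d ↔
      d = ⟨(sweepList M.toSweep.sweep (.inl true) (M.counter p)).1, p + 1, M.counter (p + 1), []⟩ := by
  have hx : inputCell w p ≠ .rightEnd := by
    rw [Ne, inputCell_eq_rightEnd_iff]
    omega
  have : M.toSweep.delta (.inl c) (inputCell w p) = {(.inl true, .right, none)} := by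
    cases h : inputCell w p with
    | rightEnd => exact absurd h hx
    | leftEnd => rfl
    | letter => rfl
  simp only [SweepMachine.Step, this, Set.mem_singleton_iff, exists_eq_left, SweepMachine.advance]
  rw [counter_succ]
  simp [moveInput, show p + 1 ≤ w.length + 1 by omega]

theorem step_begin (w : List Γ) (c : Bool) (d : M.toSweep.Snap) :
    M.toSweep.Step w ⟨.inl c, w.length + 1, M.counter (w.length + 1), []⟩ d ↔
      d = lift (w.length + 1).bits (M.initial w) := by
  have hx : inputCell w (w.length + 1) = .rightEnd := by
    rw [inputCell_eq_rightEnd_iff]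
  have h2 : M.counter (w.length + 1) =
      (w.length + 1).bits.zip (List.replicate (width w) M.blank) := by
    rw [counter, width, ← Nat.size_eq_bits_len]
    generalize (w.length + 1).bits = l
    induction l with
    | nil => rfl
    | cons a l ih => simpa [List.replicate_succ] using ih
  -- The hand-over from counting to the machine proper is itself followed by a sweep; `sweep_start`
  -- makes it harmless.
  have h3 : ∀ l : List M.Cell, sweepList M.sweep M.start l = (M.start, l) := by
    intro l
    induction l with
    | nil => rfl
    | cons a l ih => simp [sweepList, M.sweep_start, ih]
  have h4 := sweepList_zip (w.length + 1).bits M.start (List.replicate (width w) M.blank)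
    (by simp [width, Nat.size_eq_bits_len])
  have : M.toSweep.delta (.inl c) .rightEnd = {(.inr M.start, .stay, none)} := rfl
  simp only [SweepMachine.Step, hx, this, Set.mem_singleton_iff, exists_eq_left,
    SweepMachine.advance]
  rw [h2, h4, h3]
  have h5 : ∀ l : List M.toSweep.Cell,
      l ++ (M.toSweep.extend (.inr M.start)).toList = l := fun l => List.append_nil l
  simp only [lift, initial, moveInput]
  erw [h5]
  rfl

theorem reach_toSweep_initial (w : List Γ) :
    M.toSweep.Reach w M.toSweep.initial (lift (w.length + 1).bits (M.initial w)) := by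
  have : ∀ p ≤ w.length + 1, ∃ c, M.toSweep.Reach w M.toSweep.initial
      ⟨.inl c, p, M.counter p, []⟩ := by
    intro p
    induction p with
    | zero => exact fun _ => ⟨false, .refl⟩
    | succ p ih =>
      intro hp
      obtain ⟨c, hc⟩ := ih (by omega)
      obtain ⟨c', hc'⟩ := sweepList_count_isLeft true (M.counter p)
      exact ⟨c', hc.tail ((step_count w c p (by omega) _).2 (by rw [hc']))⟩
  obtain ⟨c, hc⟩ := this _ le_rfl
  exact hc.tail ((step_begin w c _).2 rfl)

theorem bits_length_of_reach {w : List Γ} {c : M.Snap} (h : M.Reach w (M.initial w) c) :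
    (w.length + 1).bits.length = c.cells.length := by
  rw [length_of_reach h, width, Nat.size_eq_bits_len]

theorem reach_toSweep {w : List Γ} {c : M.Snap} (h : M.Reach w (M.initial w) c) :
    M.toSweep.Reach w M.toSweep.initial (lift (w.length + 1).bits c) := by
  induction h with
  | refl => exact reach_toSweep_initial w
  | tail h h' ih =>
    obtain ⟨y, hy, rfl⟩ := h'
    exact ih.tail ⟨(.inr y.1, y.2), ⟨y, hy, rfl⟩, (advance_lift _ _ _ (bits_length_of_reach h) _).symm⟩

theorem of_reach_toSweep {w : List Γ} {d : M.toSweep.Snap}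
    (h : M.toSweep.Reach w M.toSweep.initial d) :
    (∃ c, ∃ p ≤ w.length + 1, d = ⟨.inl c, p, M.counter p, []⟩) ∨
      ∃ c, M.Reach w (M.initial w) c ∧ d = lift (w.length + 1).bits c := by
  induction h with
  | refl => exact .inl ⟨false, 0, by omega, rfl⟩
  | tail _ h' ih =>
    rcases ih with ⟨c, p, hp, rfl⟩ | ⟨c, hc, rfl⟩
    · rcases hp.lt_or_eq with hp | rfl
      · rw [step_count _ _ _ (by omega)] at h'
        obtain ⟨c', hc'⟩ := sweepList_count_isLeft true (M.counter p)
        exact .inl ⟨c', p + 1, by omega, by rw [h', hc']⟩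
      · rw [step_begin] at h'
        exact .inr ⟨_, .refl, h'⟩
    · obtain ⟨_, ⟨y, hy, rfl⟩, rfl⟩ := h'
      exact .inr ⟨_, hc.tail ⟨y, hy, rfl⟩, advance_lift _ _ _ (bits_length_of_reach hc) _⟩

theorem isLogBounded_toSweep (M : RulerMachine Γ Δ) : M.toSweep.IsLogBounded := by
  refine ⟨2, fun w d hd => ?_⟩
  -- `Nat.size p ≤ k` means `p < 2 ^ k`. The factor 2 in the exponent pays for the added 1, as the
  -- logarithm may be 0.
  have key : ∀ p ≤ w.length + 1, Nat.size p ≤ 2 * (Nat.log 2 w.length + 1) := by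
    intro p hp
    rw [Nat.size_le]
    have h1 : w.length < 2 ^ (Nat.log 2 w.length + 1) := Nat.lt_pow_succ_log_self (by norm_num) _
    have h2 : 2 ^ (Nat.log 2 w.length + 1 + 1) ≤ 2 ^ (2 * (Nat.log 2 w.length + 1)) :=
      Nat.pow_le_pow_right (by norm_num) (by omega)
    rw [pow_succ] at h2
    omega
  rcases of_reach_toSweep hd with ⟨c, p, hp, rfl⟩ | ⟨c, hc, rfl⟩
  · exact (counter_length p).trans_le (key p hp)
  · refine le_of_eq_of_le ?_ (key _ le_rfl)
    simp only [lift]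
    refine List.length_zip.trans ?_
    rw [length_of_reach hc, width, Nat.size_eq_bits_len, min_self]

theorem exists_mem_NL (M : RulerMachine Γ Δ) (acc : Set M.State) :
    ∃ L ∈ NL Γ, ∀ w, w ∈ L ↔ ∃ c, M.Reach w (M.initial w) c ∧ c.state ∈ acc := by
  obtain ⟨L, hL, h⟩ := SweepMachine.exists_mem_NL (isLogBounded_toSweep M) (Sum.inr '' acc)
  refine ⟨L, hL, fun w => (h w).trans ⟨?_, ?_⟩⟩
  · rintro ⟨d, hd, s, hs, hsd⟩
    rcases of_reach_toSweep hd with ⟨c, p, hp, rfl⟩ | ⟨c, hc, rfl⟩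
    · simp at hsd
    · exact ⟨c, hc, by simpa [lift] using Sum.inr_injective hsd ▸ hs⟩
  · rintro ⟨c, hc, hs⟩
    exact ⟨_, reach_toSweep hc, c.state, hs, rfl⟩

theorem logSpaceComputable (M : RulerMachine Γ Δ)
    {d : M.State → InputCell Γ → Option (M.State × HeadMove × Option Δ)}
    (hd : ∀ s x, M.delta s x = {y | d s x = some y}) (f : List Γ → List Δ)
    (hf : ∀ w, ∃ c, M.Reach w (M.initial w) c ∧ d c.state (inputCell w c.head) = none ∧
      c.output = f w) : LogSpaceComputable f := by
  refine SweepMachine.logSpaceComputable (isLogBounded_toSweep M)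
    (d := fun s x => match s, x with
      | .inl _, .rightEnd => some (.inr M.start, .stay, none)
      | .inl _, _ => some (.inl true, .right, none)
      | .inr s, x => (d s x).map fun y => (.inr y.1, y.2)) ?_ f ?_
  · rintro (b | s) x
    · cases x <;> ext y <;> simp [toSweep, eq_comm]
    · ext y
      simp only [toSweep, hd, Option.map_eq_some_iff]
      rfl
  · intro w
    obtain ⟨c, hc, h1, h2⟩ := hf w
    exact ⟨_, reach_toSweep hc, by simp [lift, h1], h2⟩

end RulerMachine

end LogSpace

/-! ### Formulas on a single trace -/

namespace HyperBody

variable {AP : Type}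

theorem sat_congr (f : HyperBody AP) {A B : TraceAssignment AP} (h : ∀ v ∈ f.vars, A v = B v) :
    f.Sat A ↔ f.Sat B := by
  have suffix : ∀ {A B : TraceAssignment AP} {s : Set ℕ} (j : ℕ), (∀ v ∈ s, A v = B v) →
      ∀ v ∈ s, A.suffix j v = B.suffix j v := by
    intro A B s j h v hv
    simp [TraceAssignment.suffix, h v hv]
  induction f generalizing A B with
  | tru => rfl
  | atom a v => simp [Sat, h v rfl]
  | neg f ih => exact not_congr (ih h)
  | or f g ihf ihg =>
    exact or_congr (ihf fun v hv => h v (.inl hv)) (ihg fun v hv => h v (.inr hv))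
  | next f ih => exact ih (suffix 1 h)
  | untl f g ihf ihg =>
    have h1 := fun j => ihf (suffix j fun v hv => h v (.inl hv))
    have h2 := fun j => ihg (suffix j fun v hv => h v (.inr hv))
    simp only [Sat, h1, h2]

/-- Satisfaction when all the trace variables stand for the same trace. -/
def Holds (f : HyperBody AP) (t : ℕ → Set AP) : Prop := f.Sat fun _ => some t

theorem holds_tru (t : ℕ → Set AP) : (tru : HyperBody AP).Holds t := trivial

theorem holds_atom (a : AP) (v : ℕ) (t : ℕ → Set AP) : (atom a v).Holds t ↔ a ∈ t 0 := by
  simp [Holds, Sat]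

theorem holds_neg (f : HyperBody AP) (t : ℕ → Set AP) : (neg f).Holds t ↔ ¬ f.Holds t := Iff.rfl

theorem holds_or (f g : HyperBody AP) (t : ℕ → Set AP) :
    (or f g).Holds t ↔ f.Holds t ∨ g.Holds t := Iff.rfl

theorem holds_next (f : HyperBody AP) (t : ℕ → Set AP) :
    (next f).Holds t ↔ f.Holds fun i => t (1 + i) := Iff.rfl

theorem holds_untl (f g : HyperBody AP) (t : ℕ → Set AP) :
    (untl f g).Holds t ↔
      ∃ i, (g.Holds fun k => t (i + k)) ∧ ∀ j < i, f.Holds fun k => t (j + k) := Iff.rfl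

/-- The expansion law of until: its truth value is determined by those of the operands here and its
own value one position later, which is the order in which a tail automaton reads. -/
theorem holds_untl_iff (f g : HyperBody AP) (t : ℕ → Set AP) :
    (untl f g).Holds t ↔ g.Holds t ∨ f.Holds t ∧ (untl f g).Holds fun i => t (i + 1) := by
  rw [holds_untl, holds_untl]
  constructor
  · rintro ⟨_ | i, hg, hf⟩
    · exact .inl (by simpa using hg)
    · refine .inr ⟨by simpa using hf 0 (by omega), i, ?_, fun j hj => ?_⟩
      · simpa [add_right_comm] using hg
      · simpa [add_right_comm] using hf (j + 1) (by omega)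
  · rintro (hg | ⟨hf, i, hg, hf'⟩)
    · exact ⟨0, by simpa using hg, by simp⟩
    · refine ⟨i + 1, by simpa [add_right_comm] using hg, fun j hj => ?_⟩
      cases j with
      | zero => simpa using hf
      | succ j => simpa [add_right_comm] using hf' j (by omega)

theorem holds_untl_of_const (f g : HyperBody AP) (t : ℕ → Set AP) (h : ∀ i, t i = t 0) :
    (untl f g).Holds t ↔ g.Holds t := by
  constructor
  · rintro ⟨i, hg, -⟩
    have : (fun k => t (i + k)) = t := by
      funext k
      rw [h, h k]
    change g.Holds (fun k => t (i + k)) at hg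
    rwa [this] at hg
  · exact fun hg => (holds_untl_iff f g t).2 (.inl hg)

end HyperBody

/-- A finite automaton that reads an eventually constant trace backwards: `last` is its state on the
constant part. -/
structure TailAutomaton (AP : Type) where
  State : Type
  finState : Finite State
  last : Set AP → State
  back : Set AP → State → State
  accept : State → Prop

namespace TailAutomaton

variable {AP : Type}

/-- The state at the beginning of a trace that is constant from position `n` on. -/
def run (D : TailAutomaton AP) : ℕ → (ℕ → Set AP) → D.State
  | 0, t => D.last (t 0)
  | n + 1, t => D.back (t 0) (D.run n fun i => t (i + 1))

/-- Any `n` from which the trace is constant is allowed, so the verdict may not depend on where the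
constant part is taken to begin. -/
def Recognizes (D : TailAutomaton AP) (f : HyperBody AP) : Prop :=
  ∀ n t, (∀ i, n ≤ i → t i = t n) → (f.Holds t ↔ D.accept (D.run n t))

theorem eq_of_shift {n : ℕ} {t : ℕ → Set AP} (h : ∀ i, n + 1 ≤ i → t i = t (n + 1)) :
    ∀ i, n ≤ i → t (i + 1) = t (n + 1) := fun i hi => h (i + 1) (by omega)

/-- Induction on the formula with product automata. For next, a further component remembers whether
the argument held one position later; for until, it holds the truth value given by the expansion
law. On the constant part, next reduces to its argument and until to its right operand. -/
theorem exists_recognizes (f : HyperBody AP) : ∃ D : TailAutomaton AP, D.Recognizes f := by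
  induction f with
  | tru =>
    exact ⟨⟨Unit, inferInstance, fun _ => (), fun _ _ => (), fun _ => True⟩,
      fun n t _ => iff_of_true (HyperBody.holds_tru t) trivial⟩
  | atom a v =>
    refine ⟨⟨Prop, inferInstance, fun l => a ∈ l, fun l _ => a ∈ l, fun p => p⟩, fun n t _ => ?_⟩
    rw [HyperBody.holds_atom]
    cases n <;> rfl
  | neg f ih =>
    obtain ⟨D, hD⟩ := ih
    have hrun : ∀ n t, TailAutomaton.run ⟨D.State, D.finState, D.last, D.back,
        fun v => ¬ D.accept v⟩ n t = D.run n t := by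
      intro n
      induction n with
      | zero => exact fun t => rfl
      | succ n ih => exact fun t => congrArg _ (ih _)
    refine ⟨⟨D.State, D.finState, D.last, D.back, fun v => ¬ D.accept v⟩, fun n t h => ?_⟩
    rw [hrun, HyperBody.holds_neg, hD n t h]
  | or f g ihf ihg =>
    obtain ⟨D, hD⟩ := ihf
    obtain ⟨E, hE⟩ := ihg
    have := D.finState
    have := E.finState
    have hrun : ∀ n t, TailAutomaton.run ⟨D.State × E.State, inferInstance,
        fun l => (D.last l, E.last l), fun l v => (D.back l v.1, E.back l v.2),
        fun v => D.accept v.1 ∨ E.accept v.2⟩ n t = (D.run n t, E.run n t) := by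
      intro n
      induction n with
      | zero => exact fun t => rfl
      | succ n ih => intro t; simp only [run]; rw [ih]
    refine ⟨⟨D.State × E.State, inferInstance,
        fun l => (D.last l, E.last l), fun l v => (D.back l v.1, E.back l v.2),
        fun v => D.accept v.1 ∨ E.accept v.2⟩, fun n t h => ?_⟩
    rw [hrun, HyperBody.holds_or, hD n t h, hE n t h]
  | next f ih =>
    obtain ⟨D, hD⟩ := ih
    have := D.finState
    have hrun : ∀ n t, (∀ i, n ≤ i → t i = t n) → TailAutomaton.run ⟨D.State × Prop, inferInstance,
        fun l => (D.last l, D.accept (D.last l)), fun l v => (D.back l v.1, D.accept v.1),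
        fun v => v.2⟩ n t = (D.run n t, (f.next).Holds t) := by
      intro n
      induction n with
      | zero =>
        intro t h
        have h1 : (fun i => t (1 + i)) = t := by
          funext i
          rw [h, h i] <;> omega
        simp only [run, HyperBody.holds_next, h1, Prod.mk.injEq, true_and, eq_iff_iff]
        exact (hD 0 t h).symm
      | succ n ih =>
        intro t h
        simp only [run]
        rw [ih _ (eq_of_shift h)]
        simp only [HyperBody.holds_next, Prod.mk.injEq, true_and, eq_iff_iff]
        simp only [add_comm 1]
        exact (hD n _ (eq_of_shift h)).symm
    exact ⟨_, fun n t h => by rw [hrun n t h]⟩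
  | untl f g ihf ihg =>
    obtain ⟨D, hD⟩ := ihf
    obtain ⟨E, hE⟩ := ihg
    have := D.finState
    have := E.finState
    have hrun : ∀ n t, (∀ i, n ≤ i → t i = t n) →
        TailAutomaton.run ⟨D.State × E.State × Prop, inferInstance,
        fun l => (D.last l, E.last l, E.accept (E.last l)),
        fun l v => (D.back l v.1, E.back l v.2.1,
          E.accept (E.back l v.2.1) ∨ D.accept (D.back l v.1) ∧ v.2.2),
        fun v => v.2.2⟩ n t = (D.run n t, E.run n t, (f.untl g).Holds t) := by
      intro n
      induction n with
      | zero =>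
        intro t h
        simp only [run, Prod.mk.injEq, true_and, eq_iff_iff]
        rw [HyperBody.holds_untl_of_const f g t fun i => h i (by omega)]
        exact (hE 0 t h).symm
      | succ n ih =>
        intro t h
        simp only [run]
        rw [ih _ (eq_of_shift h)]
        simp only [Prod.mk.injEq, true_and, eq_iff_iff]
        rw [HyperBody.holds_untl_iff f g t, hD (n + 1) t h, hE (n + 1) t h]
        rfl
    exact ⟨_, fun n t h => by rw [hrun n t h]⟩

end TailAutomaton

/-! ### Repairs select a single path -/

namespace HyperLTL

variable {AP : Type}

def matrix : HyperLTL AP → HyperBody AP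
  | ex _ f => f.matrix
  | all _ f => f.matrix
  | body f => f

theorem agree_set {A : TraceAssignment AP} {s : Set ℕ} {v : ℕ} {t : ℕ → Set AP}
    (h : ∀ u ∈ s \ {v}, A u = some t) : ∀ u ∈ s, A.set v t u = some t := by
  intro u hu
  by_cases huv : u = v
  · simp [TraceAssignment.set, huv]
  · simpa [TraceAssignment.set, huv] using h u ⟨hu, huv⟩

theorem IsAStar.holds_matrix {T : Set (ℕ → Set AP)} {t : ℕ → Set AP} (ht : t ∈ T)
    {f : HyperLTL AP} (hf : f.IsAStar) {A : TraceAssignment AP}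
    (hA : ∀ v ∈ f.freeVars, A v = some t) (h : f.Sat T A) : f.matrix.Holds t := by
  induction f generalizing A with
  | ex v f ih => exact hf.elim
  | all v f ih => exact ih hf (agree_set hA) (h t ht)
  | body f => exact (f.sat_congr hA).1 h

theorem IsAStar.sat_singleton {t : ℕ → Set AP} {f : HyperLTL AP} (hf : f.IsAStar)
    {A : TraceAssignment AP} (hA : ∀ v ∈ f.freeVars, A v = some t) (h : f.matrix.Holds t) :
    f.Sat {t} A := by
  induction f generalizing A with
  | ex v f ih => exact hf.elim
  | all v f ih =>
    rintro _ rfl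
    exact ih hf (agree_set hA) h
  | body f => exact (f.sat_congr hA).2 h

theorem Closed.agree {f : HyperLTL AP} (hf : f.Closed) (A : TraceAssignment AP)
    (t : ℕ → Set AP) : ∀ v ∈ f.freeVars, A v = some t := by
  rw [hf]
  simp

/-- One trace serves all the variables: the existential witness if there is one, otherwise any
trace, which is where nonemptiness enters. Every universal quantifier is then instantiated with it.
-/
theorem exists_holds_of_sat {f : HyperLTL AP} (hc : f.Closed) (hf : f.IsAStar ∨ f.IsEAStar)
    {T : Set (ℕ → Set AP)} (hT : T.Nonempty) (h : f.Sat T .empty) :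
    ∃ t ∈ T, f.matrix.Holds t := by
  rcases hf with hf | hf
  · obtain ⟨t, ht⟩ := hT
    exact ⟨t, ht, hf.holds_matrix ht (hc.agree _ t) h⟩
  · cases f with
    | ex v f =>
      obtain ⟨t, ht, h⟩ := h
      exact ⟨t, ht, IsAStar.holds_matrix (f := f) ht hf (agree_set (hc.agree _ t)) h⟩
    | all => exact hf.elim
    | body => exact hf.elim

/-- With a single trace to choose from, quantifiers of both kinds must pick it. -/
theorem sat_singleton_of_holds {f : HyperLTL AP} (hc : f.Closed) (hf : f.IsAStar ∨ f.IsEAStar)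
    {t : ℕ → Set AP} (h : f.matrix.Holds t) : f.Sat {t} .empty := by
  rcases hf with hf | hf
  · exact hf.sat_singleton (hc.agree _ t) h
  · cases f with
    | ex v f => exact ⟨t, rfl, IsAStar.sat_singleton hf (agree_set (hc.agree _ t)) h⟩
    | all => exact hf.elim
    | body => exact hf.elim

end HyperLTL

namespace Kripke

variable {AP S : Type} {K : Kripke AP S}

def traceOf (K : Kripke AP S) (p : ℕ → S) : ℕ → Set AP := fun i => K.label (p i)

theorem traces_nonempty (K : Kripke AP S) : K.Traces.Nonempty := by
  choose nxt hnxt using K.total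
  exact ⟨_, fun i => nxt^[i] K.initial, ⟨rfl, fun i => by
    simpa only [Function.iterate_succ_apply'] using hnxt _⟩, fun i => rfl⟩

/-- A path of an acyclic structure that returns to a state stays there. -/
theorem Acyclic.succ_eq (hK : K.Acyclic) {p : ℕ → S} (hp : ∀ i, K.trans (p i) (p (i + 1)))
    {i j : ℕ} (hij : i < j) (h : p i = p j) {s : S} (hs : K.trans (p i) s) : s = p i := by
  obtain ⟨d, rfl⟩ : ∃ d, j = i + d + 1 := ⟨j - i - 1, by omega⟩
  refine hK d (fun k => p (i + k)) ⟨fun k _ => hp _, ?_⟩ 0 (by omega) s hs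
  have := hp (i + d)
  rwa [← h] at this

theorem Acyclic.const_of_eq (hK : K.Acyclic) {p : ℕ → S} (hp : ∀ i, K.trans (p i) (p (i + 1)))
    {i j : ℕ} (hij : i < j) (h : p i = p j) : ∀ k, i ≤ k → p k = p i := by
  intro k hk
  induction k, hk using Nat.le_induction with
  | base => rfl
  | succ k hk ih =>
    have := hp k
    rw [ih] at this
    exact hK.succ_eq hp hij h this

/-- Once a state recurs, the path is constant from its first occurrence on. So a path prescribes one
successor for each visited state, and a repair, which cannot depend on the history, is able to
isolate it. -/
theorem Acyclic.succ_eq_succ (hK : K.Acyclic) {p : ℕ → S}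
    (hp : ∀ i, K.trans (p i) (p (i + 1))) {i j : ℕ} (h : p i = p j) : p (i + 1) = p (j + 1) := by
  rcases lt_trichotomy i j with hij | rfl | hij
  · rw [hK.const_of_eq hp hij h (i + 1) (by omega), hK.const_of_eq hp hij h (j + 1) (by omega)]
  · rfl
  · rw [hK.const_of_eq hp hij h.symm (i + 1) (by omega),
      hK.const_of_eq hp hij h.symm (j + 1) (by omega)]

theorem Acyclic.exists_const [Finite S] (hK : K.Acyclic) {p : ℕ → S}
    (hp : ∀ i, K.trans (p i) (p (i + 1))) : ∃ n, ∀ i, n ≤ i → p i = p n := by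
  obtain ⟨i, j, hij, h⟩ := Finite.exists_ne_map_eq_of_infinite p
  rcases hij.lt_or_gt with hij | hij
  · exact ⟨i, hK.const_of_eq hp hij h⟩
  · exact ⟨j, hK.const_of_eq hp hij h.symm⟩

theorem Acyclic.repairable_iff (hK : K.Acyclic) {f : HyperLTL AP} (hc : f.Closed)
    (hf : f.IsAStar ∨ f.IsEAStar) :
    K.Repairable f ↔ ∃ p, K.IsPath p ∧ f.matrix.Holds (K.traceOf p) := by
  constructor
  · rintro ⟨K', h0, htr, hl, hsat⟩
    obtain ⟨t, ⟨p, hp, ht⟩, h⟩ := HyperLTL.exists_holds_of_sat hc hf K'.traces_nonempty hsat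
    refine ⟨p, ⟨hp.1.trans h0, fun i => htr _ _ (hp.2 i)⟩, ?_⟩
    have : K.traceOf p = t := by
      funext i
      rw [ht, hl, traceOf]
    rwa [this]
  · rintro ⟨p, ⟨hp0, hp⟩, h⟩
    -- A visited state keeps just the transition that the path uses; an unvisited one keeps an
    -- arbitrary transition, so that it does not become a deadlock.
    have hnxt : ∀ s, ∃ s', K.trans s s' ∧ ∀ i, p i = s → p (i + 1) = s' := by
      intro s
      by_cases hs : ∃ i, p i = s
      · obtain ⟨i, rfl⟩ := hs
        exact ⟨p (i + 1), hp i, fun j hj => hK.succ_eq_succ hp hj⟩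
      · obtain ⟨s', hs'⟩ := K.total s
        exact ⟨s', hs', fun i hi => (hs ⟨i, hi⟩).elim⟩
    choose nxt hnxt1 hnxt2 using hnxt
    refine ⟨⟨K.initial, fun s s' => s' = nxt s, K.label, fun s => ⟨_, rfl⟩⟩, rfl, ?_, rfl, ?_⟩
    · rintro s _ rfl
      exact hnxt1 s
    · have : Kripke.Traces ⟨K.initial, fun s s' => s' = nxt s, K.label, fun s => ⟨_, rfl⟩⟩ =
          {K.traceOf p} := by
        have huniq : ∀ q : ℕ → S, q 0 = K.initial → (∀ i, q (i + 1) = nxt (q i)) → q = p := by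
          intro q hq0 hq
          funext i
          induction i with
          | zero => rw [hq0, hp0]
          | succ i ih => rw [hq, ih, ← hnxt2 (p i) i rfl]
        ext t
        constructor
        · rintro ⟨q, ⟨hq0, hq⟩, ht⟩
          obtain rfl := huniq q hq0 hq
          exact funext ht
        · rintro rfl
          exact ⟨p, ⟨hp0, fun i => hnxt2 _ i rfl⟩, fun i => rfl⟩
      rw [Models, this]
      exact HyperLTL.sat_singleton_of_holds hc hf h

/-! ### Runs of a tail automaton along the paths -/

/-- The pair `(i, v)` of a state and an automaton state is reached by guessing. -/
def Guess (K : Kripke AP S) (D : TailAutomaton AP) : S × D.State → S × D.State → Prop :=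
  fun x y => K.trans x.1 y.1 ∧ x.2 = D.back (K.label x.1) y.2

/-- The automaton runs backwards while the path is explored forwards, so its value on the remaining
trace has to be guessed. The first guess must be accepting, and each transition checks one guess
against the next. -/
def Guessed (K : Kripke AP S) (D : TailAutomaton AP) (x : S × D.State) : Prop :=
  ∃ v, D.accept v ∧ Relation.ReflTransGen (K.Guess D) (K.initial, v) x

/-- A path ends in a self-loop, and there the guessed value can be compared with `last`; this is the
only point where the chain of guesses is anchored. Conversely, a checked chain unrolls from its end
into a path whose run has the guessed values. -/
theorem Acyclic.exists_path_iff [Finite S] (hK : K.Acyclic) {f : HyperBody AP}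
    {D : TailAutomaton AP} (hD : D.Recognizes f) :
    (∃ p, K.IsPath p ∧ f.Holds (K.traceOf p)) ↔
      ∃ s, K.Guessed D (s, D.last (K.label s)) ∧ K.trans s s := by
  constructor
  · rintro ⟨p, ⟨hp0, hp⟩, h⟩
    obtain ⟨n, hn⟩ := hK.exists_const hp
    have key : ∀ m (p : ℕ → S), (∀ i, K.trans (p i) (p (i + 1))) →
        Relation.ReflTransGen (K.Guess D) (p 0, D.run m (K.traceOf p))
          (p m, D.last (K.label (p m))) := by
      intro m
      induction m with
      | zero => exact fun p _ => .refl
      | succ m ih =>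
        intro p hp
        exact .head ⟨hp 0, rfl⟩ (ih (fun i => p (i + 1)) fun i => hp _)
    refine ⟨p n, ⟨D.run n (K.traceOf p), (hD n _ fun i hi => ?_).1 h, hp0 ▸ key n p hp⟩, ?_⟩
    · rw [traceOf, hn i hi, traceOf]
    · have := hp n
      rwa [hn (n + 1) (by omega)] at this
  · rintro ⟨s, ⟨v, hv, h⟩, hs⟩
    have : ∀ x : S × D.State,
        Relation.ReflTransGen (K.Guess D) x (s, D.last (K.label s)) →
        ∃ (p : ℕ → S) (n : ℕ), p 0 = x.1 ∧ (∀ i, K.trans (p i) (p (i + 1))) ∧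
          (∀ i, n ≤ i → p i = p n) ∧ D.run n (K.traceOf p) = x.2 := by
      intro x hx
      induction hx using Relation.ReflTransGen.head_induction_on with
      | refl => exact ⟨fun _ => s, 0, rfl, fun _ => hs, fun _ _ => rfl, rfl⟩
      | @head x y hxy _ ih =>
        obtain ⟨p, n, hp0, hp, hn, hrun⟩ := ih
        refine ⟨fun i => Nat.casesOn i x.1 p, n + 1, rfl, ?_, ?_, ?_⟩
        · rintro (_ | i)
          · change K.trans x.1 (p 0)
            rw [hp0]
            exact hxy.1
          · exact hp i
        · rintro (_ | i) hi
          · omega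
          · exact hn i (by omega)
        · rw [hxy.2, ← hrun]
          rfl
    obtain ⟨p, n, hp0, hp, hn, hrun⟩ := this _ h
    refine ⟨p, ⟨hp0, hp⟩, (hD n _ fun i hi => ?_).2 (hrun ▸ hv)⟩
    rw [traceOf, hn i hi, traceOf]

end Kripke

/-! ### The letters of an encoded structure -/

theorem List.getElem?_flatMap_of_length_eq {α β : Type} (f : α → List β) (m : ℕ)
    (hm : ∀ x, (f x).length = m) (l : List α) (a r : ℕ) (hr : r < m) :
    (l.flatMap f)[a * m + r]? = l[a]?.bind fun x => (f x)[r]? := by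
  induction l generalizing a with
  | nil => simp
  | cons x l ih =>
    rw [List.flatMap_cons]
    cases a with
    | zero => simp [List.getElem?_append, hm, hr]
    | succ a =>
      rw [List.getElem?_append_right (by rw [hm]; nlinarith), hm,
        show (a + 1) * m + r - m = a * m + r by rw [add_mul]; omega, ih]
      simp

namespace Kripke

variable {AP : Type} {n : ℕ} (K : Kripke AP (Fin n))

theorem length_encode : K.encode.length = n * (n + 1) := by
  simp [encode, List.length_flatMap]

-- The encoding consists of blocks of n + 1 letters. Position 0 of the head is the left end marker,
-- hence the shift by 1.
open Classical in
theorem inputCell_encode_state (i : Fin n) :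
    LogSpace.inputCell K.encode (i * (n + 1) + 1) =
      .letter (.inl (decide (i = K.initial), K.label i)) := by
  have := List.getElem?_flatMap_of_length_eq (fun i : Fin n =>
    (Sum.inl (decide (i = K.initial), K.label i) :: (List.finRange n).map fun j =>
      Sum.inr (decide (K.trans i j)) : List ((Bool × Set AP) ⊕ Bool))) (n + 1) (by simp)
    (List.finRange n) i 0 (by omega)
  rw [LogSpace.inputCell]
  rw [add_zero] at this
  simp only [encode]
  rw [this]
  simp

open Classical in
theorem inputCell_encode_edge (i j : Fin n) :
    LogSpace.inputCell K.encode (i * (n + 1) + 2 + j) =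
      .letter (.inr (decide (K.trans i j))) := by
  have := List.getElem?_flatMap_of_length_eq (fun i : Fin n =>
    (Sum.inl (decide (i = K.initial), K.label i) :: (List.finRange n).map fun j =>
      Sum.inr (decide (K.trans i j)) : List ((Bool × Set AP) ⊕ Bool))) (n + 1) (by simp)
    (List.finRange n) i (j + 1) (by omega)
  rw [show (i : ℕ) * (n + 1) + 2 + j = (i * (n + 1) + (j + 1)) + 1 by ring, LogSpace.inputCell]
  simp only [encode]
  rw [this]
  simp

/-- A head position that carries a letter belongs to a state or to an edge. -/
theorem position_cases (p : ℕ) (x : (Bool × Set AP) ⊕ Bool)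
    (hx : LogSpace.inputCell K.encode p = .letter x) :
    (∃ i : Fin n, p = i * (n + 1) + 1) ∨ ∃ i j : Fin n, p = i * (n + 1) + 2 + j := by
  have hp : p < K.encode.length + 1 := by
    by_contra h
    rw [(LogSpace.RulerMachine.inputCell_eq_rightEnd_iff _ _).2 (by omega)] at hx
    cases hx
  rw [length_encode] at hp
  cases p with
  | zero => cases hx
  | succ p =>
    have h1 := Nat.div_add_mod p (n + 1)
    have h2 : p % (n + 1) < n + 1 := Nat.mod_lt _ (by omega)
    have h3 : p / (n + 1) < n := Nat.div_lt_of_lt_mul (by rw [mul_comm]; omega)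
    rw [mul_comm] at h1
    rcases Nat.eq_zero_or_pos (p % (n + 1)) with h4 | h4
    · exact .inl ⟨⟨p / (n + 1), h3⟩, by simp only; omega⟩
    · exact .inr ⟨⟨p / (n + 1), h3⟩, ⟨p % (n + 1) - 1, by omega⟩, by simp only; omega⟩

end Kripke

namespace LogSpace

/-! ### Two binary registers -/

/-- The last `W` binary digits of two numbers. -/
def binaryPair : ℕ → ℕ → ℕ → List (Bool × Bool)
  | 0, _, _ => []
  | W + 1, i, j => (i.bodd, j.bodd) :: binaryPair W i.div2 j.div2

inductive PairOp : Type
  | idle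
  | incBoth
  | inc
  | dec
  | clear
  | copy
  | compare

instance : Finite PairOp := by
  let f : PairOp → Fin 7
    | .idle => 0
    | .incBoth => 1
    | .inc => 2
    | .dec => 3
    | .clear => 4
    | .copy => 5
    | .compare => 6
  refine Finite.of_injective f fun a b h => ?_
  cases a <;> cases b <;> simp_all [f]

/-- The Boolean is the carry of an increment, the borrow of a decrement, or the verdict so far of a
comparison; the other operations just pass it on. `incBoth` computes its carry from the first
register, since it is applied only while both agree. -/
def PairOp.sweep : PairOp → Bool → Bool × Bool → Bool × (Bool × Bool)
  | idle, c, a => (c, a)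
  | incBoth, c, a => (c && a.1, (xor c a.1, xor c a.1))
  | inc, c, a => (c && a.2, (a.1, xor c a.2))
  | dec, c, a => (c && !a.2, (a.1, xor c a.2))
  | clear, c, a => (c, (a.1, false))
  | copy, c, a => (c, (a.2, a.2))
  | compare, c, a => (c && a.1 == a.2, a)

namespace PairOp

theorem sweepList_idle (c : Bool) (l : List (Bool × Bool)) :
    sweepList idle.sweep c l = (c, l) := by
  induction l with
  | nil => rfl
  | cons a l ih => simp [sweepList, sweep, ih]

theorem incBoth_false (W i : ℕ) :
    (sweepList incBoth.sweep false (binaryPair W i i)).2 = binaryPair W i i := by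
  induction W generalizing i with
  | zero => rfl
  | succ W ih => simp [binaryPair, sweepList, sweep, ih]

theorem incBoth_true (W i : ℕ) :
    (sweepList incBoth.sweep true (binaryPair W i i)).2 = binaryPair W (i + 1) (i + 1) := by
  induction W generalizing i with
  | zero => rfl
  | succ W ih =>
    cases h : i.bodd <;>
      simp [binaryPair, sweepList, sweep, h, ih, incBoth_false, Nat.div2_succ, Nat.bodd_succ]

theorem inc_false (W i j : ℕ) :
    (sweepList inc.sweep false (binaryPair W i j)).2 = binaryPair W i j := by
  induction W generalizing i j with
  | zero => rfl
  | succ W ih => simp [binaryPair, sweepList, sweep, ih]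

theorem inc_true (W i j : ℕ) :
    (sweepList inc.sweep true (binaryPair W i j)).2 = binaryPair W i (j + 1) := by
  induction W generalizing i j with
  | zero => rfl
  | succ W ih =>
    cases h : j.bodd <;>
      simp [binaryPair, sweepList, sweep, h, ih, inc_false, Nat.div2_succ, Nat.bodd_succ]

theorem dec_false (W i j : ℕ) :
    sweepList dec.sweep false (binaryPair W i j) = (false, binaryPair W i j) := by
  induction W generalizing i j with
  | zero => rfl
  | succ W ih => simp [binaryPair, sweepList, sweep, ih]

/-- The surviving borrow is the test for zero. What the register then contains is irrelevant,
because the machine clears it next. -/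
theorem dec_zero (W i : ℕ) :
    ∃ j, sweepList dec.sweep true (binaryPair W i 0) = (true, binaryPair W i j) := by
  induction W generalizing i with
  | zero => exact ⟨0, rfl⟩
  | succ W ih =>
    obtain ⟨j, hj⟩ := ih i.div2
    exact ⟨Nat.bit true j, by simp [binaryPair, sweepList, sweep, hj, -Nat.bit_true]⟩

theorem dec_succ (W i j : ℕ) (hj : j + 1 < 2 ^ W) :
    sweepList dec.sweep true (binaryPair W i (j + 1)) = (false, binaryPair W i j) := by
  induction W generalizing i j with
  | zero => simp at hj
  | succ W ih =>
    cases h : j.bodd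
    · simp [binaryPair, sweepList, sweep, h, dec_false, Nat.div2_succ, Nat.bodd_succ]
    · have h1 := Nat.bodd_add_div2 j
      rw [h, Bool.toNat_true] at h1
      have := ih i.div2 j.div2 (by rw [pow_succ] at hj; omega)
      simp [binaryPair, sweepList, sweep, h, this, Nat.div2_succ, Nat.bodd_succ]

theorem clear_eq (c : Bool) (W i j : ℕ) :
    (sweepList clear.sweep c (binaryPair W i j)).2 = binaryPair W i 0 := by
  induction W generalizing i j with
  | zero => rfl
  | succ W ih => simp [binaryPair, sweepList, sweep, ih]

theorem copy_eq (c : Bool) (W i j : ℕ) :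
    (sweepList copy.sweep c (binaryPair W i j)).2 = binaryPair W j j := by
  induction W generalizing i j with
  | zero => rfl
  | succ W ih => simp [binaryPair, sweepList, sweep, ih]

theorem compare_eq (c : Bool) (W i j : ℕ) (hi : i < 2 ^ W) (hj : j < 2 ^ W) :
    (sweepList compare.sweep c (binaryPair W i j)).1 = (c && decide (i = j)) := by
  induction W generalizing i j c with
  | zero =>
    obtain rfl : i = 0 := by simpa using hi
    obtain rfl : j = 0 := by simpa using hj
    simp [binaryPair, sweepList]
  | succ W ih =>
    rw [pow_succ] at hi hj
    have := fun c => ih c i.div2 j.div2 (by rw [Nat.div2_val]; omega) (by rw [Nat.div2_val]; omega)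
    simp only [binaryPair, sweepList, sweep, this]
    have h1 := Nat.bodd_add_div2 i
    have h2 := Nat.bodd_add_div2 j
    by_cases hij : i = j
    · simp [hij]
    · by_cases h3 : i.bodd = j.bodd
      · have : i.div2 ≠ j.div2 := by
          intro h4
          rw [h3, h4] at h1
          omega
        simp [hij, this]
      · simp [hij, h3]

theorem binaryPair_zero (W : ℕ) : binaryPair W 0 0 = List.replicate W (false, false) := by
  induction W with
  | zero => rfl
  | succ W ih => simp [binaryPair, List.replicate_succ, ih]

end PairOp

/-! ### Guessing a path and a run of a tail automaton along it -/

/-- Control states. The first register of the machine holds a state of the Kripke structure, the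
second one counts positions; the Boolean of `rewind` and `seek` says that the state in the first
register has yet to be recognized as the initial one. -/
inductive GuessCtl (AP V : Type) : Type
  | start : GuessCtl AP V
  | guess : V → GuessCtl AP V
  | rewind : Bool → V → GuessCtl AP V
  | seek : Bool → V → GuessCtl AP V
  | found : Bool → V → Bool → Set AP → GuessCtl AP V
  | row : V → Set AP → GuessCtl AP V
  | test : GuessCtl AP V

instance {AP V : Type} [Finite AP] [Finite V] : Finite (GuessCtl AP V) := by
  let f : GuessCtl AP V →
      Unit ⊕ V ⊕ (Bool × V) ⊕ (Bool × V) ⊕ (Bool × V × Bool × Set AP) ⊕ (V × Set AP) ⊕ Unit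
    | .start => .inl ()
    | .guess v => .inr (.inl v)
    | .rewind b v => .inr (.inr (.inl (b, v)))
    | .seek b v => .inr (.inr (.inr (.inl (b, v))))
    | .found b v c l => .inr (.inr (.inr (.inr (.inl (b, v, c, l)))))
    | .row v l => .inr (.inr (.inr (.inr (.inr (.inl (v, l))))))
    | .test => .inr (.inr (.inr (.inr (.inr (.inr ())))))
  refine Finite.of_injective f fun a b h => ?_
  cases a <;> cases b <;> simp_all [f]

open GuessCtl PairOp in
/-- The moves: from a control state and a flag, with the letter under the input head, to a control
state, an operation on the registers with its initial flag, and a move of the input head. -/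
inductive GuessMove {AP : Type} (D : TailAutomaton AP) : GuessCtl AP D.State → Bool →
    InputCell ((Bool × Set AP) ⊕ Bool) → GuessCtl AP D.State → PairOp → Bool → HeadMove → Prop
  | start (b x v) : D.accept v → GuessMove D start b x (guess v) idle false .stay
  | count (b x v) : GuessMove D (guess v) b x (guess v) incBoth true .stay
  | guess (b x v) : GuessMove D (guess v) b x (rewind true v) idle false .stay
  | left (b x fl v) : x ≠ .leftEnd → GuessMove D (rewind fl v) b x (rewind fl v) idle false .left
  | turn (b fl v) : GuessMove D (rewind fl v) b .leftEnd (seek fl v) idle false .right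
  | pass (b fl v e) : GuessMove D (seek fl v) b (.letter (.inr e)) (seek fl v) idle false .right
  | dec (b fl v ini lab) : GuessMove D (seek fl v) b (.letter (.inl (ini, lab)))
      (found fl v ini lab) dec true .stay
  | next (x fl v ini lab) : GuessMove D (found fl v ini lab) false x (seek fl v) idle false .right
  | found (x fl v ini lab) : (fl = true → ini = true) →
      GuessMove D (found fl v ini lab) true x (row v lab) clear false .right
  | skip (b e v lab) : GuessMove D (row v lab) b (.letter (.inr e)) (row v lab) inc true .right
  | take (b v' lab) : GuessMove D (row (D.back lab v') lab) b (.letter (.inr true))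
      (rewind false v') copy false .stay
  | finish (b lab) : GuessMove D (row (D.last lab) lab) b (.letter (.inr true)) test compare true .stay

def PairOp.sweepWith {C : Type} (s : C × PairOp × Bool) (a : Bool × Bool) :
    (C × PairOp × Bool) × (Bool × Bool) :=
  ((s.1, s.2.1, (s.2.1.sweep s.2.2 a).1), (s.2.1.sweep s.2.2 a).2)

theorem PairOp.sweepList_sweepWith {C : Type} (s : C × PairOp × Bool) (l : List (Bool × Bool)) :
    sweepList PairOp.sweepWith s l =
      ((s.1, s.2.1, (sweepList s.2.1.sweep s.2.2 l).1), (sweepList s.2.1.sweep s.2.2 l).2) := by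
  induction l generalizing s with
  | nil => rfl
  | cons a l ih => simp [sweepList, ih, PairOp.sweepWith]

/-- To find block i, the head is rewound and the second register, a copy of i, is decremented at
each state letter until it underflows. Within the row this register is cleared and counts columns,
so that at a chosen edge it holds the successor: copying it moves on along the path, and comparing
it with the first register detects a self-loop. The initial state is guessed by counting up and
confirmed when its block is found. -/
def guessMachine {AP : Type} [Finite AP] (D : TailAutomaton AP) :
    RulerMachine ((Bool × Set AP) ⊕ Bool) Unit where
  State := GuessCtl AP D.State × PairOp × Bool
  Cell := Bool × Bool
  finState := have := D.finState; inferInstance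
  finCell := inferInstance
  start := (.start, .idle, false)
  blank := (false, false)
  delta := fun s x => {y | GuessMove D s.1 s.2.2 x y.1.1 y.1.2.1 y.1.2.2 y.2.1 ∧ y.2.2 = none}
  sweep := PairOp.sweepWith
  sweep_start := fun _ => rfl

namespace guessMachine

variable {AP : Type} (D : TailAutomaton AP)

variable {n : ℕ} (K : Kripke AP (Fin n))

/-- Which states of the structure the first register may hold. -/
def Plausible : Bool → ℕ → D.State → Prop
  | true, _, v => D.accept v
  | false, i, v => ∃ h : i < n, K.Guessed D (⟨i, h⟩, v)

open GuessCtl in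
/-- What holds throughout the computations on the encoding of `K`. -/
inductive Inv (W : ℕ) : GuessCtl AP D.State → Bool → ℕ → List (Bool × Bool) → Prop
  | start (b p) : Inv W start b p (binaryPair W 0 0)
  | guess (b p i v) : D.accept v → Inv W (guess v) b p (binaryPair W i i)
  | rewind (b p i fl v) : i < 2 ^ W → Plausible D K fl i v →
      Inv W (rewind fl v) b p (binaryPair W i i)
  | seek (b p fl v i c m) : i < 2 ^ W → Plausible D K fl i v → c + m = i → m * (n + 1) < p + n →
      p ≤ m * (n + 1) + 1 → Inv W (seek fl v) b p (binaryPair W i c)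
  | next (fl v i c ini lab) (m : Fin n) : i < 2 ^ W → Plausible D K fl i v → c + m + 1 = i →
      Inv W (found fl v ini lab) false (m * (n + 1) + 1) (binaryPair W i c)
  | found (fl v c ini) (i : Fin n) : Plausible D K fl i v → (ini = true → i = K.initial) →
      Inv W (found fl v ini (K.label i)) true (i * (n + 1) + 1) (binaryPair W i c)
  | row (b v c) (i : Fin n) : K.Guessed D (i, v) → c ≤ n →
      Inv W (row v (K.label i)) b (i * (n + 1) + 2 + c) (binaryPair W i c)
  | test (b p l) : (b = true → ∃ i, K.Guessed D (i, D.last (K.label i)) ∧ K.trans i i) →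
      Inv W test b p l

/-! ### Soundness: every computation follows a path -/

variable {D K}

theorem block_inj {m a b c d : ℕ} (hc : c < m) (hd : d < m) (h : a * m + c = b * m + d) :
    a = b ∧ c = d := by
  have h1 := congrArg (· % m) h
  have h2 := congrArg (· / m) h
  simp only [Nat.mul_comm _ m, Nat.mul_add_mod, Nat.mod_eq_of_lt hc, Nat.mod_eq_of_lt hd] at h1
  rw [Nat.mul_comm, Nat.mul_comm b, Nat.mul_add_div (by omega), Nat.mul_add_div (by omega),
    Nat.div_eq_of_lt hc, Nat.div_eq_of_lt hd] at h2
  exact ⟨by omega, h1⟩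

/-- The guessing loop may count beyond the capacity of the registers; only the residue modulo 2 ^ W
remains visible. -/
theorem exists_binaryPair_eq (W i : ℕ) : ∃ j < 2 ^ W, binaryPair W i i = binaryPair W j j := by
  induction W generalizing i with
  | zero => exact ⟨0, by simp, rfl⟩
  | succ W ih =>
    obtain ⟨j, hj, h⟩ := ih i.div2
    refine ⟨Nat.bit i.bodd j, ?_, by simp [binaryPair, h]⟩
    rw [pow_succ, Nat.bit_val]
    cases i.bodd <;> simp <;> omega

open Classical in
/-- A letter that belongs to a state, with the position where it is found. -/
theorem exists_of_letter_inl {p : ℕ} {ini : Bool} {lab : Set AP}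
    (h : inputCell K.encode p = .letter (.inl (ini, lab))) :
    ∃ i : Fin n, p = i * (n + 1) + 1 ∧ ini = decide (i = K.initial) ∧ lab = K.label i := by
  rcases K.position_cases p _ h with ⟨i, rfl⟩ | ⟨i, j, rfl⟩
  · rw [K.inputCell_encode_state] at h
    simp only [InputCell.letter.injEq, Sum.inl.injEq, Prod.mk.injEq] at h
    exact ⟨i, rfl, h.1.symm, h.2.symm⟩
  · rw [K.inputCell_encode_edge] at h
    simp at h

open Classical in
theorem exists_of_letter_inr {p : ℕ} {e : Bool}
    (h : inputCell K.encode p = .letter (.inr e)) :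
    ∃ i j : Fin n, p = i * (n + 1) + 2 + j ∧ e = decide (K.trans i j) := by
  rcases K.position_cases p _ h with ⟨i, rfl⟩ | ⟨i, j, rfl⟩
  · rw [K.inputCell_encode_state] at h
    simp at h
  · rw [K.inputCell_encode_edge] at h
    simp only [InputCell.letter.injEq, Sum.inr.injEq] at h
    exact ⟨i, j, rfl, h.symm⟩

theorem moveInput_right {p : ℕ} (i : Fin n) (c : ℕ) (hc : c ≤ n) (hp : p = i * (n + 1) + 1 + c) :
    moveInput K.encode.length p .right = p + 1 := by
  have h : ((i : ℕ) + 1) * (n + 1) ≤ n * (n + 1) := Nat.mul_le_mul_right _ i.2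
  rw [add_mul] at h
  simp only [moveInput, K.length_encode]
  omega

theorem eq_zero_of_leftEnd {Γ : Type} {w : List Γ} {p : ℕ} (h : inputCell w p = .leftEnd) :
    p = 0 := by
  cases p with
  | zero => rfl
  | succ p =>
    rw [inputCell] at h
    cases h1 : w[p]? <;> simp [h1] at h

/-- In the `seek` case of the invariant, m is the number of state letters already passed, so c + m =
i says how many are still to come. For positive m the two inequalities confine the head to the
stretch behind the letter of state m - 1, up to that of state m. Hence the next state letter met is
that of m, and an underflow there forces m = i. -/
theorem Inv.step {W : ℕ} (hW : n < 2 ^ W) {k k' : GuessCtl AP D.State} {b b' : Bool} {p : ℕ}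
    {l : List (Bool × Bool)} {op : PairOp} {mv : HeadMove} (h : Inv D K W k b p l)
    (hm : GuessMove D k b (inputCell K.encode p) k' op b' mv) :
    Inv D K W k' (sweepList op.sweep b' l).1 (moveInput K.encode.length p mv)
      (sweepList op.sweep b' l).2 := by
  generalize hx : inputCell K.encode p = x at hm
  cases h with
  | start =>
    cases hm with
    | start _ _ v hv => rw [PairOp.sweepList_idle]; exact .guess _ _ _ _ hv
  | guess _ _ i v hv =>
    cases hm with
    | count => rw [PairOp.incBoth_true]; exact .guess _ _ _ _ hv
    | guess =>
      obtain ⟨j, hj, h⟩ := exists_binaryPair_eq W i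
      rw [PairOp.sweepList_idle, h]
      exact .rewind _ _ _ _ _ hj hv
  | rewind _ _ i fl v hi hv =>
    cases hm with
    | left => rw [PairOp.sweepList_idle]; exact .rewind _ _ _ _ _ hi hv
    | turn =>
      rw [PairOp.sweepList_idle]
      obtain rfl := eq_zero_of_leftEnd hx
      exact .seek _ _ _ _ i i 0 hi hv rfl (by simp [moveInput]) (by simp [moveInput])
  | seek _ _ fl v i c m hi hv hc h1 h2 =>
    cases hm with
    | pass _ _ _ e =>
      obtain ⟨r, j, rfl, -⟩ := exists_of_letter_inr hx
      rw [PairOp.sweepList_idle, moveInput_right (K := K) r (j + 1) (by omega) (by ring)]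
      have hr : (r : ℕ) + 1 ≤ m := by
        by_contra hr
        have : m * (n + 1) ≤ r * (n + 1) := Nat.mul_le_mul_right _ (by omega)
        omega
      have hr := Nat.mul_le_mul_right (n + 1) hr
      rw [add_mul] at hr
      exact .seek _ _ _ _ i c m hi hv hc (by omega) (by omega)
    | dec _ _ _ ini lab =>
      obtain ⟨r, rfl, hini, rfl⟩ := exists_of_letter_inl hx
      have hr : (r : ℕ) = m := by
        have h3 : (r : ℕ) ≤ m := by
          by_contra hr
          have := Nat.mul_le_mul_right (n + 1) (show m + 1 ≤ r by omega)
          rw [add_mul] at this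
          omega
        have h4 : m ≤ (r : ℕ) := by
          by_contra hr
          have := Nat.mul_le_mul_right (n + 1) (show (r : ℕ) + 1 ≤ m by omega)
          rw [add_mul] at this
          omega
        omega
      subst hr
      cases c with
      | zero =>
        obtain ⟨j, hj⟩ := PairOp.dec_zero W i
        rw [hj]
        obtain rfl : (r : ℕ) = i := by omega
        exact .found fl v j ini r hv (by simp [hini])
      | succ c =>
        rw [PairOp.dec_succ W i c (by omega)]
        exact .next fl v i c ini _ r hi hv (by omega)
  | next fl v i c ini lab m hi hv hc =>
    cases hm with
    | next =>
      rw [PairOp.sweepList_idle, moveInput_right (K := K) m 0 (by omega) (by ring)]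
      exact .seek _ _ _ _ i c (m + 1) hi hv (by omega) (by rw [add_mul]; omega)
        (by rw [add_mul]; omega)
  | found fl v c ini i hv hini =>
    cases hm with
    | found _ _ _ _ _ hfl =>
      rw [PairOp.clear_eq, moveInput_right (K := K) i 0 (by omega) (by ring)]
      refine .row _ _ 0 i ?_ (by omega)
      cases fl with
      | true => exact ⟨v, hv, hini (hfl rfl) ▸ .refl⟩
      | false => exact hv.2
  | row _ v c i hv hc =>
    have hcell : ∀ e, x = .letter (.inr e) → ∃ j : Fin n, c = j ∧ (e = true → K.trans i j) := by
      rintro e rfl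
      obtain ⟨r, j, hrj, he⟩ := exists_of_letter_inr hx
      obtain ⟨h1, h2⟩ := block_inj (m := n + 1) (a := i) (b := r) (c := c) (d := j) (by omega)
        (by omega) (by omega)
      obtain rfl := Fin.ext h1
      exact ⟨j, h2, by simp [he]⟩
    cases hm with
    | skip _ e =>
      obtain ⟨j, rfl, -⟩ := hcell e rfl
      rw [PairOp.inc_true, moveInput_right (K := K) i (j + 1) (by omega) (by ring)]
      exact .row _ _ (j + 1) i hv (by omega)
    | take _ v' =>
      obtain ⟨j, rfl, he⟩ := hcell true rfl
      rw [PairOp.copy_eq]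
      obtain ⟨v0, h0, hr⟩ := hv
      exact .rewind _ _ _ _ _ (by omega) ⟨j.2, v0, h0, hr.tail ⟨he rfl, rfl⟩⟩
    | finish =>
      obtain ⟨j, rfl, he⟩ := hcell true rfl
      refine .test _ _ _ fun h => ?_
      rw [PairOp.compare_eq _ _ _ _ (by omega) (by omega)] at h
      obtain rfl : i = j := Fin.ext (by simpa using h)
      exact ⟨i, hv, he rfl⟩
  | test => cases hm

/-! #### The computations that find a path -/

theorem lt_two_pow_width (K : Kripke AP (Fin n)) : n < 2 ^ RulerMachine.width K.encode := by
  have := Nat.lt_size_self (K.encode.length + 1)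
  rw [K.length_encode] at this
  rw [RulerMachine.width, K.length_encode]
  nlinarith

/-- Some computation reaches the control state, flag, head position and registers. -/
def At [Finite AP] (D : TailAutomaton AP) (w : List ((Bool × Set AP) ⊕ Bool))
    (k : GuessCtl AP D.State) (b : Bool) (p : ℕ) (l : List (Bool × Bool)) : Prop :=
  ∃ op o, (guessMachine D).Reach w ((guessMachine D).initial w) ⟨(k, op, b), p, l, o⟩

variable [Finite AP] {w : List ((Bool × Set AP) ⊕ Bool)} {k k' : GuessCtl AP D.State} {b b' : Bool}
  {p : ℕ} {l : List (Bool × Bool)} {op : PairOp} {mv : HeadMove}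

theorem advance_eq (c : (guessMachine D).Snap) (y : Option Unit) :
    (guessMachine D).advance w c ((k', op, b'), mv, y) =
      ⟨(k', op, (sweepList op.sweep b' c.cells).1), moveInput w.length c.head mv,
        (sweepList op.sweep b' c.cells).2, c.output ++ y.toList⟩ := by
  have := PairOp.sweepList_sweepWith (k', op, b') c.cells
  simp only [RulerMachine.advance]
  congr 1
  · exact congrArg Prod.fst this
  · exact congrArg Prod.snd this

theorem At.move (h : At D w k b p l) (hm : GuessMove D k b (inputCell w p) k' op b' mv) :
    At D w k' (sweepList op.sweep b' l).1 (moveInput w.length p mv)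
      (sweepList op.sweep b' l).2 := by
  obtain ⟨op', o, h⟩ := h
  refine ⟨op, o ++ [], h.tail ⟨((k', op, b'), mv, none), ⟨hm, rfl⟩, ?_⟩⟩
  rw [advance_eq]
  rfl

theorem inv_of_reach (hW : n < 2 ^ RulerMachine.width K.encode) {c : (guessMachine D).Snap}
    (h : (guessMachine D).Reach K.encode ((guessMachine D).initial K.encode) c) :
    Inv D K (RulerMachine.width K.encode) c.state.1 c.state.2.2 c.head c.cells := by
  induction h with
  | refl =>
    have := Inv.start (D := D) (K := K) (W := RulerMachine.width K.encode) false
      (K.encode.length + 1)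
    rwa [PairOp.binaryPair_zero] at this
  | tail _ h ih =>
    obtain ⟨⟨⟨k, op, b⟩, mv, y⟩, ⟨hm, -⟩, rfl⟩ := h
    have := ih.step hW hm
    rw [advance_eq]
    exact this

theorem At.guess {v : D.State} (hv : D.accept v) (i : ℕ) :
    ∃ b, At D w (.guess v) b (w.length + 1) (binaryPair (RulerMachine.width w) i i) := by
  induction i with
  | zero =>
    have h0 : At D w .start false (w.length + 1) (binaryPair (RulerMachine.width w) 0 0) :=
      ⟨.idle, [], by rw [PairOp.binaryPair_zero]; exact .refl⟩
    have := h0.move (.start _ _ v hv)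
    rw [PairOp.sweepList_idle] at this
    exact ⟨_, this⟩
  | succ i ih =>
    obtain ⟨b, h⟩ := ih
    have := h.move (.count _ _ v)
    rw [PairOp.incBoth_true] at this
    exact ⟨_, this⟩

theorem At.rewind {fl : Bool} {v : D.State} (h : At D w (.rewind fl v) b p l) :
    ∃ b, At D w (.seek fl v) b 1 l := by
  induction p generalizing b with
  | zero =>
    have := h.move (.turn _ _ _)
    rw [PairOp.sweepList_idle] at this
    exact ⟨_, by simpa [moveInput] using this⟩
  | succ p ih =>
    have := h.move (.left _ _ _ _ fun h => by simpa using eq_zero_of_leftEnd h)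
    rw [PairOp.sweepList_idle] at this
    exact ih this

theorem At.skip {fl : Bool} {v : D.State} (i : Fin n) (j : ℕ) (hj : j ≤ n)
    (h : At D K.encode (.seek fl v) b (i * (n + 1) + 2) l) :
    ∃ b, At D K.encode (.seek fl v) b (i * (n + 1) + 2 + j) l := by
  induction j with
  | zero => exact ⟨b, h⟩
  | succ j ih =>
    obtain ⟨b, h⟩ := ih (by omega)
    have := h.move (by rw [K.inputCell_encode_edge i ⟨j, hj⟩]; exact .pass _ _ _ _)
    rw [PairOp.sweepList_idle, moveInput_right (K := K) i (j + 1) (by omega) (by ring)] at this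
    exact ⟨_, this⟩

-- Each state letter passed costs one unit of the second register, so at block i it has come down to
-- 0 and the next decrement underflows.
open Classical in
theorem At.seek {W : ℕ} {fl : Bool} {v : D.State} (i : Fin n) (hi : (i : ℕ) < 2 ^ W)
    (h : At D K.encode (.seek fl v) b 1 (binaryPair W i i)) (m : ℕ) (hm : m ≤ i) :
    ∃ b, At D K.encode (.seek fl v) b (m * (n + 1) + 1) (binaryPair W i (i - m)) := by
  induction m with
  | zero => exact ⟨b, by simpa using h⟩
  | succ m ih =>
    obtain ⟨b, h⟩ := ih (by omega)
    have := h.move (by rw [K.inputCell_encode_state ⟨m, by omega⟩]; exact .dec _ _ _ _ _)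
    rw [show (i : ℕ) - m = (i - (m + 1)) + 1 by omega, PairOp.dec_succ _ _ _ (by omega)] at this
    have := this.move (.next _ _ _ _ _)
    rw [PairOp.sweepList_idle, moveInput,
      moveInput_right (K := K) ⟨m, by omega⟩ 0 (by omega) (by simp)] at this
    obtain ⟨b, h⟩ := At.skip (K := K) ⟨m, by omega⟩ n le_rfl this
    exact ⟨b, by convert h using 1; simp only; ring⟩

open Classical in
theorem At.row {W : ℕ} {fl : Bool} {v : D.State} (i : Fin n) (hi : (i : ℕ) < 2 ^ W)
    (hfl : fl = true → i = K.initial)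
    (h : At D K.encode (.rewind fl v) b p (binaryPair W i i)) (j : ℕ) (hj : j ≤ n) :
    ∃ b, At D K.encode (.row v (K.label i)) b (i * (n + 1) + 2 + j) (binaryPair W i j) := by
  induction j with
  | zero =>
    obtain ⟨b, h⟩ := h.rewind
    obtain ⟨b, h⟩ := h.seek i hi i le_rfl
    have := h.move (by rw [K.inputCell_encode_state i]; exact .dec _ _ _ _ _)
    rw [Nat.sub_self] at this
    obtain ⟨c, hc⟩ := PairOp.dec_zero W i
    rw [hc] at this
    have := this.move (.found _ _ _ _ _ fun h => by simpa using hfl h)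
    rw [PairOp.clear_eq, moveInput,
      moveInput_right (K := K) i 0 (by omega) (by simp)] at this
    exact ⟨_, this⟩
  | succ j ih =>
    obtain ⟨b, h⟩ := ih (by omega)
    have := h.move (by rw [K.inputCell_encode_edge i ⟨j, hj⟩]; exact .skip _ _ _ _)
    rw [PairOp.inc_true, moveInput_right (K := K) i (j + 1) (by omega) (by ring)] at this
    exact ⟨_, this⟩

open Classical in
theorem At.guessed {x : Fin n × D.State} (h : K.Guessed D x) :
    ∃ fl b p, (fl = true → x.1 = K.initial) ∧ At D K.encode (.rewind fl x.2) b p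
      (binaryPair (RulerMachine.width K.encode) x.1 x.1) := by
  obtain ⟨v, hv, h⟩ := h
  induction h with
  | refl =>
    obtain ⟨b, h⟩ := At.guess hv K.initial (w := K.encode)
    have := h.move (.guess _ _ _)
    rw [PairOp.sweepList_idle] at this
    exact ⟨true, _, _, fun _ => rfl, this⟩
  | @tail x y _ hxy ih =>
    obtain ⟨fl, b, p, hfl, h⟩ := ih
    obtain ⟨b, h⟩ := h.row x.1 (x.1.2.trans (lt_two_pow_width K)) hfl y.1 y.1.2.le
    rw [hxy.2] at h
    have := h.move (by
      rw [K.inputCell_encode_edge, decide_eq_true hxy.1]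
      exact .take _ _ _)
    rw [PairOp.copy_eq] at this
    exact ⟨false, _, _, fun h => by simp at h, this⟩

open Classical in
theorem reach_accept_iff (K : Kripke AP (Fin n)) :
    (∃ c, (guessMachine D).Reach K.encode ((guessMachine D).initial K.encode) c ∧
        c.state ∈ {s : GuessCtl AP D.State × PairOp × Bool | s.1 = .test ∧ s.2.2 = true}) ↔
      ∃ i, K.Guessed D (i, D.last (K.label i)) ∧ K.trans i i := by
  constructor
  · rintro ⟨⟨⟨k, op, b⟩, p, l, o⟩, hc, h1, h2⟩
    have := inv_of_reach (lt_two_pow_width K) hc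
    simp only at h1 h2 this
    subst h1 h2
    cases this with
    | test _ _ _ h => exact h rfl
  · rintro ⟨i, hi, hii⟩
    obtain ⟨fl, b, p, hfl, h⟩ := At.guessed hi
    have hlt := i.2.trans (lt_two_pow_width K)
    obtain ⟨b, h⟩ := h.row i hlt hfl i i.2.le
    have := h.move (by
      rw [K.inputCell_encode_edge, decide_eq_true hii]
      exact .finish _ _)
    rw [PairOp.compare_eq _ _ _ _ hlt hlt] at this
    obtain ⟨op, o, h⟩ := this
    exact ⟨_, h, rfl, by simp⟩

end guessMachine

end LogSpace

theorem acyclicRepair_inNL {AP : Type} [Finite AP] {f : HyperLTL AP} (hc : f.Closed)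
    (hf : f.IsAStar ∨ f.IsEAStar) : (acyclicRepair f).InNL := by
  obtain ⟨D, hD⟩ := TailAutomaton.exists_recognizes f.matrix
  obtain ⟨L, hL, h⟩ := (LogSpace.guessMachine D).exists_mem_NL {s | s.1 = .test ∧ s.2.2 = true}
  refine ⟨L, hL, fun ⟨n, K, hK⟩ => ?_⟩
  refine (h K.encode).trans ((LogSpace.guessMachine.reach_accept_iff K).trans ?_)
  rw [← hK.exists_path_iff hD, ← hK.repairable_iff hc hf]
  rfl

/-! ### Short paths in finite graphs -/

theorem Relation.ReflTransGen.exists_short_path {α : Type} [Finite α] {R : α → α → Prop} {a b : α}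
    (h : Relation.ReflTransGen R a b) :
    ∃ n < Nat.card α, ∃ p : ℕ → α, p 0 = a ∧ p n = b ∧ ∀ i < n, R (p i) (p (i + 1)) := by
  classical
  have hex : ∃ n, ∃ p : ℕ → α, p 0 = a ∧ p n = b ∧ ∀ i < n, R (p i) (p (i + 1)) := by
    induction h with
    | refl => exact ⟨0, fun _ => a, rfl, rfl, by simp⟩
    | @tail b c _ hbc ih =>
      obtain ⟨n, p, h0, hn, hp⟩ := ih
      refine ⟨n + 1, fun i => if i ≤ n then p i else c, by simpa using h0, by simp, ?_⟩
      intro i hi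
      rcases (Nat.lt_succ_iff.1 hi).lt_or_eq with h | rfl
      · simpa [h.le, Nat.succ_le_of_lt h] using hp i h
      · simpa [hn] using hbc
  obtain ⟨p, h0, hn, hp⟩ := Nat.find_spec hex
  refine ⟨Nat.find hex, ?_, p, h0, hn, hp⟩
  set n := Nat.find hex with hn_def
  -- A path of minimal length repeats no state: the segment between two occurrences could be cut
  -- out.
  have hinj : ∀ i j, i < j → j ≤ n → p i ≠ p j := by
    intro i j hij hj heq
    refine Nat.find_min hex (m := n - (j - i)) (by omega)
      ⟨fun k => if k ≤ i then p k else p (k + (j - i)), by simpa using h0, ?_, ?_⟩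
    · beta_reduce
      by_cases hjn : j = n
      · rw [if_pos (by omega), show n - (j - i) = i by omega, heq, hjn, hn]
      · rw [if_neg (by omega), show n - (j - i) + (j - i) = n by omega, hn]
    · intro k hk
      rcases lt_trichotomy k i with h | rfl | h
      · simpa [h.le, Nat.succ_le_of_lt h] using hp k (by omega)
      · simp only [le_refl, if_true, show ¬ (k + 1 ≤ k) by omega, if_false, heq]
        rw [show k + 1 + (j - k) = j + 1 by omega]
        exact hp j (by omega)
      · beta_reduce
        rw [if_neg (by omega), if_neg (by omega), show k + 1 + (j - i) = k + (j - i) + 1 by omega]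
        exact hp _ (by omega)
  have : Function.Injective fun i : Fin (n + 1) => p i := by
    intro i j hij
    by_contra hne
    rcases lt_or_gt_of_ne hne with h | h
    · exact hinj i j h (by omega) hij
    · exact hinj j i h (by omega) hij.symm
  simpa using Nat.card_le_card_of_injective _ this

namespace LogSpace

/-! ### Register systems

Nondeterministic systems with a finite control and finitely many registers, which change by affine
operations. One register holds a position of the input tape. -/

/-- The operation `(false, m, a)` demands `y = m * x + a` of the old value `x` and the new value `y`,
and `(true, m, a)` demands `x = m * y + a`. -/
abbrev RegOp (N : ℕ) : Type := Bool × Fin (N + 2) × Fin (N + 2)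

def RegOp.Rel {N : ℕ} : RegOp N → ℕ → ℕ → Prop
  | (false, m, a), x, y => y = m * x + a
  | (true, m, a), x, y => x = m * y + a

def RegOp.keep (N : ℕ) : RegOp N := (false, 1, 0)

theorem RegOp.keep_rel {N : ℕ} {x y : ℕ} : (RegOp.keep N).Rel x y ↔ y = x := by
  simp [keep, Rel]

structure RegisterSystem (Γ : Type) where
  Ctl : Type
  Reg : Type
  finCtl : Finite Ctl
  finReg : Finite Reg
  base : ℕ
  base_pos : 0 < base
  bound : ℕ
  head : Reg
  start : Ctl
  accept : Set Ctl
  rule : InputCell Γ → Ctl → Ctl → Option (Reg → RegOp bound)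
  idle : ∀ x f, ∃ g, rule x f g = some fun _ => RegOp.keep bound

namespace RegisterSystem

variable {Γ : Type} (S : RegisterSystem Γ)

instance : Finite S.Ctl := S.finCtl
instance : Finite S.Reg := S.finReg
instance : NeZero S.base := ⟨S.base_pos.ne'⟩
instance : Nonempty S.Ctl := ⟨S.start⟩

def Step (w : List Γ) (c d : S.Ctl × (S.Reg → ℕ)) : Prop :=
  ∃ ops, S.rule (inputCell w (c.2 S.head)) c.1 d.1 = some ops ∧ ∀ j, (ops j).Rel (c.2 j) (d.2 j)

def Fits (W : ℕ) (c : S.Ctl × (S.Reg → ℕ)) : Prop := ∀ j, c.2 j < S.base ^ W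

/-- Acceptance with registers of `W` digits. -/
def Accepts (w : List Γ) (W : ℕ) : Prop :=
  ∃ c, Relation.ReflTransGen (fun c d => S.Step w c d ∧ S.Fits W d) (S.start, fun _ => 0) c ∧
    c.1 ∈ S.accept

/-! #### The nodes: numbers that encode configurations with a time -/

/-- A bound, to the power `W`, for the number of configurations. -/
noncomputable def span : ℕ := Nat.card (S.Ctl × (S.Reg → Fin S.base))

theorem span_pos : 0 < S.span := Nat.card_pos

/-- The number systems for the time and for the registers. -/
noncomputable def radix : Option S.Reg → ℕ
  | none => S.span
  | some _ => S.base

theorem radix_pos : ∀ j, 0 < S.radix j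
  | none => S.span_pos
  | some _ => S.base_pos

instance (j : Option S.Reg) : NeZero (S.radix j) := ⟨(S.radix_pos j).ne'⟩

abbrev Column : Type := S.Ctl × ((j : Option S.Reg) → Fin (S.radix j))

noncomputable def columns : ℕ := Nat.card S.Column

theorem columns_pos : 0 < S.columns := Nat.card_pos

instance : NeZero S.columns := ⟨S.columns_pos.ne'⟩

/-- With the start column numbered 0, the node 0 is the start configuration at time 0 for every
number of digits. -/
theorem exists_columnEquiv : ∃ e : Fin S.columns ≃ S.Column, e 0 = (S.start, fun _ => 0) := by
  let e : Fin S.columns ≃ S.Column := (Finite.equivFin S.Column).symm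
  exact ⟨(Equiv.swap 0 (e.symm (S.start, fun _ => 0))).trans e, by simp⟩

noncomputable def columnEquiv : Fin S.columns ≃ S.Column := S.exists_columnEquiv.choose

theorem columnEquiv_zero : S.columnEquiv 0 = (S.start, fun _ => 0) := S.exists_columnEquiv.choose_spec

noncomputable def column (i : ℕ) : S.Column := S.columnEquiv (Fin.ofNat S.columns i)

/-- Every column has a control component, but only that of the lowest one counts. A configuration
may thus be represented by several nodes, which does no harm to reachability. -/
noncomputable def ctl (i : ℕ) : S.Ctl := (S.column i).1

/-- The time (for `none`) and the values of the registers. -/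
noncomputable def value : ℕ → ℕ → Option S.Reg → ℕ
  | 0, _, _ => 0
  | W + 1, i, j => (S.column i).2 j + S.radix j * value W (i / S.columns) j

theorem value_lt (W i : ℕ) (j : Option S.Reg) : S.value W i j < S.radix j ^ W := by
  induction W generalizing i with
  | zero => simp [value]
  | succ W ih =>
    have h1 := ih (i / S.columns)
    have h2 := ((S.column i).2 j).2
    have h3 := Nat.mul_le_mul_left (S.radix j) (Nat.succ_le_of_lt h1)
    rw [Nat.succ_eq_add_one, mul_add, mul_one] at h3
    rw [value, pow_succ, mul_comm (S.radix j ^ W)]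
    omega

theorem column_zero : S.column 0 = (S.start, fun _ => 0) := by
  rw [column, ← S.columnEquiv_zero]
  rfl

theorem value_zero (W : ℕ) (j : Option S.Reg) : S.value W 0 j = 0 := by
  induction W with
  | zero => rfl
  | succ W ih => simp [value, ih, S.column_zero]

theorem exists_node (W : ℕ) (f : S.Ctl) (v : Option S.Reg → ℕ) (hv : ∀ j, v j < S.radix j ^ W) :
    ∃ i < S.columns ^ W, (∀ j, S.value W i j = v j) ∧ (W ≠ 0 → S.ctl i = f) := by
  induction W generalizing f v with
  | zero => exact ⟨0, by simp, fun j => by have := hv j; simp at this; simp [value, this], by simp⟩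
  | succ W ih =>
    obtain ⟨i, hi, hval, -⟩ := ih f (fun j => v j / S.radix j) fun j =>
      Nat.div_lt_of_lt_mul (by rw [mul_comm, ← pow_succ]; exact hv j)
    let c := S.columnEquiv.symm (f, fun j => Fin.ofNat _ (v j))
    have hdiv : (c + S.columns * i) / S.columns = i := by
      rw [Nat.add_mul_div_left _ _ S.columns_pos, Nat.div_eq_of_lt c.2, zero_add]
    have hcol : S.column (c + S.columns * i) = (f, fun j => Fin.ofNat _ (v j)) := by
      have : Fin.ofNat S.columns (c + S.columns * i) = c := by
        ext
        simp [Fin.ofNat, Nat.mod_eq_of_lt c.2]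
      rw [column, this]
      simp [c]
    refine ⟨c + S.columns * i, ?_, fun j => ?_, fun _ => ?_⟩
    · have := Nat.mul_le_mul_left S.columns (Nat.succ_le_of_lt hi)
      rw [Nat.succ_eq_add_one, mul_add, mul_one] at this
      rw [pow_succ, mul_comm (S.columns ^ W)]
      have := c.2
      omega
    · rw [value, hdiv, hval, hcol]
      exact Nat.mod_add_div _ _
    · rw [ctl, hcol]

noncomputable def code (W i : ℕ) : S.Ctl × (S.Reg → ℕ) := (S.ctl i, fun j => S.value W i (some j))

/-- The transitions between nodes: a step of the system, and self-loops at the last point of time. -/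
def NodeStep (w : List Γ) (W i j : ℕ) : Prop :=
  S.value W i none + 1 = S.value W j none ∧ S.Step w (S.code W i) (S.code W j) ∨
    S.value W i none + 1 = S.span ^ W ∧ i = j

/-- The idle rule lets time pass without changing the registers; at the last moment the self-loop
takes over. -/
theorem exists_nodeStep (w : List Γ) {W : ℕ} (hW : W ≠ 0) (i : ℕ) (hi : i < S.columns ^ W) :
    ∃ j < S.columns ^ W, S.NodeStep w W i j := by
  by_cases ht : S.value W i none + 1 = S.span ^ W
  · exact ⟨i, hi, .inr ⟨ht, rfl⟩⟩
  · obtain ⟨g, hg⟩ := S.idle (inputCell w ((S.code W i).2 S.head)) (S.code W i).1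
    obtain ⟨j, hj, h1, h2⟩ := S.exists_node W g
      (fun j => if j = none then S.value W i none + 1 else S.value W i j) (by
        intro j
        split
        · rename_i h
          subst h
          have h3 : S.value W i none < S.span ^ W := S.value_lt W i none
          change _ < S.span ^ W
          omega
        · exact S.value_lt W i j)
    refine ⟨j, hj, .inl ⟨by simp [h1], _, by rw [← h2 hW] at hg; exact hg, fun r => ?_⟩⟩
    rw [RegOp.keep_rel]
    simp [code, h1]

noncomputable def toKripke (w : List Γ) (W : ℕ) (hW : W ≠ 0) :
    Kripke Unit (Fin (S.columns ^ W)) where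
  initial := ⟨0, pow_pos S.columns_pos W⟩
  trans := fun i j => S.NodeStep w W i j
  label := fun i => {_u | S.ctl i ∈ S.accept}
  total := fun i => by
    obtain ⟨j, hj, h⟩ := S.exists_nodeStep w hW i i.2
    exact ⟨⟨j, hj⟩, h⟩

/-! ### Acyclicity and paths of the time-stamped graph -/

variable {S} {w : List Γ} {W : ℕ} {hW : W ≠ 0}

theorem NodeStep.value_le {i j : ℕ} (h : S.NodeStep w W i j) :
    S.value W i none ≤ S.value W j none := by
  rcases h with ⟨h, -⟩ | ⟨-, rfl⟩
  · omega
  · rfl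

/-- Time never decreases along a transition, so it is constant on a loop, and every transition of
the loop is a self-loop at the last moment. There no proper step is possible either, since it would
need a time that does not fit. -/
theorem toKripke_acyclic : (S.toKripke w W hW).Acyclic := by
  rintro n s ⟨hs, hn⟩ i hi s' hs'
  have mono : ∀ a b, a ≤ b → b ≤ n → S.value W (s a) none ≤ S.value W (s b) none := by
    intro a b hab
    induction b, hab using Nat.le_induction with
    | base => exact fun _ => le_rfl
    | succ b hab ih => exact fun hb => (ih (by omega)).trans (NodeStep.value_le (hs b hb))
  have hlast : S.value W (s i) none + 1 = S.span ^ W := by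
    have hn' : S.NodeStep w W (s n) (s 0) := hn
    rcases hi.lt_or_eq with hi | rfl
    · rcases hs i hi with ⟨h, -⟩ | ⟨h, -⟩
      · have h1 := mono (i + 1) n hi le_rfl
        have h2 := hn'.value_le
        have h3 := mono 0 i (by omega) hi.le
        omega
      · exact h
    · rcases hn' with ⟨h, -⟩ | ⟨h, -⟩
      · have := mono 0 i (by omega) le_rfl
        omega
      · exact h
  rcases hs' with ⟨h, -⟩ | ⟨-, h⟩
  · have : S.value W s' none < S.span ^ W := S.value_lt W s' none
    omega
  · exact (Fin.ext h).symm

/-- The registers contribute the same factor to both sides; for the control states, `W ≠ 0` gives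
|Ctl| ≤ |Ctl| ^ W. -/
theorem card_le_span_pow (hW : W ≠ 0) :
    Nat.card (S.Ctl × (S.Reg → Fin (S.base ^ W))) ≤ S.span ^ W := by
  have := Fintype.ofFinite S.Reg
  simp only [span, Nat.card_prod, Nat.card_fun, Nat.card_fin, mul_pow]
  rw [← pow_mul, ← pow_mul, mul_comm W]
  exact Nat.mul_le_mul_right _ (Nat.le_self_pow hW _)

theorem exists_path_of_reach {AP T : Type} (K : Kripke AP T) {x : T}
    (h : Relation.ReflTransGen K.trans K.initial x) : ∃ p, K.IsPath p ∧ ∃ i, p i = x := by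
  choose nxt hnxt using K.total
  suffices ∀ y, Relation.ReflTransGen K.trans y x →
      ∃ p : ℕ → T, p 0 = y ∧ (∀ i, K.trans (p i) (p (i + 1))) ∧ ∃ i, p i = x by
    obtain ⟨p, h0, hp, hx⟩ := this _ h
    exact ⟨p, ⟨h0, hp⟩, hx⟩
  intro y hy
  induction hy using Relation.ReflTransGen.head_induction_on with
  | refl =>
    exact ⟨fun i => nxt^[i] x, rfl, fun i => by
      simpa only [Function.iterate_succ_apply'] using hnxt _, 0, rfl⟩
  | @head y z hyz _ ih =>
    obtain ⟨p, h0, hp, i, hi⟩ := ih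
    refine ⟨fun i => Nat.casesOn i y p, rfl, ?_, i + 1, hi⟩
    rintro (_ | i)
    · change K.trans y (p 0)
      rw [h0]
      exact hyz
    · exact hp i

theorem code_zero : S.code W 0 = (S.start, fun _ => 0) := by
  simp [code, ctl, S.column_zero, S.value_zero]

theorem fits_code (i : ℕ) : S.Fits W (S.code W i) := fun j => S.value_lt W i (some j)

/-- Forgetting the time turns a path into a run. Conversely, an accepting run can be shortened until
its length is below the number of configurations, so that all its times fit; totality then extends
it to an infinite path. -/
theorem toKripke_path_iff :
    (∃ p, (S.toKripke w W hW).IsPath p ∧ ∃ i, () ∈ (S.toKripke w W hW).label (p i)) ↔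
      S.Accepts w W := by
  constructor
  · rintro ⟨p, ⟨h0, hp⟩, i, hi⟩
    refine ⟨S.code W (p i), ?_, hi⟩
    clear hi
    induction i with
    | zero =>
      rw [h0]
      change Relation.ReflTransGen _ _ (S.code W 0)
      rw [code_zero]
    | succ i ih =>
      rcases hp i with ⟨-, h⟩ | ⟨-, h⟩
      · exact ih.tail ⟨h, fits_code _⟩
      · rwa [← h]
  · rintro ⟨c, hc, hacc⟩
    -- The bound on the registers is moved into the type, which makes the set of configurations
    -- finite.
    let R : S.Ctl × (S.Reg → Fin (S.base ^ W)) → S.Ctl × (S.Reg → Fin (S.base ^ W)) → Prop :=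
      fun c d => S.Step w (c.1, fun j => c.2 j) (d.1, fun j => d.2 j)
    have hpos : 0 < S.base ^ W := pow_pos S.base_pos W
    have hR : ∃ d : S.Ctl × (S.Reg → Fin (S.base ^ W)), (d.1, fun j => (d.2 j : ℕ)) = c ∧
        Relation.ReflTransGen R (S.start, fun _ => ⟨0, hpos⟩) d := by
      clear hacc
      induction hc with
      | refl => exact ⟨_, rfl, .refl⟩
      | @tail c c' _ h ih =>
        obtain ⟨d, rfl, hd⟩ := ih
        exact ⟨(c'.1, fun j => ⟨c'.2 j, h.2 j⟩), rfl, hd.tail h.1⟩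
    obtain ⟨d, rfl, hd⟩ := hR
    obtain ⟨n, hn, q, h0, hqn, hq⟩ := hd.exists_short_path
    have hn : n < S.span ^ W := hn.trans_le (card_le_span_pow hW)
    have key : ∀ i ≤ n, ∃ x, Relation.ReflTransGen (S.toKripke w W hW).trans
        (S.toKripke w W hW).initial x ∧ S.value W x none = i ∧
          S.code W x = ((q i).1, fun j => ((q i).2 j : ℕ)) := by
      intro i
      induction i with
      | zero =>
        refine fun _ => ⟨_, .refl, S.value_zero W none, ?_⟩
        rw [h0]
        exact code_zero
      | succ i ih =>
        intro hi
        obtain ⟨x, hx, ht, hcode⟩ := ih (by omega)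
        obtain ⟨y, hy, h1, h2⟩ := S.exists_node W (q (i + 1)).1
          (fun j => j.elim (i + 1) fun j => (q (i + 1)).2 j) (by
            rintro (_ | j)
            · change i + 1 < S.span ^ W
              omega
            · exact ((q (i + 1)).2 j).2)
        have hcy : S.code W y = ((q (i + 1)).1, fun j => ((q (i + 1)).2 j : ℕ)) := by
          simp [code, h1, h2 hW]
        refine ⟨⟨y, hy⟩, hx.tail (.inl ⟨?_, ?_⟩), h1 none, hcy⟩
        · rw [ht]
          exact (h1 none).symm
        · rw [hcode]
          change S.Step w _ (S.code W y)
          rw [hcy]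
          exact hq i hi
    obtain ⟨x, hx, -, hcode⟩ := key n le_rfl
    obtain ⟨p, hp, i, rfl⟩ := exists_path_of_reach _ hx
    refine ⟨p, hp, i, ?_⟩
    change S.ctl (p i) ∈ S.accept
    have : S.ctl (p i) = (q n).1 := congrArg Prod.fst hcode
    rw [this, hqn]
    exact hacc

end RegisterSystem

/-! ### Affine relations, one digit at a time -/

namespace RegOp

/-- Consumes one digit of each of the two numbers. -/
def step {N : ℕ} (base : ℕ) : RegOp N → ℕ → ℕ → Option (RegOp N)
  | (false, m, a), x, y =>
    if (m * x + a) % base = y then some (false, m, Fin.ofNat _ ((m * x + a) / base)) else none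
  | (true, m, a), x, y =>
    if (m * y + a) % base = x then some (true, m, Fin.ofNat _ ((m * y + a) / base)) else none

/-- The lowest digits determine a residue, and the quotient is the carry that replaces the constant
in the relation between the higher digits. -/
theorem affine_digit_iff {base m a x y X Y : ℕ} (hy : y < base) :
    y + base * Y = m * (x + base * X) + a ↔
      (m * x + a) % base = y ∧ Y = m * X + (m * x + a) / base := by
  have hb : 0 < base := by omega
  have h1 : m * (x + base * X) + a = (m * x + a) + base * (m * X) := by ring
  rw [h1]
  constructor
  · intro h
    constructor
    · have := congrArg (· % base) h
      simpa [Nat.mod_eq_of_lt hy] using this.symm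
    · have := congrArg (· / base) h
      simp only [Nat.add_mul_div_left _ _ hb, Nat.div_eq_of_lt hy] at this
      omega
  · rintro ⟨h2, rfl⟩
    have := Nat.mod_add_div (m * x + a) base
    rw [mul_add, ← h2]
    omega

/-- Carries do not grow: (N + 1)(base - 1) + (N + 1) = (N + 1) base. So finitely many operations
suffice for the whole check, and `Fin.ofNat` in `step` never truncates. -/
theorem carry_lt {N base x : ℕ} (m a : Fin (N + 2)) (hx : x < base) :
    (m * x + a) / base < N + 2 := by
  rw [Nat.div_lt_iff_lt_mul (by omega)]
  have hm : (m : ℕ) ≤ N + 1 := by omega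
  have ha : (a : ℕ) ≤ N + 1 := by omega
  have := Nat.mul_le_mul hm (show x ≤ base - 1 by omega)
  have h2 : (N + 1) * (base - 1) + (N + 1) = (N + 1) * base := by
    rw [← Nat.mul_succ]
    congr 1
    omega
  have h3 : (N + 2) * base = (N + 1) * base + base := by ring
  omega

theorem rel_digit_iff {N base x y X Y : ℕ} (op : RegOp N) (hx : x < base) (hy : y < base) :
    op.Rel (x + base * X) (y + base * Y) ↔ ∃ op', op.step base x y = some op' ∧ op'.Rel X Y := by
  obtain ⟨fl, m, a⟩ := op
  cases fl
  · rw [Rel, affine_digit_iff hy, step]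
    split <;> rename_i h
    · simp [h, Rel, Nat.mod_eq_of_lt (carry_lt m a hx)]
    · simp [h]
  · rw [Rel, affine_digit_iff hx, step]
    split <;> rename_i h
    · simp [h, Rel, Nat.mod_eq_of_lt (carry_lt m a hy)]
    · simp [h]

end RegOp

namespace RegisterSystem

variable {Γ : Type} (S : RegisterSystem Γ)

/-! ### Checking a transition between nodes digit by digit -/

/-- Whether the columns so far agree, whether the time so far is maximal, and the operations that
remain to be checked. -/
abbrev Check : Type := Bool × Bool × (Option S.Reg → Option (RegOp S.bound))

open Classical in
noncomputable def checkInit (x : InputCell Γ) (f g : S.Ctl) : S.Check :=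
  (true, true, fun j => (S.rule x f g).map fun ops => j.elim (false, 1, 1) ops)

open Classical in
noncomputable def checkStep (k : S.Check) (u v : Fin S.columns) : S.Check :=
  (k.1 && decide (u = v), k.2.1 && decide (((S.columnEquiv u).2 none : ℕ) + 1 = S.span),
    fun j => (k.2.2 j).bind fun op =>
      op.step (S.radix j) ((S.columnEquiv u).2 j) ((S.columnEquiv v).2 j))

/-- Beyond the last digit both numbers are 0, so the operations that remain must relate 0 to 0: no
carry is left over. The alternative is the self-loop at the last moment. -/
def Passed (k : S.Check) : Prop :=
  (∀ j, ∃ op, k.2.2 j = some op ∧ op.Rel 0 0) ∨ (k.1 = true ∧ k.2.1 = true)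

/-! ### The transducer -/

inductive PrintCtl : Type
  | start : PrintCtl
  | copy : Bool → Option S.Ctl → PrintCtl
  | rewind : Bool → S.Ctl → PrintCtl
  | seek : Bool → S.Ctl → Bool → PrintCtl
  | check : InputCell Γ → S.Ctl → Option S.Check → PrintCtl
  | incCol : InputCell Γ → S.Ctl → Bool → PrintCtl
  | incRow : Bool → PrintCtl

instance finite_inputCell {Γ : Type} [Finite Γ] : Finite (InputCell Γ) := by
  let f : InputCell Γ → Option (Option Γ)
    | .leftEnd => none
    | .rightEnd => some none
    | .letter a => some (some a)
  refine Finite.of_injective f fun a b h => ?_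
  cases a <;> cases b <;> simp_all [f]

instance [Finite Γ] : Finite S.PrintCtl := by
  let f : S.PrintCtl → Unit ⊕ (Bool × Option S.Ctl) ⊕ (Bool × S.Ctl) ⊕ (Bool × S.Ctl × Bool) ⊕
      (InputCell Γ × S.Ctl × Option S.Check) ⊕ (InputCell Γ × S.Ctl × Bool) ⊕ Bool
    | .start => .inl ()
    | .copy a b => .inr (.inl (a, b))
    | .rewind a b => .inr (.inr (.inl (a, b)))
    | .seek a b c => .inr (.inr (.inr (.inl (a, b, c))))
    | .check a b c => .inr (.inr (.inr (.inr (.inl (a, b, c)))))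
    | .incCol a b c => .inr (.inr (.inr (.inr (.inr (.inl (a, b, c))))))
    | .incRow a => .inr (.inr (.inr (.inr (.inr (.inr a)))))
  refine Finite.of_injective f fun a b h => ?_
  cases a <;> cases b <;> simp_all [f]

abbrev Output : Type := (Bool × Set Unit) ⊕ Bool

/-- The digits of two nodes, a row and a column of the adjacency matrix, and of a counter. -/
abbrev PrintCell : Type := Fin S.columns × Fin S.columns × Fin S.base

-- Before row i is printed, its head register is copied into the counter and counted down while the
-- input head moves right. The finite control then knows the input cell scanned in configuration i,
-- and the entries of the row need no further access to the input. The Boolean kept from `copy` to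
-- `seek` marks row 0, the initial state.
open Classical in
noncomputable def printMove : S.PrintCtl → InputCell Γ →
    Option (S.PrintCtl × HeadMove × Option Output)
  | .start, _ => some (.copy true none, .stay, none)
  | .copy _ none, _ => none
  | .copy b (some f), _ => some (.rewind b f, .stay, none)
  | .rewind b f, .leftEnd => some (.seek b f true, .stay, none)
  | .rewind b f, _ => some (.rewind b f, .left, none)
  | .seek b f false, _ => some (.seek b f true, .right, none)
  | .seek b f true, x =>
    some (.check x f none, .stay, some (.inl (b, {_u | f ∈ S.accept})))
  | .check _ _ none, _ => none
  | .check x f (some k), _ => some (.incCol x f true, .stay, some (.inr (decide (S.Passed k))))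
  | .incCol x f false, _ => some (.check x f none, .stay, none)
  | .incCol _ _ true, _ => some (.incRow true, .stay, none)
  | .incRow false, _ => some (.copy false none, .stay, none)
  | .incRow true, _ => none

-- The Boolean is a borrow in `seek` and a carry in `incCol` and `incRow`. A check starts as `none`,
-- because the control state of the column node becomes known only at the first cell.
open Classical in
noncomputable def printSweep : S.PrintCtl → S.PrintCell → S.PrintCtl × S.PrintCell
  | .start, a => (.start, a)
  | .copy b f, a => (.copy b (f.or (some (S.columnEquiv a.1).1)),
      (a.1, a.2.1, Fin.ofNat _ ((S.columnEquiv a.1).2 (some S.head))))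
  | .rewind b f, a => (.rewind b f, a)
  | .seek b f c, a => (.seek b f (c && decide (a.2.2 = 0)), (a.1, a.2.1, if c then a.2.2 - 1 else a.2.2))
  | .check x f k, a =>
    (.check x f (some (S.checkStep (k.getD (S.checkInit x f (S.columnEquiv a.2.1).1)) a.1 a.2.1)), a)
  | .incCol x f c, a =>
    (.incCol x f (c && decide (a.2.1 + 1 = 0)), (a.1, if c then a.2.1 + 1 else a.2.1, a.2.2))
  | .incRow c, a => (.incRow (c && decide (a.1 + 1 = 0)), (if c then a.1 + 1 else a.1, a.2))

noncomputable def printer [Finite Γ] : RulerMachine Γ Output where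
  State := S.PrintCtl
  Cell := S.PrintCell
  finState := inferInstance
  finCell := inferInstance
  start := .start
  blank := (0, 0, 0)
  delta := fun s x => {y | S.printMove s x = some y}
  sweep := S.printSweep
  sweep_start := fun _ => rfl

/-! ### The sweeps as arithmetic on digits -/

noncomputable def cells : ℕ → ℕ → ℕ → ℕ → List S.PrintCell
  | 0, _, _, _ => []
  | W + 1, i, j, h => (Fin.ofNat _ i, Fin.ofNat _ j, Fin.ofNat _ h) ::
      cells W (i / S.columns) (j / S.columns) (h / S.base)

theorem cells_zero (W : ℕ) : S.cells W 0 0 0 = List.replicate W (0, 0, 0) := by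
  induction W with
  | zero => rfl
  | succ W ih =>
    rw [cells, List.replicate_succ, Nat.zero_div, Nat.zero_div, ih]
    rfl

/-- The overflow at the end of a row resets the column index to 0, ready for the next row. -/
theorem cells_pow (W i h : ℕ) : S.cells W i (S.columns ^ W) h = S.cells W i 0 h := by
  induction W generalizing i h with
  | zero => rfl
  | succ W ih =>
    have h1 : Fin.ofNat S.columns (S.columns ^ (W + 1)) = Fin.ofNat S.columns 0 := by
      ext
      simp [pow_succ]
    rw [cells, cells, h1, pow_succ, Nat.mul_div_cancel _ S.columns_pos, ih, Nat.zero_div]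

theorem ofNat_succ_eq_zero_iff (n j : ℕ) [NeZero n] : Fin.ofNat n j + 1 = 0 ↔ n ∣ j + 1 := by
  rw [Fin.ext_iff, Fin.val_add]
  simp [Nat.dvd_iff_mod_eq_zero]

theorem ofNat_add_one (n j : ℕ) [NeZero n] : Fin.ofNat n j + 1 = Fin.ofNat n (j + 1) := by
  rw [Fin.ext_iff, Fin.val_add]
  simp

/-- The carry of an increment leaves the register exactly when it leaves the lowest digit and then
the rest; divisibility expresses this without a bound on j. -/
theorem pow_succ_dvd_succ_iff {n j W : ℕ} (hn : 0 < n) :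
    n ^ (W + 1) ∣ j + 1 ↔ n ∣ j + 1 ∧ n ^ W ∣ j / n + 1 := by
  have key : n ∣ j + 1 → j + 1 = n * (j / n + 1) := by
    intro h
    have h1 := Nat.succ_div_of_dvd h
    rw [← h1, Nat.mul_div_cancel' h]
  constructor
  · intro h
    have h1 : n ∣ j + 1 := (dvd_pow_self n (by omega)).trans h
    refine ⟨h1, ?_⟩
    rw [key h1, pow_succ, mul_comm n] at h
    exact Nat.dvd_of_mul_dvd_mul_right hn h
  · rintro ⟨h1, h2⟩
    rw [key h1, pow_succ, mul_comm n]
    exact Nat.mul_dvd_mul_right h2 n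

variable {S}

theorem sweepList_rewind (b : Bool) (f : S.Ctl) (l : List S.PrintCell) :
    sweepList S.printSweep (.rewind b f) l = (.rewind b f, l) := by
  induction l with
  | nil => rfl
  | cons a l ih => simp [sweepList, printSweep, ih]

theorem sweepList_incCol_false (x : InputCell Γ) (f : S.Ctl) (l : List S.PrintCell) :
    sweepList S.printSweep (.incCol x f false) l = (.incCol x f false, l) := by
  induction l with
  | nil => rfl
  | cons a l ih => simp [sweepList, printSweep, ih]

open Classical in
theorem sweepList_incCol (x : InputCell Γ) (f : S.Ctl) (W i j h : ℕ) :
    sweepList S.printSweep (.incCol x f true) (S.cells W i j h) =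
      (.incCol x f (decide (S.columns ^ W ∣ j + 1)), S.cells W i (j + 1) h) := by
  induction W generalizing i j h with
  | zero => simp [cells, sweepList]
  | succ W ih =>
    simp only [cells, sweepList, printSweep, Bool.true_and, if_true,
      ofNat_add_one, pow_succ_dvd_succ_iff S.columns_pos]
    by_cases hd : S.columns ∣ j + 1
    · simp [hd, ih, Nat.succ_div_of_dvd]
    · simp [hd, sweepList_incCol_false, Nat.succ_div_of_not_dvd]

theorem sweepList_incRow_false (l : List S.PrintCell) :
    sweepList S.printSweep (.incRow false) l = (.incRow false, l) := by
  induction l with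
  | nil => rfl
  | cons a l ih => simp [sweepList, printSweep, ih]

open Classical in
theorem sweepList_incRow (W i j h : ℕ) :
    sweepList S.printSweep (.incRow true) (S.cells W i j h) =
      (.incRow (decide (S.columns ^ W ∣ i + 1)), S.cells W (i + 1) j h) := by
  induction W generalizing i j h with
  | zero => simp [cells, sweepList]
  | succ W ih =>
    simp only [cells, sweepList, printSweep, Bool.true_and, if_true,
      ofNat_add_one, pow_succ_dvd_succ_iff S.columns_pos]
    by_cases hd : S.columns ∣ i + 1
    · simp [hd, ih, Nat.succ_div_of_dvd]
    · simp [hd, sweepList_incRow_false, Nat.succ_div_of_not_dvd]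

theorem sweepList_seek_false (b : Bool) (f : S.Ctl) (l : List S.PrintCell) :
    sweepList S.printSweep (.seek b f false) l = (.seek b f false, l) := by
  induction l with
  | nil => rfl
  | cons a l ih => simp [sweepList, printSweep, ih]

theorem sweepList_seek_zero (b : Bool) (f : S.Ctl) (W i j : ℕ) :
    ∃ h, sweepList S.printSweep (.seek b f true) (S.cells W i j 0) =
      (.seek b f true, S.cells W i j h) := by
  induction W generalizing i j with
  | zero => exact ⟨0, rfl⟩
  | succ W ih =>
    obtain ⟨h, hh⟩ := ih (i / S.columns) (j / S.columns)
    -- An underflow turns the lowest digit into base - 1, and the borrow goes on to the higher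
    -- digits.
    refine ⟨(S.base - 1) + S.base * h, ?_⟩
    have h1 : (S.base - 1 + S.base * h) / S.base = h := by
      rw [Nat.add_mul_div_left _ _ S.base_pos, Nat.div_eq_of_lt (by have := S.base_pos; omega),
        zero_add]
    have h2 : Fin.ofNat S.base 0 - 1 = Fin.ofNat S.base (S.base - 1 + S.base * h) := by
      rw [sub_eq_iff_eq_add, ofNat_add_one]
      ext
      rw [show S.base - 1 + S.base * h + 1 = S.base * (h + 1) by
        have := S.base_pos
        rw [mul_add]
        omega]
      simp
    simp only [cells, sweepList, printSweep, Bool.true_and, if_true, Nat.zero_div, h1, ← h2]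
    have h3 : decide (Fin.ofNat S.base 0 = 0) = true := by simp
    rw [h3, hh]

theorem sweepList_seek_succ (b : Bool) (f : S.Ctl) (W i j h : ℕ) (hh : h + 1 < S.base ^ W) :
    sweepList S.printSweep (.seek b f true) (S.cells W i j (h + 1)) =
      (.seek b f false, S.cells W i j h) := by
  induction W generalizing i j h with
  | zero => simp at hh
  | succ W ih =>
    have h1 : Fin.ofNat S.base (h + 1) - 1 = Fin.ofNat S.base h := by
      rw [sub_eq_iff_eq_add, ofNat_add_one]
    have h2 : Fin.ofNat S.base (h + 1) = 0 ↔ S.base ∣ h + 1 := by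
      rw [← ofNat_add_one, ofNat_succ_eq_zero_iff]
    simp only [cells, sweepList, printSweep, Bool.true_and, if_true, h1, h2]
    by_cases hd : S.base ∣ h + 1
    · have h3 := Nat.succ_div_of_dvd hd
      have h4 : h / S.base + 1 < S.base ^ W := by
        rw [← h3]
        exact Nat.div_lt_of_lt_mul (by rwa [mul_comm, ← pow_succ])
      simp [hd, h3, ih _ _ _ h4]
    · simp [hd, sweepList_seek_false, Nat.succ_div_of_not_dvd]

theorem sweepList_copy_some (b : Bool) (f : S.Ctl) (W i j h : ℕ) :
    sweepList S.printSweep (.copy b (some f)) (S.cells W i j h) =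
      (.copy b (some f), S.cells W i j (S.value W i (some S.head))) := by
  induction W generalizing i j h with
  | zero => rfl
  | succ W ih =>
    have h1 : S.radix (some S.head) = S.base := rfl
    have h2 := ((S.column i).2 (some S.head)).2
    simp only [cells, sweepList, printSweep, Option.some_or, ih, value]
    change _ = (_, (_, _, Fin.ofNat S.base _) :: _)
    have h3 : ((S.columnEquiv (Fin.ofNat _ i)).2 (some S.head) : ℕ) =
      (S.column i).2 (some S.head) := rfl
    rw [h3]
    generalize ((S.column i).2 (some S.head) : ℕ) = d at h2 ⊢
    rw [h1] at h2 ⊢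
    rw [Nat.add_mul_div_left _ _ S.base_pos, Nat.div_eq_of_lt h2, zero_add]
    congr 4
    ext
    simp

theorem sweepList_copy (b : Bool) (W i j h : ℕ) (hW : W ≠ 0) :
    sweepList S.printSweep (.copy b none) (S.cells W i j h) =
      (.copy b (some (S.ctl i)), S.cells W i j (S.value W i (some S.head))) := by
  cases W with
  | zero => exact (hW rfl).elim
  | succ W => exact sweepList_copy_some b (S.ctl i) (W + 1) i j h

-- Consuming the lowest digits reduces each of the three tests, equality of the nodes, maximality of
-- the time and the affine relations, to the same test on the quotients.
open Classical in
theorem sweepList_check_some (x : InputCell Γ) (f : S.Ctl) (k : S.Check) (W i j h : ℕ) :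
    ∃ k' : S.Check, sweepList S.printSweep (.check x f (some k)) (S.cells W i j h) =
        (.check x f (some k'), S.cells W i j h) ∧
      (k'.1 = true ↔ k.1 = true ∧ i % S.columns ^ W = j % S.columns ^ W) ∧
      (k'.2.1 = true ↔ k.2.1 = true ∧ S.value W i none + 1 = S.span ^ W) ∧
      ∀ r, (∃ op, k'.2.2 r = some op ∧ op.Rel 0 0) ↔
        ∃ op, k.2.2 r = some op ∧ op.Rel (S.value W i r) (S.value W j r) := by
  induction W generalizing k i j h with
  | zero => exact ⟨k, rfl, by simp [Nat.mod_one], by simp [value], fun r => by simp [value]⟩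
  | succ W ih =>
    obtain ⟨k', h1, h2, h3, h4⟩ := ih (S.checkStep k (Fin.ofNat _ i) (Fin.ofNat _ j))
      (i / S.columns) (j / S.columns) (h / S.base)
    refine ⟨k', ?_, ?_, ?_, fun r => ?_⟩
    · simp only [cells, sweepList, printSweep, Option.getD_some, h1]
    · rw [h2, pow_succ, mul_comm, Nat.mod_mul, Nat.mod_mul]
      simp only [checkStep, Bool.and_eq_true, decide_eq_true_eq, and_assoc, Fin.ext_iff,
        Fin.val_ofNat]
      refine and_congr_right fun _ => ⟨fun ⟨h5, h6⟩ => by rw [h5, h6], fun h5 => ?_⟩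
      have h6 := Nat.mod_lt i S.columns_pos
      have h7 := Nat.mod_lt j S.columns_pos
      have h8 := congrArg (· % S.columns) h5
      have h9 := congrArg (· / S.columns) h5
      simp only [Nat.add_mul_mod_self_left, Nat.mod_mod] at h8
      simp only [Nat.add_mul_div_left _ _ S.columns_pos, Nat.div_eq_of_lt h6,
        Nat.div_eq_of_lt h7, zero_add] at h9
      exact ⟨h8, h9⟩
    · rw [h3]
      simp only [checkStep, Bool.and_eq_true, decide_eq_true_eq, and_assoc, value]
      refine and_congr_right fun _ => ?_
      have h5 : S.radix none = S.span := rfl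
      have h6 := ((S.column i).2 none).2
      change ((S.column i).2 none : ℕ) + 1 = S.span ∧ _ ↔ _
      generalize ((S.column i).2 none : ℕ) = d at h6 ⊢
      rw [h5] at h6 ⊢
      rw [pow_succ, mul_comm _ S.span]
      constructor
      · rintro ⟨h7, h8⟩
        rw [← h8, mul_add]
        omega
      · intro h7
        have h8 := congrArg (· % S.span) h7
        rw [add_right_comm] at h8
        simp only [Nat.add_mul_mod_self_left, Nat.mul_mod_right] at h8
        have h9 : d + 1 = S.span :=
          Nat.le_antisymm h6 (Nat.le_of_dvd (by omega) (Nat.dvd_of_mod_eq_zero h8))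
        refine ⟨h9, Nat.eq_of_mul_eq_mul_left S.span_pos ?_⟩
        rw [mul_add]
        omega
    · rw [h4]
      simp only [checkStep, value, Option.bind_eq_some_iff]
      constructor
      · rintro ⟨op', ⟨op, hop, hs⟩, hr⟩
        exact ⟨op, hop, (op.rel_digit_iff (Fin.is_lt _) (Fin.is_lt _)).2 ⟨op', hs, hr⟩⟩
      · rintro ⟨op, hop, hr⟩
        obtain ⟨op', hs, hr⟩ := (op.rel_digit_iff (Fin.is_lt _) (Fin.is_lt _)).1 hr
        exact ⟨op', ⟨op, hop, hs⟩, hr⟩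

open Classical in
theorem sweepList_check (w : List Γ) {W i j h : ℕ} (hW : W ≠ 0) (hi : i < S.columns ^ W)
    (hj : j < S.columns ^ W) {x : InputCell Γ} (hx : x = inputCell w (S.value W i (some S.head))) :
    ∃ k : S.Check, sweepList S.printSweep (.check x (S.ctl i) none) (S.cells W i j h) =
        (.check x (S.ctl i) (some k), S.cells W i j h) ∧ (S.Passed k ↔ S.NodeStep w W i j) := by
  obtain ⟨k, h1, h2, h3, h4⟩ :=
    sweepList_check_some x (S.ctl i) (S.checkInit x (S.ctl i) (S.ctl j)) W i j h
  refine ⟨k, ?_, ?_⟩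
  · rw [← h1]
    -- The first cell exists because `W ≠ 0`, and it supplies the control state of j that
    -- `checkInit` needs.
    cases W with
    | zero => exact (hW rfl).elim
    | succ W => rfl
  · rw [Nat.mod_eq_of_lt hi, Nat.mod_eq_of_lt hj] at h2
    simp only [Passed, h2, h3, h4, NodeStep]
    refine or_congr ?_ (by simp [checkInit, and_comm])
    simp only [checkInit, Step, code, Option.map_eq_some_iff, ← hx]
    constructor
    · intro h5
      obtain ⟨_, ⟨ops, hops, rfl⟩, ht⟩ := h5 none
      refine ⟨by simpa [RegOp.Rel, eq_comm] using ht, ops, hops, fun r => ?_⟩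
      obtain ⟨_, ⟨ops', hops', rfl⟩, hr⟩ := h5 (some r)
      obtain rfl : ops' = ops := by simpa [hops] using hops'.symm
      exact hr
    · rintro ⟨ht, ops, hops, hr⟩ (_ | r)
      · exact ⟨_, ⟨ops, hops, rfl⟩, by simpa [RegOp.Rel, eq_comm] using ht⟩
      · exact ⟨_, ⟨ops, hops, rfl⟩, hr r⟩

end RegisterSystem

namespace RegisterSystem

variable {Γ : Type} (S : RegisterSystem Γ)

/-! ### The computation that prints the encoded structure -/

open Classical in
noncomputable def bitsWord (w : List Γ) (W i j : ℕ) : List Output :=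
  (List.range j).map fun j => .inr (decide (S.NodeStep w W i j))

open Classical in
noncomputable def rowWord (w : List Γ) (W i : ℕ) : List Output :=
  .inl (decide (i = 0), {_u | S.ctl i ∈ S.accept}) :: S.bitsWord w W i (S.columns ^ W)

open Classical in
theorem encode_toKripke (w : List Γ) (W : ℕ) (hW : W ≠ 0) :
    (S.toKripke w W hW).encode = (List.range (S.columns ^ W)).flatMap (S.rowWord w W) := by
  have key : ∀ {n : ℕ} {α : Type} (f : ℕ → α),
      (List.finRange n).map (fun i : Fin n => f i) = (List.range n).map f := by
    intro n α f
    rw [← List.map_coe_finRange_eq_range, List.map_map]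
    rfl
  have key2 : ∀ {n : ℕ} {α : Type} (f : ℕ → List α),
      (List.finRange n).flatMap (fun i : Fin n => f i) = (List.range n).flatMap f := by
    intro n α f
    rw [List.flatMap_def, List.flatMap_def, key]
  rw [← key2]
  rw [Kripke.encode]
  congr 1
  funext i
  have h1 : (i = (S.toKripke w W hW).initial) = ((i : ℕ) = 0) := propext Fin.ext_iff
  rw [rowWord, bitsWord, ← key]
  simp only [h1]
  rfl

/-- The register for the head may exceed the length of the input, whereas the real head stops at the
right end marker; both see the same cell. -/
theorem inputCell_min (w : List Γ) (h : ℕ) :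
    inputCell w (min h (w.length + 1)) = inputCell w h := by
  rcases le_total h (w.length + 1) with hh | hh
  · rw [min_eq_left hh]
  · rw [min_eq_right hh, (RulerMachine.inputCell_eq_rightEnd_iff w _).2 le_rfl,
      (RulerMachine.inputCell_eq_rightEnd_iff w _).2 hh]

theorem bitsWord_succ (w : List Γ) (W i j : ℕ) [Decidable (S.NodeStep w W i j)] :
    S.bitsWord w W i (j + 1) = S.bitsWord w W i j ++ [.inr (decide (S.NodeStep w W i j))] := by
  simp [bitsWord, List.range_succ]

theorem width_ne_zero (w : List Γ) : RulerMachine.width w ≠ 0 := by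
  rw [RulerMachine.width, Ne, Nat.size_eq_zero]
  omega

variable [Finite Γ]

/-- Some computation reaches the snapshot whose control state and cells result from a sweep. -/
def Swept (w : List Γ) (k : S.PrintCtl) (p : ℕ) (l : List S.PrintCell) (o : List Output) : Prop :=
  S.printer.Reach w (S.printer.initial w)
    ⟨(sweepList S.printSweep k l).1, p, (sweepList S.printSweep k l).2, o⟩

variable {S} {w : List Γ} {W : ℕ}

theorem Swept.move {k k' k1 : S.PrintCtl} {p : ℕ} {l l' : List S.PrintCell} {o : List Output}
    (h : S.Swept w k p l o) (hs : sweepList S.printSweep k l = (k', l')) {mv : HeadMove}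
    {y : Option Output} (hm : S.printMove k' (inputCell w p) = some (k1, mv, y)) :
    S.Swept w k1 (moveInput w.length p mv) l' (o ++ y.toList) := by
  rw [Swept, hs] at h
  exact h.tail ⟨(k1, mv, y), hm, rfl⟩

theorem swept_start :
    S.Swept w (.copy true none) (w.length + 1) (S.cells (RulerMachine.width w) 0 0 0) [] := by
  have h1 : S.printer.Reach w (S.printer.initial w)
      ⟨.start, w.length + 1, S.cells (RulerMachine.width w) 0 0 0, []⟩ := by
    rw [cells_zero]
    exact .refl
  exact h1.tail ⟨(.copy true none, .stay, none), rfl, rfl⟩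

theorem Swept.rewind {b : Bool} {f : S.Ctl} {p : ℕ} {l : List S.PrintCell} {o : List Output}
    (h : S.Swept w (.rewind b f) p l o) : S.Swept w (.seek b f true) 0 l o := by
  induction p with
  | zero => simpa [moveInput] using h.move (sweepList_rewind b f l) rfl
  | succ p ih =>
    have hm : S.printMove (.rewind b f) (inputCell w (p + 1)) =
        some (.rewind b f, .left, none) := by
      rw [inputCell]
      cases w[p]? <;> rfl
    have := h.move (sweepList_rewind b f l) hm
    exact ih (by simpa [moveInput] using this)

theorem Swept.seek {b : Bool} {f : S.Ctl} {i j : ℕ} {o : List Output} (m h : ℕ)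
    (hh : h < S.base ^ W)
    (hr : S.Swept w (.seek b f true) (min m (w.length + 1)) (S.cells W i j h) o) :
    ∃ h' p, S.Swept w (.check (inputCell w (m + h)) f none) p (S.cells W i j h')
      (o ++ [.inl (b, {_u | f ∈ S.accept})]) := by
  induction h generalizing m with
  | zero =>
    obtain ⟨h', hh'⟩ := sweepList_seek_zero b f W i j
    have := hr.move hh' rfl
    rw [inputCell_min] at this
    exact ⟨h', _, this⟩
  | succ h ih =>
    have := hr.move (sweepList_seek_succ b f W i j h hh) rfl
    have h1 : moveInput w.length (min m (w.length + 1)) .right = min (m + 1) (w.length + 1) := by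
      simp only [moveInput]
      omega
    rw [h1] at this
    simpa [add_assoc, add_comm 1 h] using ih (m + 1) (by omega) (by simpa using this)

theorem Swept.checkStep {i j h p : ℕ} {o : List Output} (hW : W ≠ 0) (hi : i < S.columns ^ W)
    (hj : j < S.columns ^ W) {x : InputCell Γ} (hx : x = inputCell w (S.value W i (some S.head)))
    (hr : S.Swept w (.check x (S.ctl i) none) p (S.cells W i j h) (o ++ S.bitsWord w W i j)) :
    S.Swept w (.incCol x (S.ctl i) true) p (S.cells W i j h) (o ++ S.bitsWord w W i (j + 1)) := by
  classical
  obtain ⟨k, hk, hp⟩ := sweepList_check w hW hi hj hx (h := h)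
  have := hr.move hk rfl
  rw [bitsWord_succ, ← List.append_assoc]
  simp only [hp] at this
  exact this

theorem Swept.checkRow {i h p : ℕ} {o : List Output} (hW : W ≠ 0) (hi : i < S.columns ^ W)
    {x : InputCell Γ} (hx : x = inputCell w (S.value W i (some S.head)))
    (hr : S.Swept w (.check x (S.ctl i) none) p (S.cells W i 0 h) o) (j : ℕ)
    (hj : j < S.columns ^ W) :
    S.Swept w (.incCol x (S.ctl i) true) p (S.cells W i j h) (o ++ S.bitsWord w W i (j + 1)) := by
  induction j with
  | zero => exact Swept.checkStep hW hi hj hx (by simpa [bitsWord] using hr)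
  | succ j ih =>
    have := (ih (by omega)).move (sweepList_incCol x (S.ctl i) W i j h)
      (k1 := .check x (S.ctl i) none) (mv := .stay) (y := none) (by
        have : ¬ S.columns ^ W ∣ j + 1 := fun hd => by
          have := Nat.le_of_dvd (by omega) hd
          omega
        simp [this, printMove])
    exact Swept.checkStep hW hi hj hx (by simpa [moveInput] using this)

/-- One row of the output. -/
theorem Swept.row {b : Bool} {i h p : ℕ} {o : List Output} (hW : W ≠ 0) (hi : i < S.columns ^ W)
    (hb : b = true ↔ i = 0) (hr : S.Swept w (.copy b none) p (S.cells W i 0 h) o) :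
    ∃ h p, S.Swept w (.incRow true) p (S.cells W i 0 h) (o ++ S.rowWord w W i) := by
  classical
  have h1 := hr.move (sweepList_copy b W i 0 h hW) rfl
  have h2 := h1.rewind
  obtain ⟨h', p', h3⟩ := Swept.seek 0 _ (S.value_lt W i (some S.head)) (by simpa using h2)
  rw [zero_add] at h3
  have hpos : 0 < S.columns ^ W := by omega
  have h4 := Swept.checkRow hW hi rfl h3 (S.columns ^ W - 1) (by omega)
  have h5 : S.columns ^ W - 1 + 1 = S.columns ^ W := by omega
  have h6 := h4.move (sweepList_incCol _ (S.ctl i) W i _ h')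
      (k1 := .incRow true) (mv := .stay) (y := none) (by simp [h5, printMove])
  rw [h5, cells_pow] at h6
  have hb' : b = decide (i = 0) := by
    cases b <;> simp_all
  refine ⟨h', p', ?_⟩
  simpa [moveInput, rowWord, hb'] using h6

theorem swept_rows (hW : RulerMachine.width w ≠ 0) (i : ℕ)
    (hi : i < S.columns ^ RulerMachine.width w) :
    ∃ h p, S.Swept w (.incRow true) p (S.cells (RulerMachine.width w) i 0 h)
      ((List.range (i + 1)).flatMap (S.rowWord w (RulerMachine.width w))) := by
  induction i with
  | zero => simpa using Swept.row hW hi (by simp) swept_start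
  | succ i ih =>
    obtain ⟨h, p, hr⟩ := ih (by omega)
    have := hr.move (sweepList_incRow _ i 0 h)
      (k1 := .copy false none) (mv := .stay) (y := none) (by
        have : ¬ S.columns ^ RulerMachine.width w ∣ i + 1 := fun hd => by
          have := Nat.le_of_dvd (by omega) hd
          omega
        simp [this, printMove])
    rw [List.range_succ, List.flatMap_append]
    simpa using Swept.row hW hi (by simp) this

variable (S)

theorem logSpaceComputable_encode :
    LogSpaceComputable fun w : List Γ =>
      (S.toKripke w (RulerMachine.width w) (width_ne_zero w)).encode := by
  refine S.printer.logSpaceComputable (d := S.printMove) (fun _ _ => rfl) _ fun w => ?_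
  have hpos : 0 < S.columns ^ RulerMachine.width w := pow_pos S.columns_pos _
  obtain ⟨h, p, hr⟩ := swept_rows (S := S) (width_ne_zero w)
    (S.columns ^ RulerMachine.width w - 1) (by omega)
  rw [Nat.sub_add_cancel hpos, Swept, sweepList_incRow, Nat.sub_add_cancel hpos] at hr
  refine ⟨_, hr, by simp only [dvd_refl, decide_true]; rfl, ?_⟩
  rw [encode_toKripke]

end RegisterSystem

/-! ### Stacks as numbers -/

/-- The digits of `L` in base `b` are the codes of the symbols on the stack `f`. -/
def IsStack {A : Type} (b : ℕ) (enc : A → ℕ) (f : ℕ → A) (L : ℕ) : Prop :=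
  ∀ z, L / b ^ z % b = enc (f z)

namespace IsStack

variable {A : Type} {b : ℕ} {enc : A → ℕ} {f g : ℕ → A} {L : ℕ}

theorem push {a : A} (h : IsStack b enc f L) (ha : enc a < b) (h0 : g 0 = a)
    (hg : ∀ z, g (z + 1) = f z) : IsStack b enc g (b * L + enc a) := by
  rintro (_ | z)
  · simp [h0, Nat.mod_eq_of_lt ha]
  · rw [hg, ← h z, pow_succ', ← Nat.div_div_eq_div_mul, Nat.mul_add_div (by omega),
      Nat.div_eq_of_lt ha, add_zero]

theorem eq_push (h : IsStack b enc f L) : L = b * (L / b) + enc (f 0) := by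
  rw [← h 0, pow_zero, Nat.div_one, Nat.div_add_mod]

theorem pop {d : ℕ} (h : IsStack b enc f (b * L + d)) (hd : d < b) (hg : ∀ z, g z = f (z + 1)) :
    IsStack b enc g L ∧ d = enc (f 0) := by
  constructor
  · intro z
    rw [hg, ← h (z + 1), pow_succ', ← Nat.div_div_eq_div_mul, Nat.mul_add_div (by omega),
      Nat.div_eq_of_lt hd, add_zero]
  · rw [← h 0, pow_zero, Nat.div_one, Nat.mul_add_mod, Nat.mod_eq_of_lt hd]

theorem eq_zero_of_digits (hb : 2 ≤ b) (L : ℕ) (h : ∀ z, L / b ^ z % b = 0) : L = 0 := by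
  induction L using Nat.strong_induction_on with
  | _ L ih =>
    by_contra hL
    have h1 := ih (L / b) (Nat.div_lt_self (by omega) hb) fun z => by
      rw [Nat.div_div_eq_div_mul, ← pow_succ']
      exact h (z + 1)
    have h2 := h 0
    have h3 := Nat.div_add_mod L b
    rw [pow_zero, Nat.div_one] at h2
    rw [h1, h2] at h3
    omega

/-- The zero digit acts as the blank: a stack blank from depth n on has no digits there. -/
theorem lt_pow (hb : 2 ≤ b) (h : IsStack b enc f L) {n : ℕ} (hn : ∀ z, n ≤ z → enc (f z) = 0) :
    L < b ^ n := by
  have := eq_zero_of_digits hb (L / b ^ n) fun z => by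
    rw [Nat.div_div_eq_div_mul, ← pow_add, h, hn _ (by omega)]
  rwa [Nat.div_eq_zero_iff_lt (by positivity)] at this

end IsStack

namespace NTM

variable {Γ : Type} (M : NTM Γ)

instance : Finite M.State := M.finState
instance : Finite M.Work := M.finWork
instance : Nonempty M.Work := ⟨M.blank⟩

instance : Finite HeadMove := by
  let f : HeadMove → Fin 3
    | .left => 0
    | .stay => 1
    | .right => 2
  refine Finite.of_injective f fun a b h => ?_
  cases a <;> cases b <;> simp_all [f]

instance {Q A : Type} {k : ℕ} [Finite Q] [Finite A] : Finite (Action Q A k) := by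
  let f : Action Q A k → Q × HeadMove × (Fin k → A) × (Fin k → HeadMove) :=
    fun a => (a.state, a.inputMove, a.write, a.workMove)
  refine Finite.of_injective f fun a b h => ?_
  cases a
  cases b
  simp_all [f]

/-! ### Turing machines as register systems -/

/-- The base of the numbers that represent the work tapes. -/
noncomputable def radix : ℕ := Nat.card M.Work + 1

/-- The added 1 in `radix` keeps the base above 1 even if blank is the only work symbol. -/
theorem two_le_radix : 2 ≤ M.radix := Nat.succ_le_succ (Nat.card_pos (α := M.Work))

/-- Giving the blank the digit 0 makes an empty tape half the number 0, as the start of a register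
system requires. -/
theorem exists_digit : ∃ enc : M.Work → ℕ,
    Function.Injective enc ∧ enc M.blank = 0 ∧ ∀ a, enc a < M.radix := by
  have : NeZero (Nat.card M.Work) := ⟨Nat.card_pos.ne'⟩
  let e := Finite.equivFin M.Work
  let e' := e.trans (Equiv.swap (e M.blank) 0)
  exact ⟨fun a => e' a, fun a b h => e'.injective (Fin.ext h), by simp [e'],
    fun a => Nat.lt_succ_of_lt (e' a).2⟩

noncomputable def digit : M.Work → ℕ := M.exists_digit.choose

theorem digit_injective : Function.Injective M.digit := M.exists_digit.choose_spec.1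

theorem digit_blank : M.digit M.blank = 0 := M.exists_digit.choose_spec.2.1

theorem digit_lt (a : M.Work) : M.digit a < M.radix := M.exists_digit.choose_spec.2.2 a

/-- The control state, the scanned symbols, and the action that led there. -/
abbrev RegCtl : Type :=
  M.State × (Fin M.tapes → M.Work) × Option (Action M.State M.Work M.tapes)

/-- The position of the input head, and for each tape the parts to the left (`false`) and to the
right (`true`) of the head. -/
abbrev RegName : Type := Option (Fin M.tapes × Bool)

noncomputable def pushOp (a : M.Work) : RegOp M.radix :=
  (false, Fin.ofNat _ M.radix, Fin.ofNat _ (M.digit a))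

noncomputable def popOp (a : M.Work) : RegOp M.radix :=
  (true, Fin.ofNat _ M.radix, Fin.ofNat _ (M.digit a))

theorem pushOp_rel {a : M.Work} {x y : ℕ} :
    (M.pushOp a).Rel x y ↔ y = M.radix * x + M.digit a := by
  have := M.digit_lt a
  simp [pushOp, RegOp.Rel, Nat.mod_eq_of_lt (show M.radix < M.radix + 2 by omega),
    Nat.mod_eq_of_lt (show M.digit a < M.radix + 2 by omega)]

theorem popOp_rel {a : M.Work} {x y : ℕ} :
    (M.popOp a).Rel x y ↔ x = M.radix * y + M.digit a := by
  have := M.digit_lt a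
  simp [popOp, RegOp.Rel, Nat.mod_eq_of_lt (show M.radix < M.radix + 2 by omega),
    Nat.mod_eq_of_lt (show M.digit a < M.radix + 2 by omega)]

-- Moving a work head pushes the written symbol on one stack and pops the other. The argument `s` is
-- the guess, in the target control state, of the symbols scanned next; the pop verifies it. A head
-- that stays needs no pop, and `regRule` compares the guess with the written symbol.
open Classical in
noncomputable def regOps (x : InputCell Γ) (a : Action M.State M.Work M.tapes)
    (s : Fin M.tapes → M.Work) : M.RegName → RegOp M.radix
  | none => match a.inputMove with
    | .left => if x = .leftEnd then RegOp.keep _ else (true, 1, 1)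
    | .stay => RegOp.keep _
    | .right => if x = .rightEnd then RegOp.keep _ else (false, 1, 1)
  | some (i, false) => match a.workMove i with
    | .left => M.popOp (s i)
    | .stay => RegOp.keep _
    | .right => M.pushOp (a.write i)
  | some (i, true) => match a.workMove i with
    | .left => M.pushOp (a.write i)
    | .stay => RegOp.keep _
    | .right => M.popOp (s i)

open Classical in
noncomputable def regRule (x : InputCell Γ) (f g : M.RegCtl) :
    Option (M.RegName → RegOp M.radix) :=
  match g.2.2 with
  | none => if g.1 = f.1 ∧ g.2.1 = f.2.1 then some fun _ => RegOp.keep _ else none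
  | some a =>
    if a ∈ M.trans f.1 x f.2.1 ∧ g.1 = a.state ∧
      ∀ i, a.workMove i = .stay → g.2.1 i = a.write i
    then some (M.regOps x a g.2.1) else none

variable {M} in
theorem regRule_none_iff {x : InputCell Γ} {f : M.RegCtl} {q : M.State} {s : Fin M.tapes → M.Work}
    {ops : M.RegName → RegOp M.radix} :
    M.regRule x f (q, s, none) = some ops ↔
      (q = f.1 ∧ s = f.2.1) ∧ (fun _ => RegOp.keep _) = ops := by
  simp only [regRule, Option.ite_none_right_eq_some, Option.some.injEq]

variable {M} in
theorem regRule_some_iff {x : InputCell Γ} {f : M.RegCtl} {q : M.State} {s : Fin M.tapes → M.Work}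
    {a : Action M.State M.Work M.tapes} {ops : M.RegName → RegOp M.radix} :
    M.regRule x f (q, s, some a) = some ops ↔
      (a ∈ M.trans f.1 x f.2.1 ∧ q = a.state ∧ ∀ i, a.workMove i = .stay → s i = a.write i) ∧
        M.regOps x a s = ops := by
  simp only [regRule]
  split <;> simp_all

noncomputable def toRegisterSystem (C : ℕ) : RegisterSystem Γ where
  Ctl := M.RegCtl
  Reg := M.RegName
  finCtl := inferInstance
  finReg := inferInstance
  -- Head and written cells lie within C (log + 1) of the origin, so a stack has at most 2 C (log +
  -- 1) symbols, that is 2 C per column. The additional 1 leaves room for the input position even if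
  -- `C` is 0.
  base := M.radix ^ (2 * C + 1)
  base_pos := pow_pos (by have := M.two_le_radix; omega) _
  bound := M.radix
  head := none
  start := (M.start, fun _ => M.blank, none)
  accept := {f | f.1 ∈ M.accept}
  rule := M.regRule
  idle := fun x f => ⟨(f.1, f.2.1, none), by simp [regRule]⟩

/-- The registers represent the configuration. -/
structure Represents (c : Config M.State M.Work M.tapes) (d : M.RegCtl × (M.RegName → ℕ)) :
    Prop where
  state : d.1.1 = c.state
  scanned : d.1.2.1 = c.scanned
  head : d.2 none = c.inputHead
  left : ∀ i, IsStack M.radix M.digit (fun z => c.tape i (c.head i - 1 - z)) (d.2 (some (i, false)))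
  right : ∀ i, IsStack M.radix M.digit (fun z => c.tape i (c.head i + 1 + z)) (d.2 (some (i, true)))

/-! ### Steps of the machine and of its registers -/

variable {M} {w : List Γ}

theorem moveInput_rel (h : ℕ) (hh : h ≤ w.length + 1) (a : Action M.State M.Work M.tapes)
    (s : Fin M.tapes → M.Work) (y : ℕ) :
    (M.regOps (inputCell w h) a s none).Rel h y ↔ y = moveInput w.length h a.inputMove := by
  cases hm : a.inputMove with
  | stay => simp [regOps, hm, RegOp.keep_rel, moveInput]
  | left =>
    have : inputCell w h = .leftEnd ↔ h = 0 :=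
      ⟨guessMachine.eq_zero_of_leftEnd, fun h => by rw [h]; rfl⟩
    simp only [regOps, hm, this, moveInput]
    split
    · rw [RegOp.keep_rel]
      omega
    · simp [RegOp.Rel]
      omega
  | right =>
    simp only [regOps, hm, RulerMachine.inputCell_eq_rightEnd_iff, moveInput]
    split
    · rw [RegOp.keep_rel]
      omega
    · simp [RegOp.Rel]
      omega

section Perform

variable (c : Config M.State M.Work M.tapes) (a : Action M.State M.Work M.tapes)
  (i : Fin M.tapes) (n : ℕ)

theorem tape_perform_of_ne {z : ℤ} (hz : z ≠ c.head i) :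
    (c.perform n a).tape i z = c.tape i z := Function.update_of_ne hz _ _

theorem tape_perform_head : (c.perform n a).tape i (c.head i) = a.write i :=
  Function.update_self _ _ _

/-- The effect of one action on one tape. -/
theorem represents_tape {c : Config M.State M.Work M.tapes}
    {a : Action M.State M.Work M.tapes} {x : InputCell Γ} {s : Fin M.tapes → M.Work}
    {i : Fin M.tapes} {n L R L' R' : ℕ}
    (hL : IsStack M.radix M.digit (fun z => c.tape i (c.head i - 1 - z)) L)
    (hR : IsStack M.radix M.digit (fun z => c.tape i (c.head i + 1 + z)) R)
    (hs : a.workMove i = .stay → s i = a.write i)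
    (hL' : (M.regOps x a s (some (i, false))).Rel L L')
    (hR' : (M.regOps x a s (some (i, true))).Rel R R') :
    s i = (c.perform n a).scanned i ∧
      IsStack M.radix M.digit (fun z => (c.perform n a).tape i ((c.perform n a).head i - 1 - z)) L' ∧
      IsStack M.radix M.digit (fun z => (c.perform n a).tape i ((c.perform n a).head i + 1 + z)) R' := by
  have hhead : (c.perform n a).head i = moveWork (c.head i) (a.workMove i) := rfl
  simp only [Config.scanned, hhead]
  cases hm : a.workMove i with
  | stay =>
    simp only [regOps, hm, RegOp.keep_rel] at hL' hR'
    subst hL' hR'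
    simp only [moveWork]
    refine ⟨by rw [tape_perform_head, hs hm], fun z => ?_, fun z => ?_⟩
    · beta_reduce
      rw [tape_perform_of_ne _ _ _ _ (by omega)]
      exact hL z
    · beta_reduce
      rw [tape_perform_of_ne _ _ _ _ (by omega)]
      exact hR z
  | right =>
    simp only [regOps, hm, pushOp_rel, popOp_rel] at hL' hR'
    subst hL' hR'
    simp only [moveWork]
    obtain ⟨h1, h2⟩ := hR.pop (M.digit_lt _)
      (g := fun z => (c.perform n a).tape i (c.head i + 1 + 1 + z)) fun z => by
        rw [tape_perform_of_ne _ _ _ _ (by omega)]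
        congr 1
        push_cast
        ring
    refine ⟨?_, hL.push (M.digit_lt _) ?_ fun z => ?_, h1⟩
    · rw [tape_perform_of_ne _ _ _ _ (by omega)]
      simpa using M.digit_injective h2
    · simp [tape_perform_head]
    · rw [tape_perform_of_ne _ _ _ _ (by push_cast; omega)]
      congr 1
      push_cast
      ring
  | left =>
    simp only [regOps, hm, pushOp_rel, popOp_rel] at hL' hR'
    subst hL' hR'
    simp only [moveWork]
    obtain ⟨h1, h2⟩ := hL.pop (M.digit_lt _)
      (g := fun z => (c.perform n a).tape i (c.head i - 1 - 1 - z)) fun z => by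
        rw [tape_perform_of_ne _ _ _ _ (by omega)]
        congr 1
        push_cast
        ring
    refine ⟨?_, h1, hR.push (M.digit_lt _) ?_ fun z => ?_⟩
    · rw [tape_perform_of_ne _ _ _ _ (by omega)]
      simpa using M.digit_injective h2
    · simp [tape_perform_head]
    · rw [tape_perform_of_ne _ _ _ _ (by push_cast; omega)]
      congr 1
      push_cast
      ring

end Perform

/-- A step of the register system that performs an action. -/
theorem Represents.perform {c : Config M.State M.Work M.tapes} {a : Action M.State M.Work M.tapes}
    {d : M.RegCtl × (M.RegName → ℕ)} (h : M.Represents c d) (hh : c.inputHead ≤ w.length + 1)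
    {s : Fin M.tapes → M.Work} {r : M.RegName → ℕ} {y : Option (Action M.State M.Work M.tapes)}
    (hs : ∀ i, a.workMove i = .stay → s i = a.write i)
    (hr : ∀ j, (M.regOps (inputCell w (d.2 none)) a s j).Rel (d.2 j) (r j)) :
    M.Represents (c.perform w.length a) ((a.state, s, y), r) := by
  have key := fun i => represents_tape (n := w.length) (h.left i) (h.right i) (hs i)
    (hr (some (i, false))) (hr (some (i, true)))
  refine ⟨rfl, funext fun i => (key i).1, ?_, fun i => (key i).2.1, fun i => (key i).2.2⟩
  have := hr none
  rw [h.head, moveInput_rel _ hh] at this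
  exact this

/-- The scanned symbols are guessed correctly by taking those of the next configuration; a pop is
then division by the radix. -/
theorem Represents.exists_step {C : ℕ} {c c' : Config M.State M.Work M.tapes}
    {d : M.RegCtl × (M.RegName → ℕ)} (h : M.Represents c d) (hh : c.inputHead ≤ w.length + 1)
    (hc : M.Step w c c') : ∃ d', (M.toRegisterSystem C).Step w d d' ∧ M.Represents c' d' := by
  obtain ⟨a, ha, rfl⟩ := hc
  let s := (c.perform w.length a).scanned
  let r : M.RegName → ℕ
    | none => moveInput w.length c.inputHead a.inputMove
    | some (i, false) => match a.workMove i with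
      | .left => d.2 (some (i, false)) / M.radix
      | .stay => d.2 (some (i, false))
      | .right => M.radix * d.2 (some (i, false)) + M.digit (a.write i)
    | some (i, true) => match a.workMove i with
      | .left => M.radix * d.2 (some (i, true)) + M.digit (a.write i)
      | .stay => d.2 (some (i, true))
      | .right => d.2 (some (i, true)) / M.radix
  have hs : ∀ i, a.workMove i = .stay → s i = a.write i := by
    intro i hi
    change (c.perform w.length a).tape i (moveWork (c.head i) (a.workMove i)) = _
    rw [hi]
    exact tape_perform_head _ _ _ _
  have hr : ∀ j, (M.regOps (inputCell w (d.2 none)) a s j).Rel (d.2 j) (r j) := by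
    rintro (_ | ⟨i, _ | _⟩)
    · rw [h.head, moveInput_rel _ hh]
    · cases hm : a.workMove i with
      | left =>
        have h1 : s i = c.tape i (c.head i - 1 - (0 : ℕ)) := by
          change (c.perform w.length a).tape i (moveWork (c.head i) (a.workMove i)) = _
          rw [hm, moveWork, tape_perform_of_ne _ _ _ _ (by omega)]
          simp
        simp only [regOps, hm, popOp_rel, r, h1]
        exact (h.left i).eq_push
      | stay => simp [regOps, hm, RegOp.keep_rel, r]
      | right => simp [regOps, hm, pushOp_rel, r]
    · cases hm : a.workMove i with
      | left => simp [regOps, hm, pushOp_rel, r]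
      | stay => simp [regOps, hm, RegOp.keep_rel, r]
      | right =>
        have h1 : s i = c.tape i (c.head i + 1 + (0 : ℕ)) := by
          change (c.perform w.length a).tape i (moveWork (c.head i) (a.workMove i)) = _
          rw [hm, moveWork, tape_perform_of_ne _ _ _ _ (by omega)]
          simp
        simp only [regOps, hm, popOp_rel, r, h1]
        exact (h.right i).eq_push
  refine ⟨((a.state, s, some a), r), ⟨_, ?_, hr⟩, h.perform hh hs hr⟩
  change M.regRule (inputCell w (d.2 none)) d.1 (a.state, s, some a) = _
  rw [← h.head, ← h.state, ← h.scanned] at ha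
  simp only [regRule]
  rw [if_pos ⟨ha, rfl, hs⟩]
  rfl

/-- The new control state records the action, so the operations are determined by it. Without an
action the step idles, and the configuration does not change. -/
theorem Represents.of_step {C : ℕ} {c : Config M.State M.Work M.tapes}
    {d d' : M.RegCtl × (M.RegName → ℕ)} (h : M.Represents c d) (hh : c.inputHead ≤ w.length + 1)
    (hd : (M.toRegisterSystem C).Step w d d') :
    M.Represents c d' ∨ ∃ c', M.Step w c c' ∧ M.Represents c' d' := by
  obtain ⟨⟨q, s, _ | a⟩, r⟩ := d'
  · obtain ⟨ops, hops, hr⟩ := hd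
    obtain ⟨⟨rfl, rfl⟩, rfl⟩ :=
      (regRule_none_iff (x := inputCell w (d.2 none))).1 hops
    obtain rfl : r = d.2 := funext fun j => RegOp.keep_rel.1 (hr j)
    exact .inl ⟨h.state, h.scanned, h.head, h.left, h.right⟩
  · obtain ⟨ops, hops, hr⟩ := hd
    obtain ⟨⟨ha, rfl, hs⟩, rfl⟩ := regRule_some_iff.1 hops
    refine .inr ⟨_, ⟨a, ?_, rfl⟩, h.perform hh hs hr⟩
    change a ∈ M.trans d.1.1 (inputCell w (d.2 none)) d.1.2.1 at ha
    rwa [h.head, h.state, h.scanned] at ha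

theorem inputHead_le {c : Config M.State M.Work M.tapes} (h : M.Reachable w c) :
    c.inputHead ≤ w.length + 1 := by
  induction h with
  | refl => exact Nat.zero_le _
  | tail _ h ih =>
    obtain ⟨a, -, rfl⟩ := h
    change moveInput _ _ a.inputMove ≤ _
    cases a.inputMove <;> simp only [moveInput] <;> omega

/-- Only scanned cells are ever written, and the head has not been that far out. -/
theorem tape_eq_blank {s : ℕ} (hs : ∀ c, M.Reachable w c → c.Within s)
    {c : Config M.State M.Work M.tapes} (h : M.Reachable w c) (i : Fin M.tapes) (z : ℤ)
    (hz : s < |z|) : c.tape i z = M.blank := by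
  induction h with
  | refl => rfl
  | tail hc h ih =>
    obtain ⟨a, -, rfl⟩ := h
    rw [tape_perform_of_ne, ih]
    rintro rfl
    have := hs _ hc i
    omega

theorem represents_start (C : ℕ) : M.Represents (Config.start M.start M.blank)
    ((M.toRegisterSystem C).start, fun _ => 0) := by
  refine ⟨rfl, rfl, rfl, fun i z => ?_, fun i z => ?_⟩ <;>
  · rw [Nat.zero_div, Nat.zero_mod]
    exact M.digit_blank.symm

/-- Space is bounded on every reachable configuration, so all cells deeper than 2 C (log + 1) from
the head are blank, and the stacks are bounded by `IsStack.lt_pow`. The number of columns is at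
least log + 1. -/
theorem Represents.fits {C : ℕ}
    (hC : ∀ c, M.Reachable w c → c.Within (C * (Nat.log 2 w.length + 1)))
    {c : Config M.State M.Work M.tapes} (hc : M.Reachable w c) {d : M.RegCtl × (M.RegName → ℕ)}
    (h : M.Represents c d) : (M.toRegisterSystem C).Fits (RulerMachine.width w) d := by
  have hb := M.two_le_radix
  have hW : Nat.log 2 w.length + 1 ≤ RulerMachine.width w := by
    rw [RulerMachine.width, Nat.succ_le_iff, Nat.lt_size]
    rcases Nat.eq_zero_or_pos w.length with h0 | h0
    · simp [h0]
    · exact (Nat.pow_log_le_self 2 h0.ne').trans (by omega)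
  have hpow : M.radix ^ (2 * (C * (Nat.log 2 w.length + 1))) ≤
      (M.radix ^ (2 * C + 1)) ^ RulerMachine.width w := by
    rw [← pow_mul]
    refine Nat.pow_le_pow_right (by omega) ?_
    have := Nat.mul_le_mul_left (2 * C) hW
    rw [add_mul, one_mul, ← mul_assoc]
    omega
  have hhead := fun i => abs_le.1 (hC c hc i)
  rintro (_ | ⟨i, _ | _⟩)
  · change d.2 none < (M.radix ^ (2 * C + 1)) ^ RulerMachine.width w
    have h1 := inputHead_le hc
    have h2 : w.length + 1 < 2 ^ RulerMachine.width w := Nat.lt_size_self _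
    have h3 : 2 ^ RulerMachine.width w ≤ (M.radix ^ (2 * C + 1)) ^ RulerMachine.width w :=
      Nat.pow_le_pow_left (hb.trans (Nat.le_self_pow (by omega) _)) _
    rw [h.head]
    omega
  · refine ((h.left i).lt_pow hb fun z hz => ?_).trans_le hpow
    rw [tape_eq_blank hC hc, M.digit_blank]
    have := hhead i
    rw [lt_abs]
    omega
  · refine ((h.right i).lt_pow hb fun z hz => ?_).trans_le hpow
    rw [tape_eq_blank hC hc, M.digit_blank]
    have := hhead i
    rw [lt_abs]
    omega

theorem accepts_toRegisterSystem_iff {C : ℕ}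
    (hC : ∀ c, M.Reachable w c → c.Within (C * (Nat.log 2 w.length + 1))) :
    (M.toRegisterSystem C).Accepts w (RulerMachine.width w) ↔ w ∈ M.language := by
  constructor
  · rintro ⟨d, hd, hacc⟩
    have : ∃ c, M.Reachable w c ∧ M.Represents c d := by
      clear hacc
      induction hd with
      | refl => exact ⟨_, .refl, represents_start C⟩
      | tail _ h ih =>
        obtain ⟨c, hc, hr⟩ := ih
        rcases hr.of_step (inputHead_le hc) h.1 with hr' | ⟨c', hc', hr'⟩
        · exact ⟨c, hc, hr'⟩
        · exact ⟨c', hc.tail hc', hr'⟩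
    obtain ⟨c, hc, hr⟩ := this
    refine ⟨c, hc, ?_⟩
    rw [← hr.state]
    exact hacc
  · rintro ⟨c, hc, hacc⟩
    have : ∃ d, Relation.ReflTransGen (fun c d => (M.toRegisterSystem C).Step w c d ∧
        (M.toRegisterSystem C).Fits (RulerMachine.width w) d)
        ((M.toRegisterSystem C).start, fun _ => 0) d ∧ M.Represents c d := by
      clear hacc
      induction hc with
      | refl => exact ⟨_, .refl, represents_start C⟩
      | tail hc h ih =>
        obtain ⟨d, hd, hr⟩ := ih
        obtain ⟨d', hd', hr'⟩ := hr.exists_step (C := C) (inputHead_le hc) h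
        exact ⟨d', hd.tail ⟨hd', hr'.fits hC (hc.tail h)⟩, hr'⟩
    obtain ⟨d, hd, hr⟩ := this
    refine ⟨d, hd, ?_⟩
    change d.1.1 ∈ M.accept
    rwa [hr.state]

end NTM

end LogSpace

/-! ### The theorem -/

/-- Eventually the proposition holds. -/
def HyperBody.eventually : HyperBody Unit := .untl .tru (.atom () 0)

theorem HyperBody.holds_eventually_iff (t : ℕ → Set Unit) :
    HyperBody.eventually.Holds t ↔ ∃ i, () ∈ t i := by
  rw [eventually, holds_untl]
  simp [holds_tru, holds_atom]

/-- With this matrix a repair exists if and only if a labelled node is reachable, and the labelled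
nodes are the accepting ones. The system depends on the machine and its space constant only, so one
transducer serves all inputs. -/
theorem acyclicRepair_nlHard {f : HyperLTL Unit} (hc : f.Closed) (hf : f.IsAStar ∨ f.IsEAStar)
    (hm : f.matrix = HyperBody.eventually) : (acyclicRepair f).NLHard := by
  rintro Γ _ L ⟨M, ⟨C, hC⟩, rfl⟩
  let S := M.toRegisterSystem C
  refine ⟨_, S.logSpaceComputable_encode, fun w => ⟨⟨_, S.toKripke w (LogSpace.RulerMachine.width w)
    (LogSpace.RegisterSystem.width_ne_zero w), LogSpace.RegisterSystem.toKripke_acyclic⟩, rfl, ?_⟩⟩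
  rw [← LogSpace.NTM.accepts_toRegisterSystem_iff (hC w),
    ← LogSpace.RegisterSystem.toKripke_path_iff
      (hW := LogSpace.RegisterSystem.width_ne_zero w)]
  have hac : (S.toKripke w (LogSpace.RulerMachine.width w)
    (LogSpace.RegisterSystem.width_ne_zero w)).Acyclic := LogSpace.RegisterSystem.toKripke_acyclic
  change _ ↔ (S.toKripke w (LogSpace.RulerMachine.width w)
    (LogSpace.RegisterSystem.width_ne_zero w)).Repairable f
  rw [hac.repairable_iff hc hf]
  simp only [hm, HyperBody.holds_eventually_iff]
  rfl

theorem mainTheorem8 :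
    (∀ (AP : Type) [Finite AP] (f : HyperLTL AP), f.Closed → f.IsAStar →
      (acyclicRepair f).InNL) ∧
    (∃ (AP : Type) (_ : Finite AP) (f : HyperLTL AP), f.Closed ∧ f.IsAStar ∧
      (acyclicRepair f).NLHard) ∧
    (∀ (AP : Type) [Finite AP] (f : HyperLTL AP), f.Closed → f.IsEAStar →
      (acyclicRepair f).InNL) ∧
    (∃ (AP : Type) (_ : Finite AP) (f : HyperLTL AP), f.Closed ∧ f.IsEAStar ∧
      (acyclicRepair f).NLHard) := by
  have hall : (HyperLTL.all 0 (.body .eventually)).Closed := by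
    simp [HyperLTL.Closed, HyperLTL.freeVars, HyperBody.eventually, HyperBody.vars]
  have hex : (HyperLTL.ex 0 (.body .eventually)).Closed := by
    simp [HyperLTL.Closed, HyperLTL.freeVars, HyperBody.eventually, HyperBody.vars]
  refine ⟨fun AP _ f hc hf => acyclicRepair_inNL hc (.inl hf),
    ⟨Unit, inferInstance, _, hall, trivial, acyclicRepair_nlHard hall (.inl trivial) rfl⟩,
    fun AP _ f hc hf => acyclicRepair_inNL hc (.inr hf),
    ⟨Unit, inferInstance, _, hex, trivial, acyclicRepair_nlHard hex (.inr trivial) rfl⟩⟩
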